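/- **Setting.** Let $H$ be a separable complex Hilbert space, $\psi\in H$ a unit vector, $H_c(t)$ a norm-continuous family of bounded self-adjoint control Hamiltonians, $L_1,\dots,L_R$ bounded operators on $H$, and $\Theta\subseteq\mathbb R^d$ open. For $\theta\in\Theta$ let $V(\theta)\in\mathbb C^{R\times R}$ be unitary and $\Lambda(\theta)=\mathrm{diag}(\gamma_1(\theta),\dots,\gamma_R(\theta))$ with $\gamma_k(\theta)>0$ having partial derivatives on $\Theta$. Put $\Gamma=V\Lambda V^\dagger$, $\zeta=V\Lambda^{1/2}$, $J_k=\sum_iV_{ik}L_i$, and let $\rho(t)=\rho(\theta;t)=\mathcal T\exp\big(\int_0^t\mathcal L_{\theta,s}\,ds\big)(|\psi\rangle\langle\psi|)$ be the solution of the Lindblad equation with generator $$\mathcal L_{\theta,t}(\rho)=-i[H_c(t),\rho]+\sum_{i,j}\Gamma_{ij}(\theta)\Big(L_i\rho L_j^\dagger-\tfrac12\{L_j^\dagger L_i,\rho\}\Big).$$ Its canonical collisional purification is $$\Psi(\theta;t)=\mathcal T\exp\Big(-i\int_0^t\Big[H_c(s)+\sum_k\sqrt{\gamma_k}\,\big(J_k\otimes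 e_k^\dagger(s)+J_k^\dagger\otimes e_k(s)\big)\Big]ds\Big)(\psi\otimes\mathrm{vac}),\qquad [e_k(s),e_l^\dagger(s')]=\delta_{kl}\,\delta(s-s'),$$ that is, the vector in $H\otimes\mathrm{Fock}_{\rm sym}(L^2(\mathbb R_+;\mathbb C^R))$ solving the quantum stochastic equation $d\Psi=\big(-iH_c-\tfrac12\sum_k\gamma_kJ_k^\dagger J_k\big)\Psi\,dt-i\sum_k\sqrt{\gamma_k}\,J_k\,dB_k^\dagger\Psi$ with $\Psi(\theta;0)=\psi\otimes\mathrm{vac}$. Let $(F_Q)_{\alpha\beta}(t)=4\,\mathrm{Re}\big(\langle\partial_\alpha\Psi,\partial_\beta\Psi\rangle-\langle\partial_\alpha\Psi,\Psi\rangle\langle\Psi,\partial_\beta\Psi\rangle\big)$ be its quantum Fisher information matrix at $\theta$, and let $\mathcal K_{\alpha\beta}=4(\partial_\beta\zeta)(\partial_\alpha\zeta)^\dagger$ be the dissipation kernel. **Proposition (Eigenrate QCRB).** Suppose that the parameters enter only through the eigenrates: $\partial_\alpha V=0$ on $\Theta$ for all $\alpha$. Then at every $\theta\in\Theta$: 1.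 $\mathcal K_{\alpha\beta}=(\partial_\beta\Gamma)\,\Gamma^{-1}\,(\partial_\alpha\Gamma)$ for all $\alpha,\beta$. 2. For every $t\ge0$, $\Psi(\theta;t)$ is a purification of $\rho(\theta;t)$ with partial derivatives in the parameters, and $F_Q$ is differentiable in time (from the right at $t=0$) with $$(\dot F_Q)_{\alpha\beta}(t)=4\sum_{k=1}^R(\partial_\alpha\sqrt{\gamma_k})(\partial_\beta\sqrt{\gamma_k})\,\mathrm{Tr}\big(J_k^\dagger J_k\,\rho(t)\big).$$ 3. Consider $\nu$ i.i.d. repetitions, each of duration $t\ge 0$, with total time $T=\nu t$: in each repetition $\rho(\theta;t)$ is measured with the same POVM $\{\Pi_x\}$ with finitely many outcomes. Let $\check\theta$ be estimators, functions of the $\nu$ outcomes, that are unbiased near $\theta$ (or only locally unbiased at $\theta$: $\mathbb E_\theta[\check\theta_\beta]=\theta_\beta$ and $\partial_\alpha\mathbb E_\theta[\check\theta_\beta]=\delta_{\alpha\beta}$), and let $\Sigma_{\alpha\beta}=\mathbb E_\theta[(\check\theta_\alpha-\theta_\alpha)(\check\theta_\beta-\theta_\beta)]$. Then $\Sigma_{\alpha\alpha}>0$,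 and the precision $\tau_\alpha=1/\Sigma_{\alpha\alpha}$ satisfies $\tau_\alpha\le\nu\,(F_Q)_{\alpha\alpha}(t)$ and $$\tau_\alpha\le T\sum_{k=1}^R\frac{(\partial_\alpha\gamma_k)^2}{\gamma_k}\,\|J_k\|^2,$$ where $\|\cdot\|$ is the operator norm. -/

import Mathlib

open MeasureTheory

noncomputable section

namespace CollisionalQFI

/-! ### Partial derivatives and matrices of partial derivatives -/

/-- The coordinate direction `e_α` of the parameter space `ℝ^d`. -/
abbrev dir {d : ℕ} (α : Fin d) : Fin d → ℝ := Pi.single α 1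

/-- The partial derivative `∂_α f (θ)`. -/
def pd {d : ℕ} {E : Type*} [NormedAddCommGroup E] [NormedSpace ℝ E]
    (α : Fin d) (f : (Fin d → ℝ) → E) (θ : Fin d → ℝ) : E :=
  lineDeriv ℝ f θ (dir α)

/-- The partial derivative `∂_α f (θ)` exists. -/
def HasPd {d : ℕ} {E : Type*} [NormedAddCommGroup E] [NormedSpace ℝ E]
    (α : Fin d) (f : (Fin d → ℝ) → E) (θ : Fin d → ℝ) : Prop :=
  LineDifferentiableAt ℝ f θ (dir α)

/-- The entrywise partial derivative `∂_α M (θ)` of a complex matrix function. -/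
def pdMatrix {d R : ℕ} (α : Fin d) (M : (Fin d → ℝ) → Matrix (Fin R) (Fin R) ℂ)
    (θ : Fin d → ℝ) : Matrix (Fin R) (Fin R) ℂ :=
  Matrix.of fun i j => pd α (fun θ' => M θ' i j) θ

/-! ### Time-ordered exponentials -/

/-- The `n`-th term of the Dyson series: the `n`-fold time-ordered integral
`∫_{s ≤ τ₁ ≤ ⋯ ≤ τₙ ≤ t} A(τₙ) ⋯ A(τ₁) x`. -/
def dysonTerm {E : Type*} [NormedAddCommGroup E] [NormedSpace ℝ E]
    (A : ℝ → E → E) (s : ℝ) (x : E) : ℕ → ℝ → E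
  | 0, _ => x
  | n + 1, t => ∫ τ in s..t, A τ (dysonTerm A s x n τ)

/-- The time-ordered exponential `𝒯 exp(∫_s^t A(τ) dτ)` of a time-dependent (bounded, linear)
generator `A`, applied to `x`, as the sum of its Dyson series. -/
def timeOrderedExp {E : Type*} [NormedAddCommGroup E] [NormedSpace ℝ E]
    (A : ℝ → E → E) (s t : ℝ) (x : E) : E :=
  ∑' n, dysonTerm A s x n t

/-! ### The quantum Fisher information of a pure-state model -/

/-- The quantum geometric tensor
`⟨∂_α Ψ, ∂_β Ψ⟩ - ⟨∂_α Ψ, Ψ⟩ ⟨Ψ, ∂_β Ψ⟩` of a pure-state model `θ ↦ Ψ(θ)`. -/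
def qgt {d : ℕ} {K : Type*} [NormedAddCommGroup K] [InnerProductSpace ℂ K]
    (Ψ : (Fin d → ℝ) → K) (θ : Fin d → ℝ) (α β : Fin d) : ℂ :=
  inner ℂ (pd α Ψ θ) (pd β Ψ θ) - inner ℂ (pd α Ψ θ) (Ψ θ) * inner ℂ (Ψ θ) (pd β Ψ θ)

/-- The quantum Fisher information matrix `F_Q = 4 Re 𝒬` of a pure-state model. -/
def qfi {d : ℕ} {K : Type*} [NormedAddCommGroup K] [InnerProductSpace ℂ K]
    (Ψ : (Fin d → ℝ) → K) (θ : Fin d → ℝ) : Matrix (Fin d) (Fin d) ℝ :=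
  Matrix.of fun α β => 4 * (qgt Ψ θ α β).re

/-! ### Trace -/

/-- The trace of an operator, computed in the Hilbert basis `b`. -/
def opTrace {H ι : Type*} [NormedAddCommGroup H] [InnerProductSpace ℂ H]
    (b : HilbertBasis ι ℂ H) (A : H →L[ℂ] H) : ℂ :=
  ∑' i, inner ℂ (b i) (A (b i))

/-! ### The bath: symmetric Fock space over `L²(ℝ₊; ℂ^R)` -/

/-- Configurations of bath quanta: a number `n` of quanta and, for each of them, its time bin
`s ∈ ℝ` and its channel `k ∈ {1, …, R}`. -/
abbrev Config (R : ℕ) : Type := Σ n : ℕ, (Fin n → ℝ × Fin R)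

/-- The configurations with positive times, listed from the latest to the earliest quantum. -/
def ordered (R n : ℕ) : Set (Fin n → ℝ × Fin R) :=
  {σ | StrictAnti (fun j => (σ j).1) ∧ ∀ j, 0 < (σ j).1}

/-- The measure on configurations: on the `n`-quanta sector, Lebesgue measure in the times and
counting measure in the channels, on time-ordered configurations. (A symmetric `n`-particle
function is the same thing as a function on ordered configurations.) -/
def fockMeasure (R : ℕ) : Measure (Config R) :=
  Measure.sum fun n : ℕ =>
    ((Measure.pi fun _ : Fin n => (volume : Measure ℝ).prod (Measure.count : Measure (Fin R))).restrict
      (ordered R n)).map (Sigma.mk n)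

/-- The joint Hilbert space of system and bath,
`H ⊗ Fock_sym(L²(ℝ₊; ℂ^R)) = ⨁ₙ L²(ordered n-quanta configurations; H)`. -/
abbrev Joint (H : Type*) [NormedAddCommGroup H] [InnerProductSpace ℂ H] (R : ℕ) : Type _ :=
  Lp H 2 (fockMeasure R)

/-- `Tr_env |Ψ⟩⟨Ψ| = ρ`, tested against all bounded system operators: `Tr(A ρ)` exists as a
convergent sum over the basis and equals `⟨Ψ, (A ⊗ I) Ψ⟩`. -/
def Purifies {H ι : Type*} [NormedAddCommGroup H] [InnerProductSpace ℂ H] {R : ℕ}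
    (b : HilbertBasis ι ℂ H) (Ψ : Joint H R) (ρ : H →L[ℂ] H) : Prop :=
  ∀ A : H →L[ℂ] H, HasSum (fun i => inner ℂ (b i) ((A * ρ) (b i)))
    (∫ σ, inner ℂ (Ψ σ) (A (Ψ σ)) ∂(fockMeasure R))

/-! ### The parametric dissipative model -/

/-- Data of a Markovian process with parametric dissipator: an open parameter domain, local jump
operators `L_i`, the eigenframe `V(θ)` (unitary) and eigenrates `γ_k(θ) > 0` of the dissipation
matrix, a control Hamiltonian and a pure initial state. -/
structure Model (H : Type*) [NormedAddCommGroup H] [InnerProductSpace ℂ H] [CompleteSpace H]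
    (d R : ℕ) where
  /-- the parameter domain -/
  dom : Set (Fin d → ℝ)
  isOpen_dom : IsOpen dom
  /-- the local jump operators -/
  L : Fin R → H →L[ℂ] H
  /-- the eigenframe of the dissipation matrix -/
  V : (Fin d → ℝ) → Matrix (Fin R) (Fin R) ℂ
  V_unitary : ∀ θ ∈ dom, V θ ∈ Matrix.unitaryGroup (Fin R) ℂ
  /-- the eigenrates of the dissipation matrix -/
  γ : (Fin d → ℝ) → Fin R → ℝ
  γ_pos : ∀ θ ∈ dom, ∀ k, 0 < γ θ k
  γ_diff : ∀ θ ∈ dom, ∀ k α, HasPd α (fun θ' => γ θ' k) θ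
  /-- the control Hamiltonian -/
  Hc : ℝ → H →L[ℂ] H
  Hc_selfAdjoint : ∀ t, IsSelfAdjoint (Hc t)
  Hc_continuous : Continuous Hc
  /-- the initial state vector -/
  ψ : H
  ψ_norm : ‖ψ‖ = 1

namespace Model

variable {H : Type*} [NormedAddCommGroup H] [InnerProductSpace ℂ H] [CompleteSpace H] {d R : ℕ}
variable (M : Model H d R)

/-- The dissipation matrix `Γ = V Λ V†`, `Λ = diag(γ_k)`. -/
def Γ (θ : Fin d → ℝ) : Matrix (Fin R) (Fin R) ℂ :=
  M.V θ * Matrix.diagonal (fun k => (M.γ θ k : ℂ)) * (M.V θ).conjTranspose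

/-- The dissipative amplitude `ζ = V Λ^{1/2}`. -/
def ζ (θ : Fin d → ℝ) : Matrix (Fin R) (Fin R) ℂ :=
  M.V θ * Matrix.diagonal (fun k => (Real.sqrt (M.γ θ k) : ℂ))

/-- The dissipation kernel `𝒦_{αβ} = 4 (∂_β ζ)(∂_α ζ)†`. -/
def kernel (θ : Fin d → ℝ) (α β : Fin d) : Matrix (Fin R) (Fin R) ℂ :=
  (4 : ℂ) • (pdMatrix β M.ζ θ * (pdMatrix α M.ζ θ).conjTranspose)

/-- The canonical jump operators `J_k = ∑_i V_{ik} L_i`. -/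
def J (θ : Fin d → ℝ) (k : Fin R) : H →L[ℂ] H := ∑ i, M.V θ i k • M.L i

/-- The generator
`ℒ_{θ,t}(ρ) = -i[H_c(t), ρ] + ∑_{ij} Γ_{ij} (L_i ρ L_j† - ½ {L_j† L_i, ρ})`. -/
def lindbladian (θ : Fin d → ℝ) (t : ℝ) (ρ : H →L[ℂ] H) : H →L[ℂ] H :=
  -(Complex.I • (M.Hc t * ρ - ρ * M.Hc t)) +
    ∑ i, ∑ j, M.Γ θ i j • (M.L i * ρ * star (M.L j) -
      (1 / 2 : ℂ) • (star (M.L j) * M.L i * ρ + ρ * (star (M.L j) * M.L i)))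

/-- The state `ρ(θ;t) = 𝒯 exp(∫_0^t ℒ_{θ,s} ds)(|ψ⟩⟨ψ|)`. -/
def ρ (θ : Fin d → ℝ) (t : ℝ) : H →L[ℂ] H :=
  timeOrderedExp (M.lindbladian θ) 0 t (InnerProductSpace.rankOne ℂ M.ψ M.ψ)

/-- The generator `-i H_c(t) - ½ ∑_k γ_k J_k† J_k` of the evolution of the system between
two emissions into the (vacuum) bath. -/
def noJumpGenerator (θ : Fin d → ℝ) (t : ℝ) (φ : H) : H :=
  -(Complex.I • M.Hc t φ) -
    (1 / 2 : ℂ) • ∑ k, (M.γ θ k : ℂ) • (star (M.J θ k) * M.J θ k) φ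

/-- The `n`-quanta component of the joint vector at time `t` on a time-ordered configuration
`t ≥ s₁ > ⋯ > sₙ > 0` with channels `k₁, …, kₙ`:
`G(t,s₁)(-i √γ_{k₁} J_{k₁}) G(s₁,s₂)(-i √γ_{k₂} J_{k₂}) ⋯ (-i √γ_{kₙ} J_{kₙ}) G(sₙ,0) ψ`,
where `G(t,s)` is the time-ordered exponential of the no-jump generator. -/
def amplitude (θ : Fin d → ℝ) : (n : ℕ) → ℝ → (Fin n → ℝ × Fin R) → H
  | 0, t, _ => timeOrderedExp (M.noJumpGenerator θ) 0 t M.ψ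
  | n + 1, t, σ =>
      timeOrderedExp (M.noJumpGenerator θ) (σ 0).1 t
        ((-Complex.I * (Real.sqrt (M.γ θ (σ 0).2) : ℂ)) •
          M.J θ (σ 0).2 (amplitude θ n (σ 0).1 (Fin.tail σ)))

/-- The wave function of the collisional purification at time `t`. The bath modes with times
later than `t` are in the vacuum. -/
def waveFunction (θ : Fin d → ℝ) (t : ℝ) (σ : Config R) : H :=
  Set.indicator {τ : Fin σ.1 → ℝ × Fin R | ∀ j, (τ j).1 ≤ t} (M.amplitude θ σ.1 t) σ.2

open Classical in
/-- The canonical collisional purification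
`Ψ(θ;t) = 𝒯 exp(-i ∫_0^t (H_c(s) + ∑_k √γ_k (J_k ⊗ e_k†(s) + J_k† ⊗ e_k(s))) ds) (ψ ⊗ vacuum)`,
where `[e_k(s), e_l†(s')] = δ_{kl} δ(s - s')`. With `e_k†(s) ds = dB_k†(s)`, it is the solution of the
(vacuum) quantum stochastic differential equation
`dΨ = (-i H_c - ½ ∑_k γ_k J_k† J_k) Ψ dt - i ∑_k √γ_k J_k dB_k† Ψ`, `Ψ(0) = ψ ⊗ vacuum`,
written out in the number representation of the bath. -/
def purification (t : ℝ) (θ : Fin d → ℝ) : Joint H R :=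
  if h : MemLp (M.waveFunction θ t) 2 (fockMeasure R) then h.toLp _ else 0

/-- The quantum Fisher information matrix `F_Q(t)` of the collisional purification, at `θ`. -/
def collisionalQFI (θ : Fin d → ℝ) (t : ℝ) : Matrix (Fin d) (Fin d) ℝ :=
  qfi (M.purification t) θ

end Model

/-! ### Measurements and estimators -/

/-- A POVM with finitely many outcomes. -/
structure POVM (H : Type*) [NormedAddCommGroup H] [InnerProductSpace ℂ H] [CompleteSpace H]
    (Ω : Type*) [Fintype Ω] where
  /-- the effects -/
  effect : Ω → H →L[ℂ] H
  effect_pos : ∀ x, (effect x).IsPositive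
  sum_effect : ∑ x, effect x = 1

section Estimation

variable {H : Type*} [NormedAddCommGroup H] [InnerProductSpace ℂ H] [CompleteSpace H] {d R : ℕ}
variable {ι : Type*} (b : HilbertBasis ι ℂ H) (M : Model H d R)
variable {Ω : Type*} [Fintype Ω] (P : POVM H Ω) (t : ℝ) (ν : ℕ)

/-- Born rule: the probability `Tr(Π_x ρ(θ;t))` of the outcome `x` in one repetition. -/
def bornProb (θ : Fin d → ℝ) (x : Ω) : ℝ := (opTrace b (P.effect x * M.ρ θ t)).re

/-- The probability of the record `x` of `ν` i.i.d. repetitions. -/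
def recordProb (θ : Fin d → ℝ) (x : Fin ν → Ω) : ℝ := ∏ a, bornProb b M P t θ (x a)

/-- The expectation of a function of the record. -/
def expect (θ : Fin d → ℝ) (f : (Fin ν → Ω) → ℝ) : ℝ :=
  ∑ x : Fin ν → Ω, recordProb b M P t ν θ x * f x

/-- The covariance matrix `Σ_{αβ} = 𝔼[(θ̌_α - θ_α)(θ̌_β - θ_β)]` of the estimators. -/
def covMatrix (est : (Fin ν → Ω) → Fin d → ℝ) (θ : Fin d → ℝ) : Matrix (Fin d) (Fin d) ℝ :=
  Matrix.of fun α β => expect b M P t ν θ fun x => (est x α - θ α) * (est x β - θ β)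

/-- The diagonal precision `τ_α = 1 / Σ_{αα}`. -/
def precision (est : (Fin ν → Ω) → Fin d → ℝ) (θ : Fin d → ℝ) (α : Fin d) : ℝ :=
  1 / covMatrix b M P t ν est θ α α

/-- The estimators are unbiased at `θ` to first order: `𝔼_θ[θ̌_β] = θ_β` and
`∂_α 𝔼_θ[θ̌_β] = δ_{αβ}`. Estimators that are unbiased in a neighbourhood of `θ` have this
property. -/
def LocallyUnbiased (est : (Fin ν → Ω) → Fin d → ℝ) (θ : Fin d → ℝ) : Prop :=
  ∀ β, expect b M P t ν θ (fun x => est x β) = θ β ∧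
    ∀ α, HasLineDerivAt ℝ (fun θ' => expect b M P t ν θ' (fun x => est x β))
      (if α = β then 1 else 0) θ (dir α)

end Estimation

end CollisionalQFI

end

open MeasureTheory

namespace CollisionalQFI

open Set Filter Topology

/-! ### Dyson series -/

section Dyson


variable {E : Type*} [NormedAddCommGroup E] [NormedSpace ℝ E]

/-! Everything rests on the overlap of the collisional vectors of two parameter values with the same
jump operators J_k. A bilinear expression in the two wave functions obeys a closed integral equation
(`Model.pairing_eq`): between emissions the no-jump generators act on its arguments, and an emission
is handled by stripping off the latest quantum and letting the jump operators act. For the inner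
product the Hamiltonian cancels, the drift contributes -½(γ_k(θ₁) + γ_k(θ₂)) and the jumps
contribute √γ_k(θ₁)√γ_k(θ₂). Together they form a perfect square: ⟨Ψ₁, Ψ₂⟩ = 1 - ½ ∑_k (√γ_k(θ₁) -
√γ_k(θ₂))² N_k(θ₁, θ₂), with N_k the time integral of ⟨J_k Ψ₁, J_k Ψ₂⟩ (`Model.inner_purification`).

This identity also carries the differentiation in θ. It gives ‖Ψ‖ = 1 and makes Ψ, hence N_k,
Lipschitz in the amplitudes √γ. The mixed second difference of the overlap then converges to ∑_k
∂_α√γ_k ∂_β√γ_k N_k(θ, θ) (`tendsto_mixed_difference`). For α = β this says that the difference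
quotients of Ψ are Cauchy, so Ψ has partial derivatives
(`exists_hasDerivAt_of_tendsto_inner_slope`); in general it computes ⟨∂_αΨ, ∂_βΨ⟩. Since ⟨Ψ(θ), Ψ(θ
+ k e_β)⟩ is 1 + o(k), also ⟨Ψ, ∂_βΨ⟩ = 0. Hence F_Q is an explicit time integral, and its time
derivative is the integrand.

For (u, v) ↦ |u⟩⟨v| the same integral equation is the Lindblad equation in jump form, so uniqueness
of its solution identifies the partial trace of |Ψ⟩⟨Ψ| with ρ (`Model.ρ_eq_pairing`), and Parseval
turns this into the trace formula (`Model.purifies`).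

A measurement of ρ is a measurement of Π ⊗ 1 in Ψ. Cauchy-Schwarz for each effect bounds the
classical Fisher information by 4‖∂_αΨ‖², which equals F_Q because ⟨Ψ, ∂_αΨ⟩ = 0; the Cramér-Rao
bound for ν independent repetitions gives the first estimate (`Model.one_le_qfi_mul_covMatrix`). The
second follows from ‖J_kΨ‖ ≤ ‖J_k‖ and 4(∂√γ)² = (∂γ)²/γ. The kernel formula is diagonal algebra in
the frozen eigenframe. -/

/-- Iterated integrals of a bounded generator decay factorially. -/
theorem norm_iteratedIntegral_le {A : ℝ → E →L[ℝ] E} {r : ℕ → ℝ → E} {s C M : ℝ} {I : Set ℝ}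
    (hI : OrdConnected I) (hs : s ∈ I) (hA : ∀ t ∈ I, ‖A t‖ ≤ C)
    (h0 : ∀ t ∈ I, ‖r 0 t‖ ≤ M)
    (hr : ∀ n, ∀ t ∈ I, r (n + 1) t = ∫ τ in s..t, A τ (r n τ)) (n : ℕ) :
    ∀ t ∈ I, ‖r n t‖ ≤ M * ((C * |t - s|) ^ n / n.factorial) := by
  have hC : 0 ≤ C := (norm_nonneg _).trans (hA s hs)
  induction n with
  | zero => intro t ht; simpa using h0 t ht
  | succ n ih =>
    intro t ht
    rw [hr n t ht]
    have hsub : ∀ τ ∈ uIoc s t, τ ∈ I := fun τ hτ =>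
      hI.uIcc_subset hs ht (uIoc_subset_uIcc hτ)
    have hbd : ∀ᵐ τ ∂(volume.restrict (uIoc s t)),
        ‖A τ (r n τ)‖ ≤ C * (M * (C ^ n / n.factorial)) * |τ - s| ^ n := by
      refine (ae_restrict_iff' measurableSet_uIoc).2 (Eventually.of_forall fun τ hτ => ?_)
      calc ‖A τ (r n τ)‖ ≤ ‖A τ‖ * ‖r n τ‖ := (A τ).le_opNorm _
        _ ≤ C * (M * ((C * |τ - s|) ^ n / n.factorial)) :=
          mul_le_mul (hA τ (hsub τ hτ)) (ih τ (hsub τ hτ)) (norm_nonneg _) hC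
        _ = _ := by rw [mul_pow]; ring
    have hint : Integrable (fun τ => C * (M * (C ^ n / n.factorial)) * |τ - s| ^ n)
        (volume.restrict (uIoc s t)) := by
      have : Continuous fun τ : ℝ => C * (M * (C ^ n / n.factorial)) * |τ - s| ^ n := by fun_prop
      exact (this.intervalIntegrable s t).def'
    have h1 : ‖∫ τ in s..t, A τ (r n τ)‖ ≤
        ∫ τ in uIoc s t, C * (M * (C ^ n / n.factorial)) * |τ - s| ^ n := by
      rw [intervalIntegral.norm_intervalIntegral_eq]
      exact norm_integral_le_of_norm_le hint hbd
    refine h1.trans_eq ?_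
    rw [integral_const_mul, integral_pow_abs_sub_uIoc, Nat.factorial_succ]
    push_cast
    field_simp
    ring

theorem summable_pow_div_factorial' (M x : ℝ) :
    Summable fun n : ℕ => M * (x ^ n / n.factorial) :=
  (Real.summable_pow_div_factorial x).mul_left M

variable {A : ℝ → E →L[ℝ] E}

/-- Continuity is needed jointly in the initial time, the final time and the vector: in a
multi-quanta amplitude all three depend on the configuration. -/
theorem continuous_dysonTerm (hA : Continuous A) (n : ℕ) :
    Continuous fun p : ℝ × ℝ × E => dysonTerm (fun t x => A t x) p.1 p.2.2 n p.2.1 := by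
  induction n with
  | zero => exact continuous_snd.comp continuous_snd
  | succ n ih =>
    have hf : Continuous (Function.uncurry fun (p : ℝ × ℝ × E) (τ : ℝ) =>
        A τ (dysonTerm (fun t x => A t x) p.1 p.2.2 n τ)) := by
      refine (hA.comp continuous_snd).clm_apply
        (ih.comp (?_ : Continuous fun q : (ℝ × ℝ × E) × ℝ => (q.1.1, q.2, q.1.2.2)))
      fun_prop
    have key : (fun p : ℝ × ℝ × E => dysonTerm (fun t x => A t x) p.1 p.2.2 (n + 1) p.2.1) =
        fun p => (∫ τ in (0 : ℝ)..p.2.1, A τ (dysonTerm (fun t x => A t x) p.1 p.2.2 n τ)) -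
          ∫ τ in (0 : ℝ)..p.1, A τ (dysonTerm (fun t x => A t x) p.1 p.2.2 n τ) := by
      funext p
      have hc : Continuous fun τ => A τ (dysonTerm (fun t x => A t x) p.1 p.2.2 n τ) :=
        hf.comp (by fun_prop : Continuous fun τ : ℝ => (p, τ))
      rw [intervalIntegral.integral_interval_sub_left (hc.intervalIntegrable _ _)
        (hc.intervalIntegrable _ _)]
      rfl
    rw [key]
    exact (intervalIntegral.continuous_parametric_intervalIntegral_of_continuous hf
      (by fun_prop)).sub
      (intervalIntegral.continuous_parametric_intervalIntegral_of_continuous hf (by fun_prop))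

theorem exists_norm_le_of_continuous (hA : Continuous A) (T : ℝ) :
    ∃ C, 0 ≤ C ∧ ∀ t ∈ Icc (-T) T, ‖A t‖ ≤ C := by
  obtain ⟨C, hC⟩ := isCompact_Icc.exists_bound_of_continuousOn (hA.continuousOn (s := Icc (-T) T))
  exact ⟨max C 0, le_max_right _ _, fun t ht => (hC t ht).trans (le_max_left _ _)⟩

/-- The factor 2T bounds |t - s|, which makes the estimate uniform over both times and usable in the
Weierstrass test. -/
theorem norm_dysonTerm_le {C T : ℝ} (hC : ∀ t ∈ Icc (-T) T, ‖A t‖ ≤ C) {s t : ℝ}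
    (hs : s ∈ Icc (-T) T) (ht : t ∈ Icc (-T) T) (x : E) (n : ℕ) :
    ‖dysonTerm (fun t x => A t x) s x n t‖ ≤ ‖x‖ * ((C * (2 * T)) ^ n / n.factorial) := by
  have h := norm_iteratedIntegral_le (A := A) (r := dysonTerm (fun t x => A t x) s x)
    (M := ‖x‖) ordConnected_Icc hs hC (fun _ _ => le_refl ‖x‖) (fun _ _ _ => rfl) n t ht
  have hC0 : 0 ≤ C := (norm_nonneg _).trans (hC s hs)
  refine h.trans ?_
  have : |t - s| ≤ 2 * T := by
    rw [abs_le]; constructor <;> linarith [hs.1, hs.2, ht.1, ht.2]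
  gcongr

theorem timeOrderedExp_self (A : ℝ → E → E) (s : ℝ) (x : E) :
    timeOrderedExp A s s x = x := by
  rw [timeOrderedExp, tsum_eq_single 0]
  · rfl
  · rintro (_ | n) h
    · exact absurd rfl h
    · exact intervalIntegral.integral_same

variable [CompleteSpace E]

theorem hasSum_dysonTerm (hA : Continuous A) (s t : ℝ) (x : E) :
    HasSum (fun n => dysonTerm (fun t x => A t x) s x n t)
      (timeOrderedExp (fun t x => A t x) s t x) := by
  obtain ⟨C, -, hC⟩ := exists_norm_le_of_continuous hA (max |s| |t|)
  have hs : s ∈ Icc (-max |s| |t|) (max |s| |t|) := abs_le.1 (le_max_left _ _)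
  have ht : t ∈ Icc (-max |s| |t|) (max |s| |t|) := abs_le.1 (le_max_right _ _)
  exact (Summable.of_norm_bounded (summable_pow_div_factorial' _ _)
    (norm_dysonTerm_le hC hs ht x)).hasSum

theorem continuous_timeOrderedExp (hA : Continuous A) :
    Continuous fun p : ℝ × ℝ × E => timeOrderedExp (fun t x => A t x) p.1 p.2.1 p.2.2 := by
  rw [continuous_iff_continuousAt]
  rintro ⟨s₀, t₀, x₀⟩
  obtain ⟨T, hT⟩ := exists_gt (max |s₀| |t₀|)
  obtain ⟨X, hX⟩ := exists_gt ‖x₀‖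
  have hs₀ := abs_lt.1 ((le_max_left _ _).trans_lt hT)
  have ht₀ := abs_lt.1 ((le_max_right _ _).trans_lt hT)
  have hT0 : 0 ≤ T := ((abs_nonneg _).trans (le_max_left _ _)).trans hT.le
  obtain ⟨C, hC0, hC⟩ := exists_norm_le_of_continuous hA T
  have hU : Icc (-T) T ×ˢ (Icc (-T) T ×ˢ {x : E | ‖x‖ ≤ X}) ∈ 𝓝 (s₀, t₀, x₀) := by
    refine prod_mem_nhds (Icc_mem_nhds hs₀.1 hs₀.2) (prod_mem_nhds (Icc_mem_nhds ht₀.1 ht₀.2) ?_)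
    exact (continuous_norm.tendsto x₀).eventually (eventually_le_nhds hX)
  have hsum := summable_pow_div_factorial' X (C * (2 * T))
  have hcont : ContinuousOn
      (fun p : ℝ × ℝ × E => ∑' n, dysonTerm (fun t x => A t x) p.1 p.2.2 n p.2.1)
      (Icc (-T) T ×ˢ (Icc (-T) T ×ˢ {x : E | ‖x‖ ≤ X})) := by
    refine continuousOn_tsum (fun n => (continuous_dysonTerm hA n).continuousOn) hsum ?_
    rintro n p ⟨hs, ht, hx⟩
    exact (norm_dysonTerm_le hC hs ht p.2.2 n).trans
      (mul_le_mul_of_nonneg_right hx (by positivity))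
  exact hcont.continuousAt hU

/-- Each Dyson term is the integral of the generator applied to the preceding term; dominated
convergence sums these relations, and the zeroth term is the initial vector. -/
theorem timeOrderedExp_eq (hA : Continuous A) (s t : ℝ) (x : E) :
    timeOrderedExp (fun t x => A t x) s t x =
      x + ∫ τ in s..t, A τ (timeOrderedExp (fun t x => A t x) s τ x) := by
  obtain ⟨C, hC0, hC⟩ := exists_norm_le_of_continuous hA (max |s| |t|)
  set T := max |s| |t|
  have hs : s ∈ Icc (-T) T := abs_le.1 (le_max_left _ _)
  have ht : t ∈ Icc (-T) T := abs_le.1 (le_max_right _ _)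
  have h1 := hasSum_dysonTerm hA s t x
  have hsub : ∀ τ ∈ uIoc s t, τ ∈ Icc (-T) T := fun τ hτ =>
    ordConnected_Icc.uIcc_subset hs ht (uIoc_subset_uIcc hτ)
  have hcont : ∀ n, Continuous fun τ => A τ (dysonTerm (fun t x => A t x) s x n τ) := fun n =>
    hA.clm_apply ((continuous_dysonTerm hA n).comp
      (by fun_prop : Continuous fun τ : ℝ => (s, τ, x)))
  have hsum := summable_pow_div_factorial' (C * ‖x‖) (C * (2 * T))
  have h2 : HasSum (fun n => dysonTerm (fun t x => A t x) s x (n + 1) t)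
      (∫ τ in s..t, A τ (timeOrderedExp (fun t x => A t x) s τ x)) := by
    refine intervalIntegral.hasSum_integral_of_dominated_convergence
      (fun n _ => C * ‖x‖ * ((C * (2 * T)) ^ n / n.factorial))
      (fun n => (hcont n).aestronglyMeasurable) ?_ (ae_of_all _ fun _ _ => hsum)
      intervalIntegrable_const
      (ae_of_all _ fun τ _ => (A τ).hasSum (hasSum_dysonTerm hA s τ x))
    refine fun n => ae_of_all _ fun τ hτ => ?_
    calc _ ≤ ‖A τ‖ * ‖dysonTerm (fun t x => A t x) s x n τ‖ := (A τ).le_opNorm _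
      _ ≤ C * (‖x‖ * ((C * (2 * T)) ^ n / n.factorial)) :=
        mul_le_mul (hC _ (hsub τ hτ)) (norm_dysonTerm_le hC hs (hsub τ hτ) x n)
          (norm_nonneg _) hC0
      _ = _ := by ring
  have h3 := (hasSum_nat_add_iff' 1).2 h1
  have h4 := h3.unique h2
  simp only [Finset.range_one, Finset.sum_singleton, dysonTerm] at h4
  rw [← h4]; abel

theorem continuous_timeOrderedExp_apply (hA : Continuous A) (s : ℝ) (x : E) :
    Continuous fun t => timeOrderedExp (fun t x => A t x) s t x :=
  (continuous_timeOrderedExp hA).comp (by fun_prop : Continuous fun t : ℝ => (s, t, x))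

theorem hasDerivAt_timeOrderedExp (hA : Continuous A) (s t : ℝ) (x : E) :
    HasDerivAt (fun t => timeOrderedExp (fun t x => A t x) s t x)
      (A t (timeOrderedExp (fun t x => A t x) s t x)) t := by
  have hc : Continuous fun τ => A τ (timeOrderedExp (fun t x => A t x) s τ x) :=
    hA.clm_apply (continuous_timeOrderedExp_apply hA s x)
  have := (hc.integral_hasStrictDerivAt s t).hasDerivAt.const_add x
  exact this.congr_of_eventuallyEq
    (Eventually.of_forall fun t => timeOrderedExp_eq hA s t x)

/-- The Dyson series is the only solution of the integrated evolution equation. -/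
theorem eq_timeOrderedExp_of_integral_eq (hA : Continuous A) {f : ℝ → E} {x : E}
    (hf : ContinuousOn f (Ici 0))
    (hfx : ∀ t, 0 ≤ t → f t = x + ∫ τ in (0 : ℝ)..t, A τ (f τ)) {t : ℝ} (ht : 0 ≤ t) :
    f t = timeOrderedExp (fun t x => A t x) 0 t x := by
  -- Freezing f at f(0) for negative times gives a function continuous on the whole line, so the
  -- fundamental theorem of calculus applies at 0 as well.
  set F : ℝ → E := fun t => f (max t 0)
  have hF : Continuous F :=
    hf.comp_continuous (by fun_prop) fun t => le_max_right t 0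
  have hFf : ∀ t, 0 ≤ t → F t = f t := fun t ht => by simp only [F, max_eq_left ht]
  have hc : Continuous fun τ => A τ (F τ) := hA.clm_apply hF
  have hG : ∀ t, 0 ≤ t → F t = x + ∫ τ in (0 : ℝ)..t, A τ (F τ) := by
    intro t ht
    rw [hFf t ht, hfx t ht]
    congr 1
    refine intervalIntegral.integral_congr fun τ hτ => ?_
    rw [uIcc_of_le ht] at hτ
    simp only [hFf τ hτ.1]
  obtain ⟨C, hC0, hC⟩ := exists_norm_le_of_continuous hA t
  have key := ODE_solution_unique_of_mem_Icc_right (v := fun τ y => A τ y)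
    (s := fun _ => univ) (K := ⟨C, hC0⟩) (f := F)
    (g := fun t => timeOrderedExp (fun t x => A t x) 0 t x) (a := 0) (b := t)
    (fun τ hτ => ?_) hF.continuousOn (fun τ hτ => ?_) (fun _ _ => mem_univ _)
    (continuous_timeOrderedExp_apply hA 0 x).continuousOn
    (fun τ _ => (hasDerivAt_timeOrderedExp hA 0 τ x).hasDerivWithinAt)
    (fun _ _ => mem_univ _) (by simp [hG 0 le_rfl, timeOrderedExp_self])
  · rw [← hFf t ht]; exact key (right_mem_Icc.2 ht)
  · refine ((A τ).lipschitz.weaken ?_).lipschitzOnWith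
    exact hC τ ⟨by linarith [hτ.1], hτ.2.le⟩
  · have := (hc.integral_hasStrictDerivAt 0 τ).hasDerivAt.const_add x
    exact this.hasDerivWithinAt.congr (fun u hu => hG u (hτ.1.trans hu)) (hG τ hτ.1)

end Dyson

/-! ### Configurations with `n` quanta -/

section Sector

/-- The measure on the `n`-quanta sector. -/
noncomputable def sectorMeasure (R n : ℕ) : Measure (Fin n → ℝ × Fin R) :=
  (Measure.pi fun _ : Fin n => (volume : Measure ℝ).prod (Measure.count : Measure (Fin R))).restrict
    (ordered R n)

instance (R n : ℕ) : SFinite (sectorMeasure R n) := by unfold sectorMeasure; infer_instance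

/-- The configurations whose times lie in `[0, T]`. -/
def timeBox (R n : ℕ) (T : ℝ) : Set (Fin n → ℝ × Fin R) :=
  univ.pi fun _ => Icc 0 T ×ˢ univ

theorem isCompact_timeBox (R n : ℕ) (T : ℝ) : IsCompact (timeBox R n T) :=
  isCompact_univ_pi fun _ => isCompact_Icc.prod isCompact_univ

theorem measurableSet_timeBox (R n : ℕ) (T : ℝ) : MeasurableSet (timeBox R n T) :=
  MeasurableSet.univ_pi fun _ => measurableSet_Icc.prod MeasurableSet.univ

theorem measurableSet_ordered (R n : ℕ) : MeasurableSet (ordered R n) := by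
  have : ordered R n = (⋂ (i : Fin n) (j : Fin n) (_ : i < j), {σ | (σ j).1 < (σ i).1}) ∩
      ⋂ j, {σ | 0 < (σ j).1} := by
    ext σ
    simp only [ordered, StrictAnti, mem_ofPred_eq, mem_inter_iff, mem_iInter]
  rw [this]
  refine MeasurableSet.inter ?_ ?_
  · refine MeasurableSet.iInter fun i => MeasurableSet.iInter fun j => MeasurableSet.iInter fun _ =>
      measurableSet_lt (by fun_prop) (by fun_prop)
  · exact MeasurableSet.iInter fun j => measurableSet_lt measurable_const (by fun_prop)

/-- Up to time T all emissions lie in this box, so its finite measure makes bounded functions on it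
integrable dominating functions. -/
theorem sectorMeasure_timeBox_lt_top (R n : ℕ) (T : ℝ) :
    sectorMeasure R n (timeBox R n T) < ⊤ := by
  refine (Measure.restrict_apply_le _ _).trans_lt ?_
  rw [timeBox, Measure.pi_pi]
  refine ENNReal.prod_lt_top fun i _ => ?_
  rw [Measure.prod_prod]
  refine ENNReal.mul_lt_top measure_Icc_lt_top ?_
  simp [Measure.count_apply]

theorem mem_timeBox {R n : ℕ} {T t : ℝ} {σ : Fin n → ℝ × Fin R} (hσ : σ ∈ ordered R n)
    (h : ∀ j, (σ j).1 ≤ t) (ht : t ≤ T) : σ ∈ timeBox R n T :=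
  fun j _ => ⟨⟨(hσ.2 j).le, (h j).trans ht⟩, mem_univ _⟩

theorem ae_mem_ordered (R n : ℕ) : ∀ᵐ σ ∂(sectorMeasure R n), σ ∈ ordered R n :=
  ae_restrict_mem (measurableSet_ordered R n)

/-- The empty product measure is a Dirac mass at the one empty configuration: this sector is the
vacuum. -/
theorem integral_sectorMeasure_zero {F : Type*} [NormedAddCommGroup F] [NormedSpace ℝ F]
    [CompleteSpace F] {R : ℕ} (f : (Fin 0 → ℝ × Fin R) → F) :
    ∫ σ, f σ ∂(sectorMeasure R 0) = f default := by
  have : ordered R 0 = univ := by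
    ext σ; simp [ordered, StrictAnti]
  rw [sectorMeasure, this, Measure.restrict_univ,
    Measure.pi_of_empty _ (default : Fin 0 → ℝ × Fin R), integral_dirac]

theorem forall_le_iff_of_ordered {R n : ℕ} {σ : Fin (n + 1) → ℝ × Fin R}
    (hσ : σ ∈ ordered R (n + 1)) {t : ℝ} : (∀ j, (σ j).1 ≤ t) ↔ (σ 0).1 ≤ t :=
  ⟨fun h => h 0, fun h j => (hσ.1.antitone (Fin.zero_le j)).trans h⟩

theorem cons_mem_ordered_iff {R n : ℕ} {p : ℝ × Fin R} {τ : Fin n → ℝ × Fin R} :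
    Fin.cons (α := fun _ => ℝ × Fin R) p τ ∈ ordered R (n + 1) ↔
      0 < p.1 ∧ τ ∈ ordered R n ∧ ∀ j, (τ j).1 < p.1 := by
  constructor
  · rintro ⟨h1, h2⟩
    refine ⟨by simpa using h2 0, ⟨fun i j hij => ?_, fun j => by simpa using h2 j.succ⟩, fun j => ?_⟩
    · simpa using h1 (Fin.succ_lt_succ_iff.2 hij)
    · simpa using h1 (Fin.succ_pos j)
  · rintro ⟨h0, ⟨h1, h2⟩, h3⟩
    refine ⟨fun i j hij => ?_, fun j => ?_⟩
    · refine Fin.cases (fun hij => ?_) (fun j hij => ?_) j hij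
      · exact absurd hij (Fin.not_lt_zero _)
      · refine Fin.cases (fun _ => ?_) (fun i hij => ?_) i hij
        · simpa using h3 j
        · simpa using h1 (Fin.succ_lt_succ_iff.1 hij)
    · refine Fin.cases ?_ (fun j => ?_) j
      · simpa using h0
      · simpa using h2 j

/-- Integration over the `n + 1`-quanta sector, the latest quantum last. -/
theorem integral_sectorMeasure_succ {F : Type*} [NormedAddCommGroup F] [NormedSpace ℝ F]
    [CompleteSpace F] {R n : ℕ} {f : (Fin (n + 1) → ℝ × Fin R) → F}
    (hf : Integrable f (sectorMeasure R (n + 1))) :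
    IntegrableOn (fun s => ∑ k, ∫ τ, {τ : Fin n → ℝ × Fin R | ∀ j, (τ j).1 ≤ s}.indicator
      (fun τ => f (Fin.cons (s, k) τ)) τ ∂(sectorMeasure R n)) (Ioi 0) ∧
    ∫ σ, f σ ∂(sectorMeasure R (n + 1)) =
      ∫ s in Ioi 0, ∑ k, ∫ τ, {τ : Fin n → ℝ × Fin R | ∀ j, (τ j).1 ≤ s}.indicator
        (fun τ => f (Fin.cons (s, k) τ)) τ ∂(sectorMeasure R n) := by
  set lam : Measure (ℝ × Fin R) := (volume : Measure ℝ).prod (Measure.count : Measure (Fin R))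
  set e := MeasurableEquiv.piFinSuccAbove (fun _ : Fin (n + 1) => ℝ × Fin R) 0
  have hmp : MeasurePreserving e (Measure.pi fun _ => lam)
      (lam.prod (Measure.pi fun _ : Fin n => lam)) :=
    measurePreserving_piFinSuccAbove (fun _ : Fin (n + 1) => lam) 0
  have hsymm : ∀ p τ, e.symm (p, τ) = Fin.cons p τ := by
    intro p τ
    simp [e, MeasurableEquiv.piFinSuccAbove, Fin.insertNthEquiv]
  -- Extension by zero off the ordered configurations replaces the restricted measure by a full
  -- product measure, where Fubini can split off the first coordinate.
  set g : (Fin (n + 1) → ℝ × Fin R) → F := (ordered R (n + 1)).indicator f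
  have hg : Integrable g (Measure.pi fun _ => lam) :=
    (integrable_indicator_iff (measurableSet_ordered R (n + 1))).2 hf
  have hint : Integrable (fun z => g (e.symm z)) (lam.prod (Measure.pi fun _ : Fin n => lam)) :=
    (hmp.symm.integrable_comp_emb e.symm.measurableEmbedding).2 hg
  have h1 : ∫ σ, f σ ∂(sectorMeasure R (n + 1)) =
      ∫ z, g (e.symm z) ∂(lam.prod (Measure.pi fun _ : Fin n => lam)) := by
    rw [hmp.symm.integral_comp', integral_indicator (measurableSet_ordered R (n + 1))]
    rfl
  have hint1 := hint.integral_prod_left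
  have hcount : ∀ h : ℝ × Fin R → F, Integrable h lam →
      ∫ p, h p ∂lam = ∫ s, ∑ k, h (s, k) := by
    intro h hh
    rw [integral_prod _ hh]
    simp [integral_fintype, measureReal_def]
  have hcount' : ∀ h : ℝ × Fin R → F, Integrable h lam →
      Integrable (fun s => ∑ k, h (s, k)) := by
    intro h hh
    have := hh.integral_prod_left
    simpa [integral_fintype, measureReal_def] using this
  have hinner : ∀ s : ℝ, ∀ k : Fin R, ∫ τ, g (e.symm ((s, k), τ)) ∂(Measure.pi fun _ => lam) =
      (Ioi (0 : ℝ)).indicator (fun s => ∫ τ, {τ : Fin n → ℝ × Fin R | ∀ j, (τ j).1 ≤ s}.indicator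
        (fun τ => f (Fin.cons (s, k) τ)) τ ∂(sectorMeasure R n)) s := by
    intro s k
    by_cases hs : 0 < s
    · rw [indicator_of_mem (mem_Ioi.2 hs), sectorMeasure,
        ← integral_indicator (measurableSet_ordered R n)]
      refine integral_congr_ae ?_
      -- The indicator allows earlier times equal to s while the ordering is strict. Coincidences
      -- lie in finitely many hyperplanes, one for each quantum and channel, and these are null.
      have hnull : ∀ᵐ τ ∂(Measure.pi fun _ : Fin n => lam), ∀ j, (τ j).1 ≠ s := by
        rw [ae_all_iff]
        intro j
        have : ∀ k : Fin R, ∀ᵐ τ ∂(Measure.pi fun _ : Fin n => lam), τ j ≠ (s, k) := fun k =>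
          ae_iff.2 (by simpa using Measure.pi_hyperplane (fun _ : Fin n => lam) j (s, k))
        filter_upwards [ae_all_iff.2 this] with τ hτ h
        exact hτ (τ j).2 (by rw [← h])
      filter_upwards [hnull] with τ hτ
      simp only [g, hsymm]
      by_cases hτo : τ ∈ ordered R n
      · rw [indicator_of_mem hτo]
        by_cases hle : ∀ j, (τ j).1 ≤ s
        · rw [indicator_of_mem (s := {τ : Fin n → ℝ × Fin R | ∀ j, (τ j).1 ≤ s}) hle,
            indicator_of_mem]
          exact cons_mem_ordered_iff.2 ⟨hs, hτo, fun j => lt_of_le_of_ne (hle j) (hτ j)⟩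
        · rw [indicator_of_notMem (s := {τ : Fin n → ℝ × Fin R | ∀ j, (τ j).1 ≤ s}) hle,
            indicator_of_notMem]
          exact fun h => hle fun j => ((cons_mem_ordered_iff.1 h).2.2 j).le
      · rw [indicator_of_notMem hτo, indicator_of_notMem]
        exact fun h => hτo (cons_mem_ordered_iff.1 h).2.1
    · rw [indicator_of_notMem (by simpa using hs)]
      refine integral_eq_zero_of_ae (Eventually.of_forall fun τ => ?_)
      simp only [g, hsymm]
      rw [indicator_of_notMem, Pi.zero_apply]
      exact fun h => hs (cons_mem_ordered_iff.1 h).1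
  have hfun : (fun s => ∑ k, ∫ τ, g (e.symm ((s, k), τ)) ∂(Measure.pi fun _ => lam)) =
      (Ioi (0 : ℝ)).indicator (fun s => ∑ k, ∫ τ,
        {τ : Fin n → ℝ × Fin R | ∀ j, (τ j).1 ≤ s}.indicator
        (fun τ => f (Fin.cons (s, k) τ)) τ ∂(sectorMeasure R n)) := by
    funext s
    simp only [hinner]
    by_cases hs : 0 < s
    · simp [indicator_of_mem (mem_Ioi.2 hs)]
    · simp [indicator_of_notMem (show s ∉ Ioi (0:ℝ) by simpa using hs)]
  constructor
  · rw [← integrable_indicator_iff measurableSet_Ioi, ← hfun]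
    exact hcount' _ hint1
  · rw [h1, integral_prod _ hint, hcount _ hint1, hfun, integral_indicator measurableSet_Ioi]

end Sector

namespace Model

variable {H : Type*} [NormedAddCommGroup H] [InnerProductSpace ℂ H] [CompleteSpace H] {d R : ℕ}
variable (M : Model H d R)

/-! ### The wave function on one sector -/

/-- The generator of the evolution between two emissions, as an operator. -/
noncomputable def noJumpOp (θ : Fin d → ℝ) (t : ℝ) : H →L[ℂ] H :=
  -(Complex.I • M.Hc t) - (1 / 2 : ℂ) • ∑ k, (M.γ θ k : ℂ) • (star (M.J θ k) * M.J θ k)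

/-- The jump operator `-i √γ_k J_k`. -/
noncomputable def jumpOp (θ : Fin d → ℝ) (k : Fin R) : H →L[ℂ] H :=
  (-Complex.I * (Real.sqrt (M.γ θ k) : ℂ)) • M.J θ k

theorem continuous_noJumpOp (θ : Fin d → ℝ) : Continuous (M.noJumpOp θ) := by
  unfold noJumpOp
  exact ((continuous_const (y := Complex.I).smul M.Hc_continuous).neg).sub continuous_const

theorem continuous_noJumpOp_restrictScalars (θ : Fin d → ℝ) :
    Continuous fun t => (M.noJumpOp θ t).restrictScalars ℝ :=
  (ContinuousLinearMap.restrictScalarsL ℂ H H ℝ ℝ).continuous.comp (M.continuous_noJumpOp θ)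

theorem noJumpGenerator_eq (θ : Fin d → ℝ) :
    M.noJumpGenerator θ = fun t φ => (M.noJumpOp θ t).restrictScalars ℝ φ := by
  funext t φ
  simp [noJumpGenerator, noJumpOp]

theorem continuous_noJumpEvolution (θ : Fin d → ℝ) :
    Continuous fun p : ℝ × ℝ × H => timeOrderedExp (M.noJumpGenerator θ) p.1 p.2.1 p.2.2 := by
  rw [noJumpGenerator_eq]
  exact continuous_timeOrderedExp (M.continuous_noJumpOp_restrictScalars θ)

theorem continuous_jumpOp_uncurry (θ : Fin d → ℝ) :
    Continuous fun p : Fin R × H => M.jumpOp θ p.1 p.2 :=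
  ((continuous_of_discreteTopology (f := M.jumpOp θ)).comp continuous_fst).clm_apply continuous_snd

/-- The joint vector right after the last emission. -/
noncomputable def emission (θ : Fin d → ℝ) (n : ℕ) (σ : Fin (n + 1) → ℝ × Fin R) : H :=
  M.jumpOp θ (σ 0).2 (M.amplitude θ n (σ 0).1 (Fin.tail σ))

theorem continuous_amplitude (θ : Fin d → ℝ) (n : ℕ) :
    Continuous fun p : ℝ × (Fin n → ℝ × Fin R) => M.amplitude θ n p.1 p.2 := by
  induction n with
  | zero =>
    exact (M.continuous_noJumpEvolution θ).comp
      (by fun_prop : Continuous fun p : ℝ × (Fin 0 → ℝ × Fin R) => ((0 : ℝ), p.1, M.ψ))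
  | succ n ih =>
    have h1 : Continuous fun p : ℝ × (Fin (n + 1) → ℝ × Fin R) =>
        M.amplitude θ n (p.2 0).1 (Fin.tail p.2) :=
      ih.comp (g := fun p : ℝ × (Fin n → ℝ × Fin R) => M.amplitude θ n p.1 p.2)
        (f := fun p : ℝ × (Fin (n + 1) → ℝ × Fin R) => ((p.2 0).1, Fin.tail p.2))
        (by unfold Fin.tail; fun_prop)
    have h2 : Continuous fun p : ℝ × (Fin (n + 1) → ℝ × Fin R) => M.emission θ n p.2 :=
      (M.continuous_jumpOp_uncurry θ).comp
        (by fun_prop : Continuous fun p : ℝ × (Fin (n + 1) → ℝ × Fin R) =>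
          ((p.2 0).2, M.amplitude θ n (p.2 0).1 (Fin.tail p.2)))
    exact (M.continuous_noJumpEvolution θ).comp
      (by fun_prop : Continuous fun p : ℝ × (Fin (n + 1) → ℝ × Fin R) =>
        ((p.2 0).1, p.1, M.emission θ n p.2))

theorem continuous_emission (θ : Fin d → ℝ) (n : ℕ) : Continuous (M.emission θ n) := by
  have h1 : Continuous fun σ : Fin (n + 1) → ℝ × Fin R =>
      M.amplitude θ n (σ 0).1 (Fin.tail σ) :=
    (M.continuous_amplitude θ n).comp
      (f := fun σ : Fin (n + 1) → ℝ × Fin R => ((σ 0).1, Fin.tail σ))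
      (by unfold Fin.tail; fun_prop)
  exact (M.continuous_jumpOp_uncurry θ).comp
    (by fun_prop : Continuous fun σ : Fin (n + 1) → ℝ × Fin R =>
      ((σ 0).2, M.amplitude θ n (σ 0).1 (Fin.tail σ)))

/-- The wave function on the `n`-quanta sector. -/
noncomputable def sectorWave (θ : Fin d → ℝ) (n : ℕ) (t : ℝ) (σ : Fin n → ℝ × Fin R) : H :=
  {τ : Fin n → ℝ × Fin R | ∀ j, (τ j).1 ≤ t}.indicator (M.amplitude θ n t) σ

theorem stronglyMeasurable_sectorWave (θ : Fin d → ℝ) (n : ℕ) :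
    StronglyMeasurable fun p : ℝ × (Fin n → ℝ × Fin R) => M.sectorWave θ n p.1 p.2 := by
  have hs : MeasurableSet {p : ℝ × (Fin n → ℝ × Fin R) | ∀ j, (p.2 j).1 ≤ p.1} := by
    have : {p : ℝ × (Fin n → ℝ × Fin R) | ∀ j, (p.2 j).1 ≤ p.1} =
        ⋂ j, {p | (p.2 j).1 ≤ p.1} := by ext; simp
    rw [this]
    exact MeasurableSet.iInter fun j => measurableSet_le (by fun_prop) (by fun_prop)
  exact (M.continuous_amplitude θ n).stronglyMeasurable.indicator hs

/-- The amplitude is continuous and the box is compact; an ordered configuration with all times at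
most t ≤ T lies in the box. The bound does not depend on t, so it also dominates integrals over
time. -/
theorem exists_norm_sectorWave_le (θ : Fin d → ℝ) (n : ℕ) (T : ℝ) :
    ∃ C, 0 ≤ C ∧ ∀ t ∈ Icc 0 T, ∀ σ ∈ ordered R n,
      ‖M.sectorWave θ n t σ‖ ≤ (timeBox R n T).indicator (fun _ => C) σ := by
  obtain ⟨C, hC⟩ := (isCompact_Icc.prod (isCompact_timeBox R n T)).exists_bound_of_continuousOn
    (M.continuous_amplitude θ n).continuousOn (s := Icc 0 T ×ˢ timeBox R n T)
  refine ⟨max C 0, le_max_right _ _, fun t ht σ hσ => ?_⟩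
  by_cases h : ∀ j, (σ j).1 ≤ t
  · have hb := mem_timeBox hσ h ht.2
    rw [sectorWave, indicator_of_mem (s := {τ : Fin n → ℝ × Fin R | ∀ j, (τ j).1 ≤ t}) h,
      indicator_of_mem hb]
    exact (hC (t, σ) ⟨ht, hb⟩).trans (le_max_left _ _)
  · rw [sectorWave, indicator_of_notMem (s := {τ : Fin n → ℝ × Fin R | ∀ j, (τ j).1 ≤ t}) h,
      norm_zero]
    exact indicator_nonneg (fun _ _ => le_max_right _ _) _

/-! ### Bilinear expressions in two wave functions on one sector -/

variable {F : Type*} [NormedAddCommGroup F] [NormedSpace ℝ F]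
variable (θ₁ θ₂ : Fin d → ℝ)

/-- The integral of a bilinear expression in two wave functions over the `n`-quanta sector. -/
noncomputable def sectorPairing (B : H →L[ℝ] H →L[ℝ] F) (n : ℕ) (t : ℝ) : F :=
  ∫ σ, B (M.sectorWave θ₁ n t σ) (M.sectorWave θ₂ n t σ) ∂(sectorMeasure R n)

theorem integrable_indicator_timeBox (n : ℕ) (T C : ℝ) :
    Integrable ((timeBox R n T).indicator fun _ => C) (sectorMeasure R n) :=
  (integrable_indicator_iff (measurableSet_timeBox R n T)).2
    (integrableOn_const (sectorMeasure_timeBox_lt_top R n T).ne)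

omit [CompleteSpace H] in
theorem stronglyMeasurable_bilin {α : Type*} [MeasurableSpace α] {B : α → H →L[ℝ] H →L[ℝ] F}
    {f g : α → H} (hB : StronglyMeasurable B) (hf : StronglyMeasurable f)
    (hg : StronglyMeasurable g) : StronglyMeasurable fun a => B a (f a) (g a) := by
  have hc : Continuous fun p : (H →L[ℝ] H →L[ℝ] F) × H × H => p.1 p.2.1 p.2.2 := by fun_prop
  exact hc.comp_stronglyMeasurable (hB.prodMk (hf.prodMk hg))

omit [CompleteSpace H] in
theorem norm_bilin_indicator_le {α : Type*} {s : Set α} {B : H →L[ℝ] H →L[ℝ] F} {C C₁ C₂ : ℝ}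
    {u v : H} {σ : α} (hC : ‖B‖ ≤ C)
    (hu : ‖u‖ ≤ s.indicator (fun _ => C₁) σ) (hv : ‖v‖ ≤ s.indicator (fun _ => C₂) σ) :
    ‖B u v‖ ≤ s.indicator (fun _ => C * C₁ * C₂) σ := by
  have h : ‖B u v‖ ≤ ‖B‖ * ‖u‖ * ‖v‖ := B.le_opNorm₂ u v
  have hC0 : 0 ≤ C := (norm_nonneg B).trans hC
  by_cases hσ : σ ∈ s
  · simp only [indicator_of_mem hσ] at *
    refine h.trans ?_
    have := (norm_nonneg u).trans hu
    gcongr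
  · simp only [indicator_of_notMem hσ] at *
    refine h.trans ?_
    rw [le_antisymm hu (norm_nonneg u)]; simp

/-- Joint integrability in time and configuration is what later permits exchanging the two integrals
in the evolution equation. -/
theorem integrable_sectorPairing_prod {B : ℝ → H →L[ℝ] H →L[ℝ] F} (hB : Continuous B) (n : ℕ)
    {T : ℝ} (hT : 0 ≤ T) :
    Integrable (Function.uncurry fun (t : ℝ) (σ : Fin n → ℝ × Fin R) =>
      B t (M.sectorWave θ₁ n t σ) (M.sectorWave θ₂ n t σ))
      ((volume.restrict (uIoc 0 T)).prod (sectorMeasure R n)) := by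
  obtain ⟨C₁, hC₁, h₁⟩ := M.exists_norm_sectorWave_le θ₁ n T
  obtain ⟨C₂, hC₂, h₂⟩ := M.exists_norm_sectorWave_le θ₂ n T
  obtain ⟨C, hC⟩ := IsCompact.exists_bound_of_continuousOn
    (E := H →L[ℝ] H →L[ℝ] F) (f := B) (isCompact_Icc (a := (0 : ℝ)) (b := T)) hB.continuousOn
  have : TopologicalSpace.PseudoMetrizableSpace (H →L[ℝ] H →L[ℝ] F) :=
    PseudoEMetricSpace.pseudoMetrizableSpace (α := H →L[ℝ] H →L[ℝ] F)
  have : IsFiniteMeasure (volume.restrict (uIoc 0 T)) := by rw [uIoc_of_le hT]; infer_instance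
  have hmeas : StronglyMeasurable (Function.uncurry fun (t : ℝ) (σ : Fin n → ℝ × Fin R) =>
      B t (M.sectorWave θ₁ n t σ) (M.sectorWave θ₂ n t σ)) :=
    stronglyMeasurable_bilin (hB.stronglyMeasurable.comp_measurable measurable_fst)
      (M.stronglyMeasurable_sectorWave θ₁ n) (M.stronglyMeasurable_sectorWave θ₂ n)
  have hdom : Integrable (fun p : ℝ × (Fin n → ℝ × Fin R) =>
      (1 : ℝ) * (timeBox R n T).indicator (fun _ => C * C₁ * C₂) p.2)
      ((volume.restrict (uIoc 0 T)).prod (sectorMeasure R n)) :=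
    Integrable.mul_prod (integrable_const (1 : ℝ)) (integrable_indicator_timeBox n T _)
  refine hdom.mono' hmeas.aestronglyMeasurable ?_
  have hae : ∀ᵐ p ∂((volume.restrict (uIoc 0 T)).prod (sectorMeasure R n)),
      p ∈ uIoc 0 T ×ˢ ordered R n := by
    rw [sectorMeasure, Measure.prod_restrict]
    exact ae_restrict_mem (measurableSet_uIoc.prod (measurableSet_ordered R n))
  filter_upwards [hae] with p hp
  have ht : p.1 ∈ Icc 0 T := by
    have := hp.1
    rw [uIoc_of_le hT] at this
    exact ⟨this.1.le, this.2⟩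
  rw [one_mul]
  exact norm_bilin_indicator_le (hC _ ht) (h₁ _ ht _ hp.2) (h₂ _ ht _ hp.2)

theorem integrable_sectorPairing (B : H →L[ℝ] H →L[ℝ] F) (n : ℕ) {t : ℝ} (ht : 0 ≤ t) :
    Integrable (fun σ => B (M.sectorWave θ₁ n t σ) (M.sectorWave θ₂ n t σ))
      (sectorMeasure R n) := by
  obtain ⟨C₁, hC₁, h₁⟩ := M.exists_norm_sectorWave_le θ₁ n t
  obtain ⟨C₂, hC₂, h₂⟩ := M.exists_norm_sectorWave_le θ₂ n t
  have hw : ∀ θ, StronglyMeasurable fun σ => M.sectorWave θ n t σ := fun θ =>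
    (M.stronglyMeasurable_sectorWave θ n).comp_measurable measurable_prodMk_left
  refine (integrable_indicator_timeBox n t (‖B‖ * C₁ * C₂)).mono'
    (stronglyMeasurable_bilin stronglyMeasurable_const (hw θ₁) (hw θ₂)).aestronglyMeasurable ?_
  filter_upwards [ae_mem_ordered R n] with σ hσ
  exact norm_bilin_indicator_le le_rfl (h₁ t ⟨ht, le_rfl⟩ σ hσ) (h₂ t ⟨ht, le_rfl⟩ σ hσ)

theorem intervalIntegrable_sectorPairing {B : ℝ → H →L[ℝ] H →L[ℝ] F} (hB : Continuous B) (n : ℕ)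
    {T : ℝ} (hT : 0 ≤ T) :
    IntervalIntegrable (fun t => M.sectorPairing θ₁ θ₂ (B t) n t) volume 0 T :=
  intervalIntegrable_iff.2 (M.integrable_sectorPairing_prod θ₁ θ₂ hB n hT).integral_prod_left

/-- The action of the generators between two emissions on bilinear expressions. -/
noncomputable def drift (B : H →L[ℝ] H →L[ℝ] F) (t : ℝ) : H →L[ℝ] H →L[ℝ] F :=
  B.comp ((M.noJumpOp θ₁ t).restrictScalars ℝ) +
    (B.flip.comp ((M.noJumpOp θ₂ t).restrictScalars ℝ)).flip

@[simp]
theorem drift_apply (B : H →L[ℝ] H →L[ℝ] F) (t : ℝ) (u v : H) :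
    M.drift θ₁ θ₂ B t u v = B (M.noJumpOp θ₁ t u) v + B u (M.noJumpOp θ₂ t v) := rfl

theorem continuous_drift (B : H →L[ℝ] H →L[ℝ] F) : Continuous (M.drift θ₁ θ₂ B) :=
  (continuous_const.clm_comp (M.continuous_noJumpOp_restrictScalars θ₁)).add
    ((ContinuousLinearMap.flipₗᵢ ℝ H H F).continuous.comp
      (continuous_const.clm_comp (M.continuous_noJumpOp_restrictScalars θ₂)))

/-- The action of the jumps on bilinear expressions. -/
noncomputable def jumpForm (B : H →L[ℝ] H →L[ℝ] F) : H →L[ℝ] H →L[ℝ] F :=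
  ∑ k, (B.comp ((M.jumpOp θ₁ k).restrictScalars ℝ)).flip.comp
    ((M.jumpOp θ₂ k).restrictScalars ℝ) |>.flip

@[simp]
theorem jumpForm_apply (B : H →L[ℝ] H →L[ℝ] F) (u v : H) :
    M.jumpForm θ₁ θ₂ B u v = ∑ k, B (M.jumpOp θ₁ k u) (M.jumpOp θ₂ k v) := by
  simp [jumpForm]

variable [CompleteSpace F]

/-- This is the product rule for the two no-jump evolutions, integrated from s to t. -/
theorem bilin_timeOrderedExp_eq (B : H →L[ℝ] H →L[ℝ] F) (s t : ℝ) (u v : H) :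
    B (timeOrderedExp (M.noJumpGenerator θ₁) s t u) (timeOrderedExp (M.noJumpGenerator θ₂) s t v) =
      B u v + ∫ τ in s..t, M.drift θ₁ θ₂ B τ (timeOrderedExp (M.noJumpGenerator θ₁) s τ u)
        (timeOrderedExp (M.noJumpGenerator θ₂) s τ v) := by
  have hc : ∀ θ w, Continuous fun τ => timeOrderedExp (M.noJumpGenerator θ) s τ w := fun θ w => by
    rw [noJumpGenerator_eq]; exact continuous_timeOrderedExp_apply (M.continuous_noJumpOp_restrictScalars θ) s w
  have hd : ∀ θ w τ, HasDerivAt (fun τ => timeOrderedExp (M.noJumpGenerator θ) s τ w)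
      (M.noJumpOp θ τ (timeOrderedExp (M.noJumpGenerator θ) s τ w)) τ := fun θ w τ => by
    rw [noJumpGenerator_eq]; exact hasDerivAt_timeOrderedExp (M.continuous_noJumpOp_restrictScalars θ) s τ w
  rw [intervalIntegral.integral_eq_sub_of_hasDerivAt (f := fun τ =>
    B (timeOrderedExp (M.noJumpGenerator θ₁) s τ u)
      (timeOrderedExp (M.noJumpGenerator θ₂) s τ v))]
  · simp [timeOrderedExp_self]
  · intro τ _
    have := B.hasDerivAt_of_bilinear (fun _ => hd θ₁ u τ) (fun _ => hd θ₂ v τ)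
    rw [drift_apply, add_comm]
    exact this
  · exact (((M.continuous_drift θ₁ θ₂ B).clm_apply (hc θ₁ u)).clm_apply
      (hc θ₂ v)).intervalIntegrable _ _

theorem sectorPairing_zero_eq (B : H →L[ℝ] H →L[ℝ] F) (t : ℝ) :
    M.sectorPairing θ₁ θ₂ B 0 t = B M.ψ M.ψ +
      ∫ τ in (0 : ℝ)..t, M.sectorPairing θ₁ θ₂ (M.drift θ₁ θ₂ B τ) 0 τ := by
  have h : ∀ (C : H →L[ℝ] H →L[ℝ] F) t, M.sectorPairing θ₁ θ₂ C 0 t =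
      C (timeOrderedExp (M.noJumpGenerator θ₁) 0 t M.ψ)
        (timeOrderedExp (M.noJumpGenerator θ₂) 0 t M.ψ) := by
    intro C t
    rw [sectorPairing, integral_sectorMeasure_zero]
    simp [sectorWave, amplitude]
  simp only [h]
  exact M.bilin_timeOrderedExp_eq θ₁ θ₂ B 0 t M.ψ M.ψ

/-- For a fixed configuration the wave function vanishes before the latest emission time, jumps
there to the emission vector and follows the no-jump evolution afterwards. The first term on the
right records the jump. -/
theorem bilin_sectorWave_succ (B : H →L[ℝ] H →L[ℝ] F) {n : ℕ} {t : ℝ} (ht : 0 ≤ t)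
    {σ : Fin (n + 1) → ℝ × Fin R} (hσ : σ ∈ ordered R (n + 1)) :
    B (M.sectorWave θ₁ (n + 1) t σ) (M.sectorWave θ₂ (n + 1) t σ) =
      {σ : Fin (n + 1) → ℝ × Fin R | (σ 0).1 ≤ t}.indicator
        (fun σ => B (M.emission θ₁ n σ) (M.emission θ₂ n σ)) σ +
      ∫ τ in (0 : ℝ)..t, M.drift θ₁ θ₂ B τ (M.sectorWave θ₁ (n + 1) τ σ)
        (M.sectorWave θ₂ (n + 1) τ σ) := by
  set s := (σ 0).1
  have hs : 0 < s := hσ.2 0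
  have hin : ∀ θ τ, s ≤ τ → M.sectorWave θ (n + 1) τ σ =
      timeOrderedExp (M.noJumpGenerator θ) s τ (M.emission θ n σ) := fun θ τ h => by
    rw [sectorWave, indicator_of_mem]
    · rfl
    · exact (forall_le_iff_of_ordered hσ).2 h
  have hout : ∀ θ τ, τ < s → M.sectorWave θ (n + 1) τ σ = 0 := fun θ τ h => by
    rw [sectorWave, indicator_of_notMem]
    exact fun h' => absurd ((forall_le_iff_of_ordered hσ).1 h') (not_le.2 h)
  set g : ℝ → F := fun τ => M.drift θ₁ θ₂ B τ (M.sectorWave θ₁ (n + 1) τ σ)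
        (M.sectorWave θ₂ (n + 1) τ σ)
  have hg0 : ∀ τ < s, g τ = 0 := fun τ hτ => by simp only [g, hout _ τ hτ]; simp
  rcases le_or_gt s t with hst | hst
  · rw [indicator_of_mem (by exact hst), hin θ₁ t hst, hin θ₂ t hst, M.bilin_timeOrderedExp_eq]
    congr 1
    -- The integrand vanishes only strictly before s, so the endpoint, where the vector has already
    -- jumped, is removed as a null set.
    have h1 : ∫ τ in (0 : ℝ)..s, g τ = 0 := by
      rw [intervalIntegral.integral_of_le hs.le, integral_Ioc_eq_integral_Ioo]
      exact setIntegral_eq_zero_of_forall_eq_zero fun τ hτ => hg0 τ hτ.2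
    have hg : EqOn (fun τ => M.drift θ₁ θ₂ B τ (timeOrderedExp (M.noJumpGenerator θ₁) s τ
        (M.emission θ₁ n σ)) (timeOrderedExp (M.noJumpGenerator θ₂) s τ (M.emission θ₂ n σ))) g
        (uIcc s t) := by
      intro τ hτ
      rw [uIcc_of_le hst] at hτ
      simp only [g, hin _ τ hτ.1]
    rw [intervalIntegral.integral_congr hg, ← intervalIntegral.integral_add_adjacent_intervals
      (a := 0) (b := s) (c := t), h1, zero_add]
    · rw [intervalIntegrable_iff_integrableOn_Ioo_of_le hs.le]
      exact integrableOn_zero.congr_fun (fun τ hτ => (hg0 τ hτ.2).symm) measurableSet_Ioo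
    · have hc : ∀ θ w, Continuous fun τ => timeOrderedExp (M.noJumpGenerator θ) s τ w := by
        intro θ w
        rw [noJumpGenerator_eq]
        exact continuous_timeOrderedExp_apply (M.continuous_noJumpOp_restrictScalars θ) s w
      refine (intervalIntegrable_congr fun τ hτ => hg (uIoc_subset_uIcc hτ)).1 ?_
      exact (((M.continuous_drift θ₁ θ₂ B).clm_apply (hc θ₁ _)).clm_apply
        (hc θ₂ _)).intervalIntegrable _ _
  · rw [indicator_of_notMem (by exact not_le.2 hst), hout θ₁ t hst, hout θ₂ t hst]
    have h1 : ∫ τ in (0 : ℝ)..t, g τ = 0 := by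
      rw [intervalIntegral.integral_of_le ht]
      exact setIntegral_eq_zero_of_forall_eq_zero fun τ hτ => hg0 τ (hτ.2.trans_lt hst)
    simp [h1]

/-- Fubini in the latest quantum: its time becomes the integration variable s, the sum over its
channel builds the jump form, and the remaining n quanta form the wave function at time s. This is
how sector n feeds sector n + 1. -/
theorem integral_emission (B : H →L[ℝ] H →L[ℝ] F) (n : ℕ) {t : ℝ} (ht : 0 ≤ t) :
    Integrable ({σ : Fin (n + 1) → ℝ × Fin R | (σ 0).1 ≤ t}.indicator
      (fun σ => B (M.emission θ₁ n σ) (M.emission θ₂ n σ))) (sectorMeasure R (n + 1)) ∧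
    ∫ σ, {σ : Fin (n + 1) → ℝ × Fin R | (σ 0).1 ≤ t}.indicator
      (fun σ => B (M.emission θ₁ n σ) (M.emission θ₂ n σ)) σ ∂(sectorMeasure R (n + 1)) =
    ∫ s in (0 : ℝ)..t, M.sectorPairing θ₁ θ₂ (M.jumpForm θ₁ θ₂ B) n s := by
  set f : (Fin (n + 1) → ℝ × Fin R) → F := {σ : Fin (n + 1) → ℝ × Fin R | (σ 0).1 ≤ t}.indicator
      (fun σ => B (M.emission θ₁ n σ) (M.emission θ₂ n σ)) with hfdef
  have hcont : Continuous fun σ => B (M.emission θ₁ n σ) (M.emission θ₂ n σ) := by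
    have h1 := M.continuous_emission θ₁ n
    have h2 := M.continuous_emission θ₂ n
    fun_prop
  have hmeas : MeasurableSet {σ : Fin (n + 1) → ℝ × Fin R | (σ 0).1 ≤ t} :=
    measurableSet_le (by fun_prop) measurable_const
  have hf : Integrable f (sectorMeasure R (n + 1)) := by
    obtain ⟨C, hC⟩ := (isCompact_timeBox R (n + 1) t).exists_bound_of_continuousOn
      hcont.continuousOn
    refine (integrable_indicator_timeBox (n + 1) t C).mono'
      (hcont.stronglyMeasurable.indicator hmeas).aestronglyMeasurable ?_
    filter_upwards [ae_mem_ordered R (n + 1)] with σ hσ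
    by_cases h : (σ 0).1 ≤ t
    · have hb := mem_timeBox hσ ((forall_le_iff_of_ordered hσ).2 h) le_rfl
      rw [hfdef, indicator_of_mem (by exact h), indicator_of_mem hb]
      exact hC σ hb
    · rw [hfdef, indicator_of_notMem (by exact h), norm_zero]
      by_cases hb : σ ∈ timeBox R (n + 1) t
      · rw [indicator_of_mem hb]; exact (norm_nonneg _).trans (hC σ hb)
      · rw [indicator_of_notMem hb]
  refine ⟨hf, ?_⟩
  rw [(integral_sectorMeasure_succ hf).2, intervalIntegral.integral_of_le ht]
  have hpt : ∀ s ∈ Ioi (0 : ℝ), (∑ k, ∫ τ, {τ : Fin n → ℝ × Fin R | ∀ j, (τ j).1 ≤ s}.indicator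
        (fun τ => f (Fin.cons (s, k) τ)) τ ∂(sectorMeasure R n)) =
      (Ioc (0 : ℝ) t).indicator
        (fun s => M.sectorPairing θ₁ θ₂ (M.jumpForm θ₁ θ₂ B) n s) s := by
    intro s hs
    by_cases hst : s ≤ t
    · rw [indicator_of_mem (show s ∈ Ioc 0 t from ⟨hs, hst⟩), sectorPairing]
      simp only [jumpForm_apply]
      rw [integral_finsetSum]
      · refine Finset.sum_congr rfl fun k _ => integral_congr_ae (Eventually.of_forall fun τ => ?_)
        by_cases hτ : ∀ j, (τ j).1 ≤ s
        · simp only [sectorWave]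
          rw [indicator_of_mem (s := {τ : Fin n → ℝ × Fin R | ∀ j, (τ j).1 ≤ s}) hτ,
            indicator_of_mem (s := {τ : Fin n → ℝ × Fin R | ∀ j, (τ j).1 ≤ s}) hτ,
            indicator_of_mem (s := {τ : Fin n → ℝ × Fin R | ∀ j, (τ j).1 ≤ s}) hτ, hfdef,
            indicator_of_mem (by exact hst)]
          simp [emission]
        · simp only [sectorWave]
          rw [indicator_of_notMem (s := {τ : Fin n → ℝ × Fin R | ∀ j, (τ j).1 ≤ s}) hτ,
            indicator_of_notMem (s := {τ : Fin n → ℝ × Fin R | ∀ j, (τ j).1 ≤ s}) hτ,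
            indicator_of_notMem (s := {τ : Fin n → ℝ × Fin R | ∀ j, (τ j).1 ≤ s}) hτ]
          simp
      · intro k _
        exact M.integrable_sectorPairing θ₁ θ₂
          ((B.comp ((M.jumpOp θ₁ k).restrictScalars ℝ)).flip.comp
            ((M.jumpOp θ₂ k).restrictScalars ℝ)).flip n (le_of_lt hs)
    · rw [indicator_of_notMem (fun h => hst h.2)]
      refine Finset.sum_eq_zero fun k _ => integral_eq_zero_of_ae (Eventually.of_forall fun τ => ?_)
      have : f (Fin.cons (s, k) τ) = 0 := by
        rw [hfdef, indicator_of_notMem]; exact hst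
      simp only [indicator, this, ite_self, Pi.zero_apply]
  rw [setIntegral_congr_fun measurableSet_Ioi hpt, setIntegral_indicator measurableSet_Ioc]
  congr 2
  ext s; simp +contextual

/-- The integrated evolution equation on the sector with `n + 1` quanta. -/
theorem sectorPairing_succ_eq (B : H →L[ℝ] H →L[ℝ] F) (n : ℕ) {t : ℝ} (ht : 0 ≤ t) :
    M.sectorPairing θ₁ θ₂ B (n + 1) t =
      (∫ s in (0 : ℝ)..t, M.sectorPairing θ₁ θ₂ (M.jumpForm θ₁ θ₂ B) n s) +
      ∫ s in (0 : ℝ)..t, M.sectorPairing θ₁ θ₂ (M.drift θ₁ θ₂ B s) (n + 1) s := by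
  have hint := M.integrable_sectorPairing_prod θ₁ θ₂ (M.continuous_drift θ₁ θ₂ B) (n + 1) ht
  obtain ⟨h1, h2⟩ := M.integral_emission θ₁ θ₂ B n ht
  have hswap := intervalIntegral_integral_swap hint
  unfold sectorPairing at h2 ⊢
  rw [hswap, ← h2, ← integral_add h1]
  · refine integral_congr_ae ?_
    filter_upwards [ae_mem_ordered R (n + 1)] with σ hσ
    exact M.bilin_sectorWave_succ θ₁ θ₂ B ht hσ
  · have := hint.integral_prod_right
    simp only [intervalIntegral.integral_of_le ht]
    rwa [uIoc_of_le ht] at this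

end Model

/-! ### Gluing the sectors into Fock space -/

theorem measurableEmbedding_sigmaMk (R n : ℕ) :
    MeasurableEmbedding (@Sigma.mk ℕ (fun n => Fin n → ℝ × Fin R) n) := by
  have hmeas : ∀ s : Set (Config R), MeasurableSet s ↔
      ∀ m, MeasurableSet (@Sigma.mk ℕ (fun n => Fin n → ℝ × Fin R) m ⁻¹' s) := fun s =>
    MeasurableSpace.measurableSet_iInf
  refine ⟨sigma_mk_injective, fun s hs => (hmeas s).1 hs n, fun s hs => (hmeas _).2 fun m => ?_⟩
  rcases eq_or_ne m n with rfl | h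
  · rwa [preimage_image_eq _ sigma_mk_injective]
  · convert MeasurableSet.empty
    ext τ
    simp only [mem_preimage, mem_image, mem_empty_iff_false, iff_false]
    rintro ⟨σ, -, hσ⟩
    exact h (congrArg Sigma.fst hσ).symm

theorem fockMeasure_eq (R : ℕ) :
    fockMeasure R = Measure.sum fun n => (sectorMeasure R n).map (Sigma.mk n) := rfl

theorem integrable_fockMeasure {E : Type*} [NormedAddCommGroup E] {R : ℕ} {f : Config R → E}
    (hf : ∀ n, Integrable (fun σ => f ⟨n, σ⟩) (sectorMeasure R n))
    (hs : Summable fun n => ∫ σ, ‖f ⟨n, σ⟩‖ ∂(sectorMeasure R n)) :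
    Integrable f (fockMeasure R) := by
  rw [fockMeasure_eq]
  refine integrable_sum_measure (fun n =>
    ((measurableEmbedding_sigmaMk R n).integrable_map_iff).2 (hf n)) ?_
  simpa only [(measurableEmbedding_sigmaMk R _).integral_map] using hs

theorem hasSum_integral_fockMeasure {E : Type*} [NormedAddCommGroup E] [NormedSpace ℝ E] {R : ℕ}
    {f : Config R → E} (hf : Integrable f (fockMeasure R)) :
    HasSum (fun n => ∫ σ, f ⟨n, σ⟩ ∂(sectorMeasure R n)) (∫ σ, f σ ∂(fockMeasure R)) := by
  rw [fockMeasure_eq] at hf ⊢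
  simpa only [(measurableEmbedding_sigmaMk R _).integral_map] using hasSum_integral_measure hf

theorem aestronglyMeasurable_fockMeasure {E : Type*} [NormedAddCommGroup E] {R : ℕ}
    {f : Config R → E}
    (hf : ∀ n, AEStronglyMeasurable (fun σ => f ⟨n, σ⟩) (sectorMeasure R n)) :
    AEStronglyMeasurable f (fockMeasure R) := by
  rw [fockMeasure_eq]
  exact aestronglyMeasurable_sum_measure_iff.2 fun n =>
    ((measurableEmbedding_sigmaMk R n).aestronglyMeasurable_map_iff).2 (hf n)

/-! ### The bilinear forms to which the evolution equation is applied -/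

section Forms

variable {H : Type*} [NormedAddCommGroup H] [InnerProductSpace ℂ H]

/-- The real-bilinear form `(u, v) ↦ ⟨u, A v⟩`. -/
noncomputable def expectationForm (A : H →L[ℂ] H) : H →L[ℝ] H →L[ℝ] ℂ :=
  LinearMap.mkContinuous₂ (LinearMap.mk₂ ℝ (fun u v => inner ℂ u (A v))
    (fun _ _ _ => inner_add_left _ _ _) (fun c u v => by
      rw [← Complex.coe_smul, inner_smul_left]; simp)
    (fun _ _ _ => by rw [map_add, inner_add_right]) (fun c u v => by
      rw [← Complex.coe_smul, map_smul, inner_smul_right]; simp)) ‖A‖ (fun u v => by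
      calc ‖inner ℂ u (A v)‖ ≤ ‖u‖ * ‖A v‖ := norm_inner_le_norm _ _
        _ ≤ ‖u‖ * (‖A‖ * ‖v‖) := by gcongr; exact A.le_opNorm v
        _ = ‖A‖ * ‖u‖ * ‖v‖ := by ring)

@[simp]
theorem expectationForm_apply (A : H →L[ℂ] H) (u v : H) :
    expectationForm A u v = inner ℂ u (A v) := rfl

/-- The real-bilinear form `(u, v) ↦ |u⟩⟨v|`. -/
noncomputable def rankOneForm : H →L[ℝ] H →L[ℝ] (H →L[ℂ] H) :=
  LinearMap.mkContinuous₂ (LinearMap.mk₂ ℝ (fun u v => InnerProductSpace.rankOne ℂ u v)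
    (fun _ _ _ => by simp) (fun c u v => by
      ext z
      rw [InnerProductSpace.rankOne_apply, smul_apply, InnerProductSpace.rankOne_apply, smul_comm])
    (fun _ _ _ => by simp) (fun c u v => by
      ext z
      rw [InnerProductSpace.rankOne_apply, smul_apply, InnerProductSpace.rankOne_apply,
        ← Complex.coe_smul c v, inner_smul_left, Complex.conj_ofReal, mul_smul, Complex.coe_smul])) 1 (fun u v => by
      simp [InnerProductSpace.norm_rankOne])

@[simp]
theorem rankOneForm_apply (u v : H) :
    rankOneForm u v = InnerProductSpace.rankOne ℂ u v := rfl

/-- The real-bilinear form `(u, v) ↦ Re ⟨u, v⟩`. -/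
noncomputable def realInnerForm : H →L[ℝ] H →L[ℝ] ℝ :=
  LinearMap.mkContinuous₂ (LinearMap.mk₂ ℝ (fun u v => (inner ℂ u v).re)
    (fun _ _ _ => by simp) (fun c u v => by
      rw [← Complex.coe_smul, inner_smul_left]; simp)
    (fun _ _ _ => by simp) (fun c u v => by
      rw [← Complex.coe_smul, inner_smul_right]; simp)) 1 (fun u v => by
      rw [one_mul]
      exact (Complex.abs_re_le_norm _).trans (norm_inner_le_norm _ _))

@[simp]
theorem realInnerForm_apply (u v : H) : realInnerForm u v = (inner ℂ u v).re := rfl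

theorem realInnerForm_self (u : H) : realInnerForm u u = ‖u‖ ^ 2 := by
  rw [realInnerForm_apply, inner_self_eq_norm_sq_to_K]
  norm_cast

end Forms

/-! ### Summation over the sectors and the evolution equation on Fock space -/

namespace Model

variable {H : Type*} [NormedAddCommGroup H] [InnerProductSpace ℂ H] [CompleteSpace H] {d R : ℕ}
variable (M : Model H d R)

/-- The squared norm of the `n`-quanta component. -/
noncomputable def sectorNormSq (θ : Fin d → ℝ) (n : ℕ) (t : ℝ) : ℝ :=
  ∫ σ, ‖M.sectorWave θ n t σ‖ ^ 2 ∂(sectorMeasure R n)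

theorem sectorPairing_realInnerForm (θ : Fin d → ℝ) (n : ℕ) (t : ℝ) :
    M.sectorPairing θ θ realInnerForm n t = M.sectorNormSq θ n t := by
  simp only [sectorPairing, sectorNormSq, realInnerForm_self]

theorem sectorNormSq_nonneg (θ : Fin d → ℝ) (n : ℕ) (t : ℝ) : 0 ≤ M.sectorNormSq θ n t :=
  integral_nonneg fun _ => by positivity

theorem integrable_norm_sq_sectorWave (θ : Fin d → ℝ) (n : ℕ) {t : ℝ} (ht : 0 ≤ t) :
    Integrable (fun σ => ‖M.sectorWave θ n t σ‖ ^ 2) (sectorMeasure R n) := by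
  simpa only [realInnerForm_self] using M.integrable_sectorPairing θ θ realInnerForm n ht

/-- Between two emissions and at the emissions the inner product changes by the difference of
the jump amplitudes. -/
theorem inner_noJumpOp_add {θ₁ θ₂ : Fin d → ℝ} (h₁ : ∀ k, 0 ≤ M.γ θ₁ k) (h₂ : ∀ k, 0 ≤ M.γ θ₂ k)
    (hJ : M.J θ₁ = M.J θ₂) (t : ℝ) (u v : H) :
    inner ℂ (M.noJumpOp θ₁ t u) v + inner ℂ u (M.noJumpOp θ₂ t v) =
      -(1 / 2 : ℂ) * ∑ k, ((Real.sqrt (M.γ θ₁ k) ^ 2 + Real.sqrt (M.γ θ₂ k) ^ 2 : ℝ) : ℂ) *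
        inner ℂ (M.J θ₁ k u) (M.J θ₁ k v) := by
  have hself : inner ℂ (M.Hc t u) v = inner ℂ u (M.Hc t v) := by
    have := (M.Hc_selfAdjoint t)
    rw [← ContinuousLinearMap.adjoint_inner_right, ← ContinuousLinearMap.star_eq_adjoint, this]
  have hk : ∀ k, inner ℂ ((star (M.J θ₁ k) * M.J θ₁ k) u) v =
      inner ℂ (M.J θ₁ k u) (M.J θ₁ k v) := fun k => by
    rw [mul_apply_eq_comp, ContinuousLinearMap.star_eq_adjoint,
      ContinuousLinearMap.adjoint_inner_left]
  have hk' : ∀ k, inner ℂ u ((star (M.J θ₁ k) * M.J θ₁ k) v) =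
      inner ℂ (M.J θ₁ k u) (M.J θ₁ k v) := fun k => by
    rw [mul_apply_eq_comp, ContinuousLinearMap.star_eq_adjoint,
      ContinuousLinearMap.adjoint_inner_right]
  simp only [noJumpOp, ← hJ, sub_apply, neg_apply,
    smul_apply, sum_apply, inner_sub_left, inner_sub_right, inner_neg_left,
    inner_neg_right, inner_smul_left, inner_smul_right, sum_inner, inner_sum, hself, hk, hk',
    Real.sq_sqrt (h₁ _), Real.sq_sqrt (h₂ _), Complex.conj_ofReal,
    Complex.conj_I, Complex.ofReal_add, add_mul,
    Finset.sum_add_distrib]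
  have h2 : (starRingEnd ℂ) 2 = 2 := map_ofNat _ 2
  simp [h2]
  ring

/-- This is the cross term ab which completes the drift contribution -½(a² + b²) to -½(a - b)²,
where a and b are the two amplitudes √γ_k. -/
theorem inner_jumpOp {θ₁ θ₂ : Fin d → ℝ} (hJ : M.J θ₁ = M.J θ₂) (k : Fin R) (u v : H) :
    inner ℂ (M.jumpOp θ₁ k u) (M.jumpOp θ₂ k v) =
      ((Real.sqrt (M.γ θ₁ k) * Real.sqrt (M.γ θ₂ k) : ℝ) : ℂ) *
        inner ℂ (M.J θ₁ k u) (M.J θ₁ k v) := by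
  simp only [jumpOp, ← hJ, smul_apply, inner_smul_left, inner_smul_right,
    map_mul, map_neg, Complex.conj_I, Complex.conj_ofReal, Complex.ofReal_mul]
  linear_combination (-(Real.sqrt (M.γ θ₁ k) : ℂ) * (Real.sqrt (M.γ θ₂ k) : ℂ) *
        inner ℂ (M.J θ₁ k u) (M.J θ₁ k v)) * Complex.I_mul_I

/-- A bound on the total emission rate. -/
noncomputable def rateBound (θ : Fin d → ℝ) : ℝ := ∑ k, Real.sqrt (M.γ θ k) ^ 2 * ‖M.J θ k‖ ^ 2

theorem rateBound_nonneg (θ : Fin d → ℝ) : 0 ≤ M.rateBound θ :=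
  Finset.sum_nonneg fun _ _ => by positivity

/-- The self-adjoint Hamiltonian preserves the norm, and the remaining part of the no-jump generator
is minus a positive operator. -/
theorem drift_realInnerForm_self_nonpos {θ : Fin d → ℝ} (h : ∀ k, 0 ≤ M.γ θ k) (t : ℝ) (u : H) :
    M.drift θ θ realInnerForm t u u ≤ 0 := by
  rw [drift_apply, realInnerForm_apply, realInnerForm_apply, ← Complex.add_re,
    M.inner_noJumpOp_add h h rfl, neg_mul, Complex.neg_re]
  have : (1 / 2 : ℂ) = ((1 / 2 : ℝ) : ℂ) := by norm_num
  rw [this, Complex.re_ofReal_mul, Complex.re_sum]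
  refine neg_nonpos.2 (mul_nonneg (by norm_num) (Finset.sum_nonneg fun k _ => ?_))
  rw [Complex.re_ofReal_mul]
  have := realInnerForm_self (M.J θ k u)
  rw [realInnerForm_apply] at this
  rw [this]
  positivity

theorem jumpForm_realInnerForm_self_le (θ : Fin d → ℝ) (u : H) :
    M.jumpForm θ θ realInnerForm u u ≤ M.rateBound θ * ‖u‖ ^ 2 := by
  rw [jumpForm_apply, rateBound, Finset.sum_mul]
  refine Finset.sum_le_sum fun k _ => ?_
  rw [realInnerForm_apply, M.inner_jumpOp rfl, Complex.re_ofReal_mul]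
  have := realInnerForm_self (M.J θ k u)
  rw [realInnerForm_apply] at this
  rw [this, ← sq, mul_assoc]
  refine mul_le_mul_of_nonneg_left ?_ (sq_nonneg _)
  rw [← mul_pow]
  exact pow_le_pow_left₀ (norm_nonneg _) ((M.J θ k).le_opNorm u) 2

/-- The probability of `n` emissions decays factorially. -/
theorem sectorNormSq_le {θ : Fin d → ℝ} (h : ∀ k, 0 ≤ M.γ θ k) (n : ℕ) :
    ∀ t, 0 ≤ t → M.sectorNormSq θ n t ≤ (M.rateBound θ * t) ^ n / n.factorial := by
  -- Between emissions a sector only loses norm, so for an upper bound the drift can be dropped and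
  -- only the feeding from the sector below remains.
  have hdrift : ∀ n t, 0 ≤ t →
      ∫ s in (0 : ℝ)..t, M.sectorPairing θ θ (M.drift θ θ realInnerForm s) n s ≤ 0 := by
    intro n t ht
    have : 0 ≤ ∫ s in (0 : ℝ)..t, -M.sectorPairing θ θ (M.drift θ θ realInnerForm s) n s :=
      intervalIntegral.integral_nonneg ht fun s _ => neg_nonneg.2
        (integral_nonpos fun σ => M.drift_realInnerForm_self_nonpos h s _)
    rw [intervalIntegral.integral_neg] at this
    linarith
  induction n with
  | zero =>
    intro t ht
    rw [← sectorPairing_realInnerForm, sectorPairing_zero_eq, realInnerForm_self, M.ψ_norm]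
    have := hdrift 0 t ht
    simp only [pow_zero, Nat.factorial_zero, Nat.cast_one, div_one, one_pow]
    linarith
  | succ n ih =>
    intro t ht
    rw [← sectorPairing_realInnerForm, M.sectorPairing_succ_eq θ θ _ n ht]
    have hle : ∀ s ∈ Icc 0 t, M.sectorPairing θ θ (M.jumpForm θ θ realInnerForm) n s ≤
        M.rateBound θ ^ (n + 1) / n.factorial * s ^ n := by
      intro s hs
      calc M.sectorPairing θ θ (M.jumpForm θ θ realInnerForm) n s
          ≤ ∫ σ, M.rateBound θ * ‖M.sectorWave θ n s σ‖ ^ 2 ∂(sectorMeasure R n) :=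
            integral_mono (M.integrable_sectorPairing θ θ _ n hs.1)
              ((M.integrable_norm_sq_sectorWave θ n hs.1).const_mul _)
              fun σ => M.jumpForm_realInnerForm_self_le θ _
        _ = M.rateBound θ * M.sectorNormSq θ n s := integral_const_mul _ _
        _ ≤ M.rateBound θ * ((M.rateBound θ * s) ^ n / n.factorial) :=
            mul_le_mul_of_nonneg_left (ih s hs.1) (M.rateBound_nonneg θ)
        _ = _ := by rw [mul_pow]; ring
    have h1 : ∫ s in (0 : ℝ)..t, M.sectorPairing θ θ (M.jumpForm θ θ realInnerForm) n s ≤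
        ∫ s in (0 : ℝ)..t, M.rateBound θ ^ (n + 1) / n.factorial * s ^ n :=
      intervalIntegral.integral_mono_on ht
        (M.intervalIntegrable_sectorPairing θ θ continuous_const n ht)
        (Continuous.intervalIntegrable (by fun_prop) _ _) hle
    rw [intervalIntegral.integral_const_mul, integral_pow] at h1
    have h2 : M.rateBound θ ^ (n + 1) / n.factorial * ((t ^ (n + 1) - 0 ^ (n + 1)) / (n + 1)) =
        (M.rateBound θ * t) ^ (n + 1) / (n + 1).factorial := by
      rw [Nat.factorial_succ, mul_pow]
      push_cast
      field_simp
      simp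
    rw [h2] at h1
    linarith [hdrift (n + 1) t ht]

theorem sectorNormSq_le_of_le {θ : Fin d → ℝ} (h : ∀ k, 0 ≤ M.γ θ k) (n : ℕ) {t T : ℝ}
    (ht : 0 ≤ t) (hT : t ≤ T) :
    M.sectorNormSq θ n t ≤ (M.rateBound θ * T) ^ n / n.factorial := by
  have := M.rateBound_nonneg θ
  refine (M.sectorNormSq_le h n t ht).trans ?_
  gcongr

theorem summable_sectorNormSq {θ : Fin d → ℝ} (h : ∀ k, 0 ≤ M.γ θ k) {t : ℝ} (ht : 0 ≤ t) :
    Summable fun n => M.sectorNormSq θ n t :=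
  Summable.of_nonneg_of_le (fun n => M.sectorNormSq_nonneg θ n t)
    (fun n => M.sectorNormSq_le h n t ht) (Real.summable_pow_div_factorial _)

theorem stronglyMeasurable_sectorWave_apply (θ : Fin d → ℝ) (n : ℕ) (t : ℝ) :
    StronglyMeasurable (M.sectorWave θ n t) :=
  (M.stronglyMeasurable_sectorWave θ n).comp_measurable measurable_prodMk_left

theorem memLp_waveFunction {θ : Fin d → ℝ} (h : ∀ k, 0 ≤ M.γ θ k) {t : ℝ} (ht : 0 ≤ t) :
    MemLp (M.waveFunction θ t) 2 (fockMeasure R) := by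
  have hm : AEStronglyMeasurable (M.waveFunction θ t) (fockMeasure R) :=
    aestronglyMeasurable_fockMeasure fun n =>
      (M.stronglyMeasurable_sectorWave_apply θ n t).aestronglyMeasurable
  refine (memLp_two_iff_integrable_sq_norm hm).2
    (integrable_fockMeasure (fun n => M.integrable_norm_sq_sectorWave θ n ht) ?_)
  simpa using! M.summable_sectorNormSq h ht

variable {F : Type*} [NormedAddCommGroup F] [NormedSpace ℝ F]
variable {θ₁ θ₂ : Fin d → ℝ}

/-- The integral of a bilinear expression in two wave functions. -/
noncomputable def pairing (θ₁ θ₂ : Fin d → ℝ) (B : H →L[ℝ] H →L[ℝ] F) (t : ℝ) : F :=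
  ∫ σ, B (M.waveFunction θ₁ t σ) (M.waveFunction θ₂ t σ) ∂(fockMeasure R)

/-- Bounding ‖u‖‖v‖ by ‖u‖² + ‖v‖² reduces every bilinear expression to the emission probabilities,
whose factorial decay makes the sums over sectors converge. -/
theorem integral_norm_bilin_le (B : H →L[ℝ] H →L[ℝ] F) (n : ℕ) {t : ℝ} (ht : 0 ≤ t) :
    ∫ σ, ‖B (M.sectorWave θ₁ n t σ) (M.sectorWave θ₂ n t σ)‖ ∂(sectorMeasure R n) ≤
      ‖B‖ * (M.sectorNormSq θ₁ n t + M.sectorNormSq θ₂ n t) := by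
  rw [sectorNormSq, sectorNormSq, ← integral_add (M.integrable_norm_sq_sectorWave θ₁ n ht)
    (M.integrable_norm_sq_sectorWave θ₂ n ht), ← integral_const_mul]
  refine integral_mono (M.integrable_sectorPairing θ₁ θ₂ B n ht).norm
    (((M.integrable_norm_sq_sectorWave θ₁ n ht).add
      (M.integrable_norm_sq_sectorWave θ₂ n ht)).const_mul _) fun σ => ?_
  set u := M.sectorWave θ₁ n t σ
  set v := M.sectorWave θ₂ n t σ
  calc ‖B u v‖ ≤ ‖B‖ * ‖u‖ * ‖v‖ := B.le_opNorm₂ u v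
    _ = ‖B‖ * (‖u‖ * ‖v‖) := by ring
    _ ≤ ‖B‖ * (‖u‖ ^ 2 + ‖v‖ ^ 2) := by
      gcongr
      nlinarith [sq_nonneg (‖u‖ - ‖v‖), sq_nonneg ‖u‖, sq_nonneg ‖v‖]

theorem norm_sectorPairing_le (B : H →L[ℝ] H →L[ℝ] F) (n : ℕ) {t : ℝ} (ht : 0 ≤ t) :
    ‖M.sectorPairing θ₁ θ₂ B n t‖ ≤ ‖B‖ * (M.sectorNormSq θ₁ n t + M.sectorNormSq θ₂ n t) :=
  (norm_integral_le_integral_norm _).trans (M.integral_norm_bilin_le B n ht)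

theorem integrable_pairing (h₁ : ∀ k, 0 ≤ M.γ θ₁ k) (h₂ : ∀ k, 0 ≤ M.γ θ₂ k)
    (B : H →L[ℝ] H →L[ℝ] F) {t : ℝ} (ht : 0 ≤ t) :
    Integrable (fun σ => B (M.waveFunction θ₁ t σ) (M.waveFunction θ₂ t σ)) (fockMeasure R) :=
  integrable_fockMeasure (fun n => M.integrable_sectorPairing θ₁ θ₂ B n ht)
    (Summable.of_nonneg_of_le (fun _ => integral_nonneg fun _ => norm_nonneg _)
      (fun n => M.integral_norm_bilin_le B n ht)
      (((M.summable_sectorNormSq h₁ ht).add (M.summable_sectorNormSq h₂ ht)).mul_left _))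

theorem hasSum_sectorPairing (h₁ : ∀ k, 0 ≤ M.γ θ₁ k) (h₂ : ∀ k, 0 ≤ M.γ θ₂ k)
    (B : H →L[ℝ] H →L[ℝ] F) {t : ℝ} (ht : 0 ≤ t) :
    HasSum (fun n => M.sectorPairing θ₁ θ₂ B n t) (M.pairing θ₁ θ₂ B t) :=
  hasSum_integral_fockMeasure (M.integrable_pairing h₁ h₂ B ht)

/-- The factorial bounds at the final time t dominate all earlier times, so the sum over sectors and
the time integral commute. -/
theorem hasSum_integral_sectorPairing (h₁ : ∀ k, 0 ≤ M.γ θ₁ k) (h₂ : ∀ k, 0 ≤ M.γ θ₂ k)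
    {B : ℝ → H →L[ℝ] H →L[ℝ] F} (hB : Continuous B) {t : ℝ} (ht : 0 ≤ t) :
    IntervalIntegrable (fun s => M.pairing θ₁ θ₂ (B s) s) volume 0 t ∧
    HasSum (fun n => ∫ s in (0 : ℝ)..t, M.sectorPairing θ₁ θ₂ (B s) n s)
      (∫ s in (0 : ℝ)..t, M.pairing θ₁ θ₂ (B s) s) := by
  obtain ⟨C, hC⟩ := IsCompact.exists_bound_of_continuousOn
    (E := H →L[ℝ] H →L[ℝ] F) (f := B) (isCompact_Icc (a := (0 : ℝ)) (b := t)) hB.continuousOn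
  set bound : ℕ → ℝ := fun n =>
    C * ((M.rateBound θ₁ * t) ^ n / n.factorial + (M.rateBound θ₂ * t) ^ n / n.factorial)
  have hsum : Summable bound :=
    ((Real.summable_pow_div_factorial _).add (Real.summable_pow_div_factorial _)).mul_left _
  have hmem : ∀ s ∈ uIoc 0 t, s ∈ Icc 0 t := fun s hs => by
    rw [uIoc_of_le ht] at hs; exact ⟨hs.1.le, hs.2⟩
  have hle : ∀ n, ∀ s ∈ uIoc 0 t, ‖M.sectorPairing θ₁ θ₂ (B s) n s‖ ≤ bound n := by
    intro n s hs
    have hs' := hmem s hs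
    refine (M.norm_sectorPairing_le (B s) n hs'.1).trans ?_
    have h1 := M.sectorNormSq_le_of_le h₁ n hs'.1 hs'.2
    have h2 := M.sectorNormSq_le_of_le h₂ n hs'.1 hs'.2
    exact mul_le_mul (hC s hs') (add_le_add h1 h2)
      (add_nonneg (M.sectorNormSq_nonneg _ _ _) (M.sectorNormSq_nonneg _ _ _))
      ((norm_nonneg _).trans (hC s hs'))
  have hmeas : ∀ n, AEStronglyMeasurable (fun s => M.sectorPairing θ₁ θ₂ (B s) n s)
      (volume.restrict (uIoc 0 t)) := fun n =>
    (intervalIntegrable_iff.1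
      (M.intervalIntegrable_sectorPairing θ₁ θ₂ hB n ht)).aestronglyMeasurable
  have hlim : ∀ s ∈ uIoc 0 t, HasSum (fun n => M.sectorPairing θ₁ θ₂ (B s) n s)
      (M.pairing θ₁ θ₂ (B s) s) := fun s hs =>
    M.hasSum_sectorPairing h₁ h₂ (B s) (hmem s hs).1
  constructor
  · rw [intervalIntegrable_iff]
    -- Measurability in time is inherited from the partial sums over sectors.
    have hm : AEStronglyMeasurable (fun s => M.pairing θ₁ θ₂ (B s) s)
        (volume.restrict (uIoc 0 t)) := by
      refine aestronglyMeasurable_of_tendsto_ae atTop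
        (f := fun N s => ∑ n ∈ Finset.range N, M.sectorPairing θ₁ θ₂ (B s) n s)
        (fun N => Finset.aestronglyMeasurable_fun_sum _ fun n _ => hmeas n) ?_
      filter_upwards [ae_restrict_mem measurableSet_uIoc] with s hs
      exact (hlim s hs).tendsto_sum_nat
    have : IsFiniteMeasure (volume.restrict (uIoc 0 t)) := by rw [uIoc_of_le ht]; infer_instance
    refine (integrable_const (∑' n, bound n)).mono' hm ?_
    · filter_upwards [ae_restrict_mem measurableSet_uIoc] with s hs
      rw [← (hlim s hs).tsum_eq]
      exact tsum_of_norm_bounded hsum.hasSum fun n => hle n s hs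
  · exact intervalIntegral.hasSum_integral_of_dominated_convergence (fun n _ => bound n) hmeas
      (fun n => ae_of_all _ (hle n)) (ae_of_all _ fun _ _ => hsum) intervalIntegrable_const
      (ae_of_all _ hlim)

variable [CompleteSpace F]

/-- The integrated evolution equation of a bilinear expression in two wave functions. -/
theorem pairing_eq (h₁ : ∀ k, 0 ≤ M.γ θ₁ k) (h₂ : ∀ k, 0 ≤ M.γ θ₂ k)
    (B : H →L[ℝ] H →L[ℝ] F) {t : ℝ} (ht : 0 ≤ t) :
    IntervalIntegrable (fun s => M.pairing θ₁ θ₂ (M.drift θ₁ θ₂ B s + M.jumpForm θ₁ θ₂ B) s)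
      volume 0 t ∧
    M.pairing θ₁ θ₂ B t = B M.ψ M.ψ +
      ∫ s in (0 : ℝ)..t, M.pairing θ₁ θ₂ (M.drift θ₁ θ₂ B s + M.jumpForm θ₁ θ₂ B) s := by
  obtain ⟨i1, s1⟩ := M.hasSum_integral_sectorPairing h₁ h₂ (M.continuous_drift θ₁ θ₂ B) ht
  obtain ⟨i2, s2⟩ := M.hasSum_integral_sectorPairing h₁ h₂
    (B := fun _ => M.jumpForm θ₁ θ₂ B) continuous_const ht
  have hadd : ∀ s ∈ uIcc 0 t,
      M.pairing θ₁ θ₂ (M.drift θ₁ θ₂ B s + M.jumpForm θ₁ θ₂ B) s =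
      M.pairing θ₁ θ₂ (M.drift θ₁ θ₂ B s) s + M.pairing θ₁ θ₂ (M.jumpForm θ₁ θ₂ B) s := by
    intro s hs
    rw [uIcc_of_le ht] at hs
    exact integral_add (M.integrable_pairing h₁ h₂ _ hs.1) (M.integrable_pairing h₁ h₂ _ hs.1)
  refine ⟨(intervalIntegrable_congr fun s hs => hadd s (uIoc_subset_uIcc hs)).2 (i1.add i2), ?_⟩
  rw [intervalIntegral.integral_congr hadd, intervalIntegral.integral_add i1 i2]
  -- The vacuum sector has no incoming jumps and is split off; in the shifted series, the drift of
  -- sector n + 1 is paired with the jumps out of sector n.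
  have s0 := (hasSum_nat_add_iff' 1).2 (M.hasSum_sectorPairing h₁ h₂ B ht)
  have s1' := (hasSum_nat_add_iff' 1).2 s1
  simp only [M.sectorPairing_succ_eq θ₁ θ₂ B _ ht] at s0
  have := s0.unique (s2.add s1')
  simp only [Finset.range_one, Finset.sum_singleton] at this
  rw [sub_eq_iff_eq_add, M.sectorPairing_zero_eq] at this
  rw [this]
  abel

/-- By the evolution equation this is a constant plus the primitive of an integrable function. -/
theorem continuousOn_pairing (h₁ : ∀ k, 0 ≤ M.γ θ₁ k) (h₂ : ∀ k, 0 ≤ M.γ θ₂ k)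
    (B : H →L[ℝ] H →L[ℝ] F) : ContinuousOn (M.pairing θ₁ θ₂ B) (Ici 0) := by
  have h : ∀ T : ℝ, 0 ≤ T → ContinuousOn (M.pairing θ₁ θ₂ B) (Icc 0 T) := by
    intro T hT
    have hc := intervalIntegral.continuousOn_primitive_interval'
      (M.pairing_eq h₁ h₂ B hT).1 left_mem_uIcc
    rw [uIcc_of_le hT] at hc
    exact (continuousOn_const.add hc).congr fun s hs => (M.pairing_eq h₁ h₂ B hs.1).2
  intro t ht
  refine (h (t + 1) (by linarith [mem_Ici.1 ht]) t ⟨ht, by linarith⟩).mono_of_mem_nhdsWithin ?_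
  rw [← Ici_inter_Iic]
  exact inter_mem self_mem_nhdsWithin (mem_nhdsWithin_of_mem_nhds (Iic_mem_nhds (by linarith)))

end Model

namespace Model

variable {H : Type*} [NormedAddCommGroup H] [InnerProductSpace ℂ H] [CompleteSpace H] {d R : ℕ}
variable (M : Model H d R) {θ θ₁ θ₂ : Fin d → ℝ}

/-! ### The joint vector -/

theorem purification_eq (h : ∀ k, 0 ≤ M.γ θ k) {t : ℝ} (ht : 0 ≤ t) :
    M.purification t θ = (M.memLp_waveFunction h ht).toLp _ :=
  dif_pos _

theorem coeFn_purification (h : ∀ k, 0 ≤ M.γ θ k) {t : ℝ} (ht : 0 ≤ t) :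
    M.purification t θ =ᵐ[fockMeasure R] M.waveFunction θ t := by
  rw [M.purification_eq h ht]
  exact MemLp.coeFn_toLp _

/-- The operator `A ⊗ 1` on the joint Hilbert space. -/
noncomputable def ampliate (R : ℕ) (A : H →L[ℂ] H) : Joint H R →L[ℂ] Joint H R :=
  A.compLpL 2 (fockMeasure R)

omit [CompleteSpace H] in
theorem norm_ampliate_apply_le (A : H →L[ℂ] H) (Φ : Joint H R) :
    ‖ampliate R A Φ‖ ≤ ‖A‖ * ‖Φ‖ :=
  ContinuousLinearMap.norm_compLp_le A Φ

omit [CompleteSpace H] in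
theorem inner_ampliate (A : H →L[ℂ] H) (Φ₁ Φ₂ : Joint H R) :
    inner ℂ Φ₁ (ampliate R A Φ₂) = ∫ σ, inner ℂ (Φ₁ σ) (A (Φ₂ σ)) ∂(fockMeasure R) := by
  rw [L2.inner_def]
  refine integral_congr_ae ?_
  filter_upwards [A.coeFn_compLpL Φ₂] with σ hσ
  rw [ampliate, hσ]

theorem inner_ampliate_ampliate (A : H →L[ℂ] H) (Φ₁ Φ₂ : Joint H R) :
    inner ℂ (ampliate R A Φ₁) (ampliate R A Φ₂) =
      inner ℂ Φ₁ (ampliate R (star A * A) Φ₂) := by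
  rw [inner_ampliate (star A * A), L2.inner_def]
  refine integral_congr_ae ?_
  filter_upwards [A.coeFn_compLpL Φ₁, A.coeFn_compLpL Φ₂] with σ h1 h2
  rw [ampliate, h1, h2, mul_apply_eq_comp, ContinuousLinearMap.star_eq_adjoint,
    ContinuousLinearMap.adjoint_inner_right]

theorem pairing_expectationForm (h₁ : ∀ k, 0 ≤ M.γ θ₁ k) (h₂ : ∀ k, 0 ≤ M.γ θ₂ k)
    (A : H →L[ℂ] H) {t : ℝ} (ht : 0 ≤ t) :
    M.pairing θ₁ θ₂ (expectationForm A) t =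
      inner ℂ (M.purification t θ₁) (ampliate R A (M.purification t θ₂)) := by
  rw [inner_ampliate]
  refine integral_congr_ae ?_
  filter_upwards [M.coeFn_purification h₁ ht, M.coeFn_purification h₂ ht] with σ e1 e2
  rw [e1, e2, expectationForm_apply]

/-! ### The reduced state -/

/-- Expanding Γ = VΛV† absorbs V into the jump operators. An arbitrary bilinear f lets the sandwich
and the anticommutator of the dissipator be diagonalized in one stroke. -/
theorem sum_Γ_smul {E : Type*} [AddCommGroup E] [Module ℂ E]
    (f : (H →L[ℂ] H) →ₗ[ℂ] (H →L[ℂ] H) →ₗ[ℂ] E) (θ : Fin d → ℝ) :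
    ∑ i, ∑ j, M.Γ θ i j • f (M.L i) (star (M.L j)) =
      ∑ k, (M.γ θ k : ℂ) • f (M.J θ k) (star (M.J θ k)) := by
  have hΓ : ∀ i j, M.Γ θ i j = ∑ k, M.V θ i k * (M.γ θ k : ℂ) * star (M.V θ j k) := by
    intro i j
    rw [Γ, Matrix.mul_apply]
    simp only [Matrix.mul_diagonal, Matrix.conjTranspose_apply]
  have hJ : ∀ k, (M.γ θ k : ℂ) • f (M.J θ k) (star (M.J θ k)) =
      ∑ i, ∑ j, (M.V θ i k * (M.γ θ k : ℂ) * star (M.V θ j k)) •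
        f (M.L i) (star (M.L j)) := by
    intro k
    simp only [J, star_sum, star_smul, map_sum, map_smul, LinearMap.sum_apply,
      LinearMap.smul_apply, Finset.smul_sum, smul_smul]
    rw [Finset.sum_comm]
    refine Finset.sum_congr rfl fun i _ => Finset.sum_congr rfl fun j _ => ?_
    congr 1
    ring
  simp only [hJ, hΓ, Finset.sum_smul]
  conv_rhs => rw [Finset.sum_comm]
  exact Finset.sum_congr rfl fun i _ => Finset.sum_comm

/-- In this jump form the generator has the same two pieces as the evolution of the wave function,
drift and jumps. -/
theorem lindbladian_eq (h : ∀ k, 0 ≤ M.γ θ k) (t : ℝ) (X : H →L[ℂ] H) :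
    M.lindbladian θ t X = M.noJumpOp θ t * X + X * star (M.noJumpOp θ t) +
      ∑ k, M.jumpOp θ k * X * star (M.jumpOp θ k) := by
  let f : (H →L[ℂ] H) →ₗ[ℂ] (H →L[ℂ] H) →ₗ[ℂ] (H →L[ℂ] H) :=
    LinearMap.mk₂ ℂ (fun a b => a * X * b - (1 / 2 : ℂ) • (b * a * X + X * (b * a)))
      (fun _ _ _ => by simp only [add_mul, mul_add, smul_add]; abel)
      (fun c _ _ => by
        simp only [smul_mul_assoc, mul_smul_comm, smul_add, smul_sub, smul_comm c])
      (fun _ _ _ => by simp only [add_mul, mul_add, smul_add]; abel)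
      (fun c _ _ => by
        simp only [smul_mul_assoc, mul_smul_comm, smul_add, smul_sub, smul_comm c])
  have hf := M.sum_Γ_smul f θ
  simp only [f, LinearMap.mk₂_apply] at hf
  have hjump : ∀ k, M.jumpOp θ k * X * star (M.jumpOp θ k) =
      (M.γ θ k : ℂ) • (M.J θ k * X * star (M.J θ k)) := by
    intro k
    rw [jumpOp, star_smul, smul_mul_assoc, smul_mul_assoc, mul_smul_comm, smul_smul]
    congr 1
    rw [star_mul', star_neg]
    simp only [Complex.star_def, Complex.conj_I, Complex.conj_ofReal, neg_neg]
    have : ((Real.sqrt (M.γ θ k) : ℝ) : ℂ) * (Real.sqrt (M.γ θ k) : ℝ) = (M.γ θ k : ℂ) := by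
      rw [← Complex.ofReal_mul, Real.mul_self_sqrt (h k)]
    linear_combination (-Complex.I * Complex.I) * this - (M.γ θ k : ℂ) * Complex.I_mul_I
  have hself : star (M.Hc t) = M.Hc t := M.Hc_selfAdjoint t
  rw [lindbladian, hf]
  simp only [hjump]
  simp only [noJumpOp, star_sub, star_neg, star_smul, star_sum, star_mul, star_star, hself,
    sub_mul, mul_sub, neg_mul, mul_neg, smul_mul_assoc, mul_smul_comm, Finset.sum_mul,
    Finset.mul_sum, smul_sub, smul_add, Finset.sum_sub_distrib, Finset.sum_add_distrib,
    Finset.smul_sum, Complex.star_def, Complex.conj_I, Complex.conj_ofReal, map_div₀, map_one,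
    map_ofNat]
  simp only [smul_comm (_ : ℂ) (1 / 2 : ℂ), neg_smul]
  abel

/-- The Lindblad generator as a bounded operator. -/
noncomputable def lindbladOp (θ : Fin d → ℝ) (t : ℝ) : (H →L[ℂ] H) →L[ℝ] (H →L[ℂ] H) :=
  ContinuousLinearMap.mul ℝ (H →L[ℂ] H) (M.noJumpOp θ t) +
    (ContinuousLinearMap.mul ℝ (H →L[ℂ] H)).flip (star (M.noJumpOp θ t)) +
    ∑ k, (ContinuousLinearMap.mul ℝ (H →L[ℂ] H) (M.jumpOp θ k)).comp
      ((ContinuousLinearMap.mul ℝ (H →L[ℂ] H)).flip (star (M.jumpOp θ k)))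

theorem lindbladOp_apply (θ : Fin d → ℝ) (t : ℝ) (X : H →L[ℂ] H) :
    M.lindbladOp θ t X = M.noJumpOp θ t * X + X * star (M.noJumpOp θ t) +
      ∑ k, M.jumpOp θ k * X * star (M.jumpOp θ k) := by
  simp [lindbladOp, sum_apply, mul_assoc]

theorem continuous_lindbladOp (θ : Fin d → ℝ) : Continuous (M.lindbladOp θ) := by
  unfold lindbladOp
  have h := M.continuous_noJumpOp θ
  exact (((ContinuousLinearMap.mul ℝ (H →L[ℂ] H)).continuous.comp h).add
    ((ContinuousLinearMap.mul ℝ (H →L[ℂ] H)).flip.continuous.comp h.star)).add continuous_const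

/-- The state `ρ(θ;t)` is the partial trace of the projection on the joint vector. -/
theorem ρ_eq_pairing (h : ∀ k, 0 ≤ M.γ θ k) {t : ℝ} (ht : 0 ≤ t) :
    M.ρ θ t = M.pairing θ θ rankOneForm t := by
  have hfun : M.lindbladian θ = fun t X => M.lindbladOp θ t X := by
    funext t X
    rw [lindbladOp_apply, M.lindbladian_eq h]
  rw [ρ, hfun]
  refine (eq_timeOrderedExp_of_integral_eq (M.continuous_lindbladOp θ)
    (M.continuousOn_pairing h h rankOneForm) (fun t ht => ?_) ht).symm
  rw [(M.pairing_eq h h rankOneForm ht).2]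
  congr 1
  refine intervalIntegral.integral_congr fun s hs => ?_
  rw [uIcc_of_le ht] at hs
  simp only [pairing]
  -- The generator moves inside the integral over configurations, where on |u⟩⟨u| it agrees
  -- pointwise with drift plus jumps.
  rw [← ContinuousLinearMap.integral_comp_comm _ (M.integrable_pairing h h rankOneForm hs.1)]
  refine integral_congr_ae (Eventually.of_forall fun σ => ?_)
  simp only [add_apply, drift_apply, jumpForm_apply, lindbladOp_apply, rankOneForm_apply,
    ContinuousLinearMap.mul_def, InnerProductSpace.comp_rankOne, InnerProductSpace.rankOne_comp,
    ContinuousLinearMap.star_eq_adjoint, ContinuousLinearMap.adjoint_adjoint]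

theorem inner_mul_pairing_rankOneForm (h : ∀ k, 0 ≤ M.γ θ k) {t : ℝ} (ht : 0 ≤ t)
    (A : H →L[ℂ] H) (x : H) :
    inner ℂ x ((A * M.pairing θ θ rankOneForm t) x) =
      ∫ σ, inner ℂ (M.waveFunction θ t σ) x * inner ℂ x (A (M.waveFunction θ t σ))
        ∂(fockMeasure R) := by
  let T : (H →L[ℂ] H) →L[ℂ] ℂ :=
    ((innerSL ℂ x).comp A).comp (ContinuousLinearMap.apply ℂ H x)
  have hT : ∀ X, T X = inner ℂ x ((A * X) x) := fun X => rfl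
  rw [← hT, pairing, ← ContinuousLinearMap.integral_comp_comm _
    (M.integrable_pairing h h rankOneForm ht)]
  refine integral_congr_ae (Eventually.of_forall fun σ => ?_)
  simp only [hT, rankOneForm_apply, mul_apply_eq_comp, InnerProductSpace.rankOne_apply, map_smul,
    inner_smul_right]

variable {ι : Type*} [Countable ι] (b : HilbertBasis ι ℂ H)

omit [CompleteSpace H] [Countable ι] in
theorem _root_.HilbertBasis.hasSum_norm_inner_sq (x : H) :
    HasSum (fun i => ‖inner ℂ (b i) x‖ ^ 2) (‖x‖ ^ 2) := by
  have h := Complex.hasSum_re (b.hasSum_inner_mul_inner x x)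
  rw [inner_self_eq_norm_sq_to_K] at h
  have e : (((‖x‖ : ℂ)) ^ 2).re = ‖x‖ ^ 2 := by norm_cast
  have e' : ∀ i, (inner ℂ x (b i) * inner ℂ (b i) x).re = ‖inner ℂ (b i) x‖ ^ 2 := fun i => by
    rw [← inner_conj_symm x (b i), Complex.conj_mul']
    norm_cast
  simpa only [e, e', Complex.coe_algebraMap] using! h

/-- Pointwise in the configuration the trace is Parseval's identity for w and Aw. Exchanging the
basis sum with the integral is justified by the dominating series |⟨b_i, w⟩|² + |⟨b_i, Aw⟩|², whose
sum ‖w‖² + ‖Aw‖² is integrable. -/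
theorem purifies (h : ∀ k, 0 ≤ M.γ θ k) {t : ℝ} (ht : 0 ≤ t) :
    Purifies b (M.purification t θ) (M.ρ θ t) := by
  intro A
  rw [M.ρ_eq_pairing h ht]
  simp only [M.inner_mul_pairing_rankOneForm h ht]
  set w := M.waveFunction θ t
  have hw := M.memLp_waveFunction h ht
  have hint : ∫ σ, inner ℂ (M.purification t θ σ) (A (M.purification t θ σ)) ∂(fockMeasure R) =
      ∫ σ, inner ℂ (w σ) (A (w σ)) ∂(fockMeasure R) := by
    refine integral_congr_ae ?_
    filter_upwards [M.coeFn_purification h ht] with σ e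
    rw [e]
  rw [hint]
  have hAw : MemLp (fun σ => A (w σ)) 2 (fockMeasure R) := A.comp_memLp' hw
  have hsum : ∀ σ, HasSum (fun i => ‖inner ℂ (b i) (w σ)‖ ^ 2 + ‖inner ℂ (b i) (A (w σ))‖ ^ 2)
      (‖w σ‖ ^ 2 + ‖A (w σ)‖ ^ 2) := fun σ =>
    (b.hasSum_norm_inner_sq _).add (b.hasSum_norm_inner_sq _)
  refine hasSum_integral_of_dominated_convergence
    (fun i σ => ‖inner ℂ (b i) (w σ)‖ ^ 2 + ‖inner ℂ (b i) (A (w σ))‖ ^ 2) (fun i => ?_)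
    (fun i => Eventually.of_forall fun σ => ?_)
    (Eventually.of_forall fun σ => (hsum σ).summable) ?_
    (Eventually.of_forall fun σ => b.hasSum_inner_mul_inner _ _)
  · exact (hw.1.inner aestronglyMeasurable_const).mul (aestronglyMeasurable_const.inner hAw.1)
  · rw [norm_mul, norm_inner_symm]
    nlinarith [sq_nonneg (‖inner ℂ (b i) (w σ)‖ - ‖inner ℂ (b i) (A (w σ))‖),
      sq_nonneg ‖inner ℂ (b i) (w σ)‖, sq_nonneg ‖inner ℂ (b i) (A (w σ))‖]
  · simp only [fun σ => (hsum σ).tsum_eq]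
    exact ((memLp_two_iff_integrable_sq_norm hw.1).1 hw).add
      ((memLp_two_iff_integrable_sq_norm hAw.1).1 hAw)

theorem opTrace_mul_ρ (h : ∀ k, 0 ≤ M.γ θ k) {t : ℝ} (ht : 0 ≤ t) (A : H →L[ℂ] H) :
    opTrace b (A * M.ρ θ t) =
      inner ℂ (M.purification t θ) (ampliate R A (M.purification t θ)) := by
  rw [inner_ampliate]
  exact (M.purifies b h ht A).tsum_eq

/-! ### The overlap of the joint vectors of two parameters -/

theorem continuousOn_inner_ampliate (h₁ : ∀ k, 0 ≤ M.γ θ₁ k) (h₂ : ∀ k, 0 ≤ M.γ θ₂ k)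
    (A : H →L[ℂ] H) :
    ContinuousOn (fun s => inner ℂ (M.purification s θ₁) (ampliate R A (M.purification s θ₂)))
      (Ici 0) :=
  (M.continuousOn_pairing h₁ h₂ (expectationForm A)).congr fun _ hs =>
    (M.pairing_expectationForm h₁ h₂ A hs).symm

theorem continuousOn_inner_ampliate_J (h₁ : ∀ k, 0 ≤ M.γ θ₁ k) (h₂ : ∀ k, 0 ≤ M.γ θ₂ k)
    (A : H →L[ℂ] H) :
    ContinuousOn (fun s => inner ℂ (ampliate R A (M.purification s θ₁))
      (ampliate R A (M.purification s θ₂))) (Ici 0) := by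
  simp only [inner_ampliate_ampliate]
  exact M.continuousOn_inner_ampliate h₁ h₂ _

/-- The evolution equation is applied to the inner product. With common J_k, drift and jumps combine
channel by channel into the negative perfect square -½(√γ_k(θ₁) - √γ_k(θ₂))². -/
theorem inner_purification (h₁ : ∀ k, 0 ≤ M.γ θ₁ k) (h₂ : ∀ k, 0 ≤ M.γ θ₂ k)
    (hJ : M.J θ₁ = M.J θ₂) {t : ℝ} (ht : 0 ≤ t) :
    inner ℂ (M.purification t θ₁) (M.purification t θ₂) =
      1 - (1 / 2 : ℂ) * ∑ k, (((Real.sqrt (M.γ θ₁ k) - Real.sqrt (M.γ θ₂ k)) ^ 2 : ℝ) : ℂ) *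
        ∫ s in (0 : ℝ)..t, inner ℂ (ampliate R (M.J θ₁ k) (M.purification s θ₁))
          (ampliate R (M.J θ₁ k) (M.purification s θ₂)) := by
  have h1 : inner ℂ (M.purification t θ₁) (M.purification t θ₂) =
      M.pairing θ₁ θ₂ (expectationForm 1) t := by
    rw [M.pairing_expectationForm h₁ h₂ 1 ht, inner_ampliate, L2.inner_def]
    rfl
  rw [h1, (M.pairing_eq h₁ h₂ _ ht).2]
  have hψ : expectationForm (1 : H →L[ℂ] H) M.ψ M.ψ = 1 := by
    rw [expectationForm_apply, one_apply_eq_self, inner_self_eq_norm_sq_to_K, M.ψ_norm]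
    simp
  set c : Fin R → ℂ := fun k =>
    -(1 / 2 : ℂ) * (((Real.sqrt (M.γ θ₁ k) - Real.sqrt (M.γ θ₂ k)) ^ 2 : ℝ) : ℂ) with hc
  have hint : ∀ s ∈ uIcc 0 t, M.pairing θ₁ θ₂ (M.drift θ₁ θ₂ (expectationForm 1) s +
        M.jumpForm θ₁ θ₂ (expectationForm 1)) s =
      ∑ k, c k * inner ℂ (ampliate R (M.J θ₁ k) (M.purification s θ₁))
          (ampliate R (M.J θ₁ k) (M.purification s θ₂)) := by
    intro s hs
    rw [uIcc_of_le ht] at hs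
    simp only [inner_ampliate_ampliate, ← M.pairing_expectationForm h₁ h₂ _ hs.1, pairing]
    simp only [← integral_const_mul]
    rw [← integral_finsetSum _ fun k _ => (M.integrable_pairing h₁ h₂ _ hs.1).const_mul _]
    refine integral_congr_ae (Eventually.of_forall fun σ => ?_)
    simp only [add_apply, drift_apply, jumpForm_apply, expectationForm_apply, one_apply_eq_self,
      M.inner_noJumpOp_add h₁ h₂ hJ, M.inner_jumpOp hJ, Finset.mul_sum, ← Finset.sum_add_distrib]
    refine Finset.sum_congr rfl fun k _ => ?_
    rw [mul_apply_eq_comp, ContinuousLinearMap.star_eq_adjoint,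
      ContinuousLinearMap.adjoint_inner_right, hc]
    push_cast
    ring
  rw [hψ, intervalIntegral.integral_congr hint, intervalIntegral.integral_finsetSum]
  · simp only [intervalIntegral.integral_const_mul, hc, Finset.mul_sum, sub_eq_add_neg,
      ← Finset.sum_neg_distrib]
    congr 1
    refine Finset.sum_congr rfl fun k _ => ?_
    ring
  · intro k _
    refine ((M.continuousOn_inner_ampliate_J h₁ h₂ (M.J θ₁ k)).mono ?_).intervalIntegrable.const_mul _
    rw [uIcc_of_le ht]
    exact Icc_subset_Ici_self

/-- All squares in the overlap formula vanish for equal parameters. -/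
theorem norm_purification (h : ∀ k, 0 ≤ M.γ θ k) {t : ℝ} (ht : 0 ≤ t) :
    ‖M.purification t θ‖ = 1 := by
  have := M.inner_purification h h rfl ht
  have h2 : ‖M.purification t θ‖ ^ 2 = 1 := by
    rw [← inner_self_eq_norm_sq (𝕜 := ℂ), this]
    simp
  nlinarith [norm_nonneg (M.purification t θ)]

end Model

/-! ### Difference quotients in Hilbert spaces -/

section Slopes

variable {K : Type*} [NormedAddCommGroup K] [InnerProductSpace ℂ K]

/-- A curve in a Hilbert space is differentiable if the inner products of its difference quotients
converge. -/
theorem exists_hasDerivAt_of_tendsto_inner_slope [NormedSpace ℝ K] [CompleteSpace K] {f : ℝ → K}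
    {c : ℂ} (h : Tendsto (fun p : ℝ × ℝ => inner ℂ (slope f 0 p.1) (slope f 0 p.2))
      (𝓝[≠] 0 ×ˢ 𝓝[≠] 0) (𝓝 c)) : ∃ f', HasDerivAt f f' 0 := by
  suffices hcauchy : Cauchy (map (slope f 0) (𝓝[≠] (0 : ℝ))) by
    obtain ⟨f', hf'⟩ := CompleteSpace.complete hcauchy
    exact ⟨f', hasDerivAt_iff_tendsto_slope.2 hf'⟩
  generalize slope f 0 = q at h ⊢
  have hdiag : Tendsto (fun x : ℝ => inner ℂ (q x) (q x)) (𝓝[≠] 0) (𝓝 c) :=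
    Tendsto.comp (f := fun x : ℝ => (x, x)) h (tendsto_id.prodMk tendsto_id)
  have hswap : Tendsto (fun p : ℝ × ℝ => inner ℂ (q p.2) (q p.1))
      (𝓝[≠] 0 ×ˢ 𝓝[≠] 0) (𝓝 c) := Tendsto.comp (f := Prod.swap) h (tendsto_snd.prodMk tendsto_fst)
  -- Expanding the square gives four inner products with the same limit c, which cancel; so the
  -- difference quotients are Cauchy.
  have hsq : Tendsto (fun p : ℝ × ℝ => ‖q p.1 - q p.2‖ ^ 2)
      (𝓝[≠] 0 ×ˢ 𝓝[≠] 0) (𝓝 0) := by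
    have h1 := (((hdiag.comp tendsto_fst).sub h).sub hswap).add (hdiag.comp tendsto_snd)
    have h2 := (Complex.continuous_re.tendsto _).comp h1
    have h3 : (c - c - c + c).re = 0 := by simp
    rw [h3] at h2
    refine h2.congr fun p => ?_
    rw [← inner_self_eq_norm_sq (𝕜 := ℂ)]
    simp only [inner_sub_left, inner_sub_right, Function.comp]
    simp only [RCLike.re_to_complex, Complex.add_re, Complex.sub_re]
    ring
  refine cauchy_map_iff.2 ⟨inferInstance, ?_⟩
  rw [tendsto_uniformity_iff_dist_tendsto_zero]
  have := (Real.continuous_sqrt.tendsto _).comp hsq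
  rw [Real.sqrt_zero] at this
  refine this.congr fun p => ?_
  simp only [Function.comp, dist_eq_norm]
  exact Real.sqrt_sq (norm_nonneg _)

/-- The mixed second difference of a function `1 - ½ ∑ⱼ (aⱼ(h) - bⱼ(k))² Nⱼ(h, k)`. -/
theorem tendsto_mixed_difference {R : ℕ} {a b : Fin R → ℝ → ℝ} {a' b' : Fin R → ℝ}
    {N : Fin R → ℝ → ℝ → ℂ} {G : ℝ → ℝ → ℂ} {C : ℝ} {U W : Set ℝ}
    (hU : U ∈ 𝓝 (0 : ℝ)) (hW : W ∈ 𝓝 (0 : ℝ))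
    (ha0 : ∀ j, a j 0 = 0) (hb0 : ∀ j, b j 0 = 0)
    (ha : ∀ j, HasDerivAt (a j) (a' j) 0) (hb : ∀ j, HasDerivAt (b j) (b' j) 0)
    (hG : ∀ h ∈ U, ∀ k ∈ W,
      G h k = 1 - (1 / 2 : ℂ) * ∑ j, (((a j h - b j k) ^ 2 : ℝ) : ℂ) * N j h k)
    (hN₁ : ∀ j, ∀ h ∈ U, ∀ k ∈ W, ‖N j h k - N j 0 k‖ ≤ C * ∑ i, |a i h|)
    (hN₂ : ∀ j, ∀ h ∈ U, ∀ k ∈ W, ‖N j h k - N j h 0‖ ≤ C * ∑ i, |b i k|) :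
    Tendsto (fun p : ℝ × ℝ => (p.1 : ℂ)⁻¹ * (p.2 : ℂ)⁻¹ *
        (G p.1 p.2 - G p.1 0 - G 0 p.2 + G 0 0))
      (𝓝[≠] 0 ×ˢ 𝓝[≠] 0) (𝓝 (∑ j, (a' j : ℂ) * (b' j : ℂ) * N j 0 0)) := by
  set l : Filter (ℝ × ℝ) := 𝓝[≠] 0 ×ˢ 𝓝[≠] 0
  have h0U := mem_of_mem_nhds hU
  have h0W := mem_of_mem_nhds hW
  have hslope : ∀ {u : ℝ → ℝ} {u' : ℝ}, u 0 = 0 → HasDerivAt u u' 0 →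
      Tendsto (fun h => u h / h) (𝓝[≠] 0) (𝓝 u') := fun {u u'} h0 hu => by
    have := hasDerivAt_iff_tendsto_slope.1 hu
    refine this.congr fun h => ?_
    rw [slope_def_field, h0, sub_zero, sub_zero]
  have hzero : ∀ {u : ℝ → ℝ} {u' : ℝ}, u 0 = 0 → HasDerivAt u u' 0 →
      Tendsto u (𝓝[≠] 0) (𝓝 0) := fun {u u'} h0 hu => by
    have := hu.continuousAt.tendsto
    rw [h0] at this
    exact this.mono_left nhdsWithin_le_nhds
  have f1 : Tendsto (Prod.fst : ℝ × ℝ → ℝ) l (𝓝[≠] 0) := tendsto_fst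
  have f2 : Tendsto (Prod.snd : ℝ × ℝ → ℝ) l (𝓝[≠] 0) := tendsto_snd
  have hmem : ∀ᶠ p in l, p.1 ∈ U ∧ p.2 ∈ W ∧ p.1 ≠ 0 ∧ p.2 ≠ 0 := by
    filter_upwards [f1.eventually (mem_nhdsWithin_of_mem_nhds hU),
      f2.eventually (mem_nhdsWithin_of_mem_nhds hW),
      f1.eventually self_mem_nhdsWithin, f2.eventually self_mem_nhdsWithin] with p h1 h2 h3 h4
    exact ⟨h1, h2, h3, h4⟩
  have sa := fun j => (hslope (ha0 j) (ha j)).comp f1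
  have sb := fun j => (hslope (hb0 j) (hb j)).comp f2
  have za := fun j => (hzero (ha0 j) (ha j)).comp f1
  have zb := fun j => (hzero (hb0 j) (hb j)).comp f2
  have hNlim : ∀ j, Tendsto (fun p : ℝ × ℝ => N j p.1 p.2) l (𝓝 (N j 0 0)) := by
    intro j
    rw [tendsto_iff_norm_sub_tendsto_zero]
    have hlim : Tendsto (fun p : ℝ × ℝ => C * ∑ i, |a i p.1| + C * ∑ i, |b i p.2|) l (𝓝 0) := by
      have := ((tendsto_finsetSum Finset.univ fun i _ => (za i).abs).const_mul C).add
        ((tendsto_finsetSum Finset.univ fun i _ => (zb i).abs).const_mul C)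
      simpa using this
    refine squeeze_zero' (Eventually.of_forall fun _ => norm_nonneg _) ?_ hlim
    filter_upwards [hmem] with p hp
    calc ‖N j p.1 p.2 - N j 0 0‖ = ‖(N j p.1 p.2 - N j 0 p.2) + (N j 0 p.2 - N j 0 0)‖ := by
          congr 1; ring
      _ ≤ _ := (norm_add_le _ _).trans (add_le_add (hN₁ j _ hp.1 _ hp.2.1)
        (hN₂ j _ h0U _ hp.2.1))
  -- Here a²/h = (a/h)·a tends to 0, while the increment of N divided by k stays bounded by the
  -- Lipschitz estimate. No derivative of N is needed.
  have hA : ∀ j, Tendsto (fun p : ℝ × ℝ => ((a j p.1 / p.1 : ℝ) : ℂ) * (a j p.1 : ℂ) *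
      ((p.2 : ℂ)⁻¹ * (N j p.1 p.2 - N j p.1 0))) l (𝓝 0) := by
    intro j
    have hlim : Tendsto (fun p : ℝ × ℝ => |a j p.1 / p.1| * |a j p.1| *
        (C * ∑ i, |b i p.2 / p.2|)) l (𝓝 0) := by
      have := ((sa j).abs.mul (za j).abs).mul
        ((tendsto_finsetSum Finset.univ fun i _ => (sb i).abs).const_mul C)
      simpa using this
    refine squeeze_zero_norm' ?_ hlim
    filter_upwards [hmem] with p hp
    rw [norm_mul, norm_mul, norm_mul, norm_inv, Complex.norm_real, Complex.norm_real,
      Complex.norm_real, Real.norm_eq_abs, Real.norm_eq_abs, Real.norm_eq_abs]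
    refine mul_le_mul_of_nonneg_left ?_ (by positivity)
    rw [inv_mul_le_iff₀ (abs_pos.2 hp.2.2.2)]
    refine (hN₂ j _ hp.1 _ hp.2.1).trans_eq ?_
    simp only [Finset.mul_sum, abs_div]
    refine Finset.sum_congr rfl fun i _ => ?_
    have := abs_pos.2 hp.2.2.2
    field_simp
  have hB : ∀ j, Tendsto (fun p : ℝ × ℝ => ((b j p.2 / p.2 : ℝ) : ℂ) * (b j p.2 : ℂ) *
      ((p.1 : ℂ)⁻¹ * (N j p.1 p.2 - N j 0 p.2))) l (𝓝 0) := by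
    intro j
    have hlim : Tendsto (fun p : ℝ × ℝ => |b j p.2 / p.2| * |b j p.2| *
        (C * ∑ i, |a i p.1 / p.1|)) l (𝓝 0) := by
      have := ((sb j).abs.mul (zb j).abs).mul
        ((tendsto_finsetSum Finset.univ fun i _ => (sa i).abs).const_mul C)
      simpa using this
    refine squeeze_zero_norm' ?_ hlim
    filter_upwards [hmem] with p hp
    rw [norm_mul, norm_mul, norm_mul, norm_inv, Complex.norm_real, Complex.norm_real,
      Complex.norm_real, Real.norm_eq_abs, Real.norm_eq_abs, Real.norm_eq_abs]
    refine mul_le_mul_of_nonneg_left ?_ (by positivity)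
    rw [inv_mul_le_iff₀ (abs_pos.2 hp.2.2.1)]
    refine (hN₁ j _ hp.1 _ hp.2.1).trans_eq ?_
    simp only [Finset.mul_sum, abs_div]
    refine Finset.sum_congr rfl fun i _ => ?_
    have := abs_pos.2 hp.2.2.1
    field_simp
  have hM : ∀ j, Tendsto (fun p : ℝ × ℝ => ((a j p.1 / p.1 : ℝ) : ℂ) *
      ((b j p.2 / p.2 : ℝ) : ℂ) * N j p.1 p.2) l (𝓝 ((a' j : ℂ) * (b' j : ℂ) * N j 0 0)) :=
    fun j => (((Complex.continuous_ofReal.tendsto _).comp (sa j)).mul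
      ((Complex.continuous_ofReal.tendsto _).comp (sb j))).mul (hNlim j)
  have htot := tendsto_finsetSum Finset.univ fun j (_ : j ∈ Finset.univ) =>
    ((hM j).sub ((hA j).const_mul (1 / 2 : ℂ))).sub ((hB j).const_mul (1 / 2 : ℂ))
  simp only [mul_zero, sub_zero] at htot
  refine htot.congr' ?_
  filter_upwards [hmem] with p hp
  obtain ⟨hp1, hp2, hp3, hp4⟩ := hp
  have e1 : (p.1 : ℂ) ≠ 0 := Complex.ofReal_ne_zero.2 hp3
  have e2 : (p.2 : ℂ) ≠ 0 := Complex.ofReal_ne_zero.2 hp4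
  rw [hG _ hp1 _ hp2, hG _ hp1 _ h0W, hG _ h0U _ hp2, hG _ h0U _ h0W]
  -- After the constants cancel, each channel contributes ab N(h,k) - ½a²(N(h,k) - N(h,0)) -
  -- ½b²(N(h,k) - N(0,k)); only the first term survives division by hk.
  have hre : ∀ S₁ S₂ S₃ S₄ : ℂ, (1 - (1 / 2 : ℂ) * S₁) - (1 - (1 / 2 : ℂ) * S₂) -
      (1 - (1 / 2 : ℂ) * S₃) + (1 - (1 / 2 : ℂ) * S₄) =
      -(1 / 2 : ℂ) * (S₁ - S₂ - S₃ + S₄) := fun _ _ _ _ => by ring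
  rw [hre, ← Finset.sum_sub_distrib, ← Finset.sum_sub_distrib, ← Finset.sum_add_distrib,
    Finset.mul_sum, Finset.mul_sum]
  refine Finset.sum_congr rfl fun j _ => ?_
  rw [ha0, hb0]
  push_cast
  field_simp
  ring

end Slopes

/-! ### Lipschitz dependence on the jump amplitudes -/

namespace Model

variable {H : Type*} [NormedAddCommGroup H] [InnerProductSpace ℂ H] [CompleteSpace H] {d R : ℕ}
variable (M : Model H d R) {θ θ₁ θ₂ θ₃ : Fin d → ℝ}

omit [CompleteSpace H] in
theorem joint_real_smul (c : ℝ) (Φ : Joint H R) : c • Φ = (c : ℂ) • Φ := rfl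

/-- The time integral of the correlations of the emissions into channel `k`. -/
noncomputable def emissionCorr (A : H →L[ℂ] H) (t : ℝ) (θ₁ θ₂ : Fin d → ℝ) : ℂ :=
  ∫ s in (0 : ℝ)..t, inner ℂ (ampliate R A (M.purification s θ₁))
    (ampliate R A (M.purification s θ₂))

theorem norm_inner_ampliate_le (h₁ : ∀ k, 0 ≤ M.γ θ₁ k) (A : H →L[ℂ] H) {s : ℝ} (hs : 0 ≤ s)
    (Φ : Joint H R) :
    ‖inner ℂ (ampliate R A (M.purification s θ₁)) (ampliate R A Φ)‖ ≤ ‖A‖ ^ 2 * ‖Φ‖ := by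
  refine (norm_inner_le_norm _ _).trans ?_
  have h1 := norm_ampliate_apply_le A (M.purification s θ₁)
  rw [M.norm_purification h₁ hs, mul_one] at h1
  calc _ ≤ ‖A‖ * (‖A‖ * ‖Φ‖) :=
        mul_le_mul h1 (norm_ampliate_apply_le A Φ) (norm_nonneg _) (norm_nonneg _)
    _ = _ := by ring

theorem norm_emissionCorr_le (h₁ : ∀ k, 0 ≤ M.γ θ₁ k) (h₂ : ∀ k, 0 ≤ M.γ θ₂ k)
    (A : H →L[ℂ] H) {t : ℝ} (ht : 0 ≤ t) :
    ‖M.emissionCorr A t θ₁ θ₂‖ ≤ ‖A‖ ^ 2 * t := by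
  have := intervalIntegral.norm_integral_le_of_norm_le_const (a := 0) (b := t)
    (f := fun s => inner ℂ (ampliate R A (M.purification s θ₁))
      (ampliate R A (M.purification s θ₂))) (C := ‖A‖ ^ 2) (fun s hs => by
      rw [uIoc_of_le ht] at hs
      have := M.norm_inner_ampliate_le h₁ A hs.1.le (M.purification s θ₂)
      rwa [M.norm_purification h₂ hs.1.le, mul_one] at this)
  rwa [sub_zero, abs_of_nonneg ht] at this

/-- The joint vector is Lipschitz in the jump amplitudes. -/
theorem norm_purification_sub_le (h₁ : ∀ k, 0 ≤ M.γ θ₁ k) (h₂ : ∀ k, 0 ≤ M.γ θ₂ k)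
    (hJ : M.J θ₁ = M.J θ₂) {t : ℝ} (ht : 0 ≤ t) :
    ‖M.purification t θ₁ - M.purification t θ₂‖ ≤
      Real.sqrt (t * ∑ k, ‖M.J θ₁ k‖ ^ 2) *
        ∑ k, |Real.sqrt (M.γ θ₁ k) - Real.sqrt (M.γ θ₂ k)| := by
  set S := ∑ k, |Real.sqrt (M.γ θ₁ k) - Real.sqrt (M.γ θ₂ k)|
  have hS : 0 ≤ S := Finset.sum_nonneg fun _ _ => abs_nonneg _
  have hsq : ‖M.purification t θ₁ - M.purification t θ₂‖ ^ 2 ≤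
      t * (∑ k, ‖M.J θ₁ k‖ ^ 2) * S ^ 2 := by
    rw [@norm_sub_sq ℂ, M.norm_purification h₁ ht, M.norm_purification h₂ ht,
      M.inner_purification h₁ h₂ hJ ht]
    -- For unit vectors the squared distance is 2 - 2 Re⟨Ψ₁, Ψ₂⟩, and the overlap formula leaves
    -- only the quadratic term.
    have e : (1 : ℝ) ^ 2 - 2 * RCLike.re (1 - (1 / 2 : ℂ) *
        ∑ k, (((Real.sqrt (M.γ θ₁ k) - Real.sqrt (M.γ θ₂ k)) ^ 2 : ℝ) : ℂ) *
        M.emissionCorr (M.J θ₁ k) t θ₁ θ₂) + 1 ^ 2 =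
        ∑ k, (Real.sqrt (M.γ θ₁ k) - Real.sqrt (M.γ θ₂ k)) ^ 2 *
          (M.emissionCorr (M.J θ₁ k) t θ₁ θ₂).re := by
      have h2 : (1 / 2 : ℂ) = ((1 / 2 : ℝ) : ℂ) := by norm_num
      rw [h2, RCLike.re_to_complex, Complex.sub_re, Complex.re_ofReal_mul, Complex.re_sum]
      simp only [Complex.re_ofReal_mul, Complex.one_re]
      ring
    refine e.trans_le ?_
    rw [mul_comm t, Finset.sum_mul, Finset.sum_mul]
    refine Finset.sum_le_sum fun k _ => ?_
    have hk : (Real.sqrt (M.γ θ₁ k) - Real.sqrt (M.γ θ₂ k)) ^ 2 ≤ S ^ 2 := by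
      rw [← sq_abs]
      exact pow_le_pow_left₀ (abs_nonneg _) (Finset.single_le_sum
        (f := fun k => |Real.sqrt (M.γ θ₁ k) - Real.sqrt (M.γ θ₂ k)|)
        (fun _ _ => abs_nonneg _) (Finset.mem_univ k)) 2
    have hN := (Complex.re_le_norm _).trans (M.norm_emissionCorr_le h₁ h₂ (M.J θ₁ k) ht)
    calc _ ≤ (Real.sqrt (M.γ θ₁ k) - Real.sqrt (M.γ θ₂ k)) ^ 2 * (‖M.J θ₁ k‖ ^ 2 * t) :=
          mul_le_mul_of_nonneg_left hN (sq_nonneg _)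
      _ ≤ S ^ 2 * (‖M.J θ₁ k‖ ^ 2 * t) := mul_le_mul_of_nonneg_right hk (by positivity)
      _ = _ := by ring
  have h0 : 0 ≤ t * ∑ k, ‖M.J θ₁ k‖ ^ 2 :=
    mul_nonneg ht (Finset.sum_nonneg fun _ _ => by positivity)
  refine abs_le_of_sq_le_sq' ?_ (by positivity) |>.2
  rwa [mul_pow, Real.sq_sqrt h0]

/-- The Lipschitz bound for the joint vector passes to N_k. Only θ₂ and θ₃ need common jump
operators. -/
theorem norm_emissionCorr_sub_le (h₁ : ∀ k, 0 ≤ M.γ θ₁ k) (h₂ : ∀ k, 0 ≤ M.γ θ₂ k)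
    (h₃ : ∀ k, 0 ≤ M.γ θ₃ k) (hJ : M.J θ₂ = M.J θ₃) (A : H →L[ℂ] H) {t : ℝ} (ht : 0 ≤ t) :
    ‖M.emissionCorr A t θ₁ θ₂ - M.emissionCorr A t θ₁ θ₃‖ ≤
      ‖A‖ ^ 2 * (Real.sqrt (t * ∑ k, ‖M.J θ₂ k‖ ^ 2) *
        ∑ k, |Real.sqrt (M.γ θ₂ k) - Real.sqrt (M.γ θ₃ k)|) * t := by
  have hii : ∀ {θ'}, (∀ k, 0 ≤ M.γ θ' k) → IntervalIntegrable (fun s =>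
      inner ℂ (ampliate R A (M.purification s θ₁)) (ampliate R A (M.purification s θ')))
      volume 0 t := fun h' => by
    refine ((M.continuousOn_inner_ampliate_J h₁ h' A).mono ?_).intervalIntegrable
    rw [uIcc_of_le ht]
    exact Icc_subset_Ici_self
  rw [emissionCorr, emissionCorr, ← intervalIntegral.integral_sub (hii h₂) (hii h₃)]
  have := intervalIntegral.norm_integral_le_of_norm_le_const (a := 0) (b := t)
    (f := fun s => inner ℂ (ampliate R A (M.purification s θ₁))
        (ampliate R A (M.purification s θ₂)) - inner ℂ (ampliate R A (M.purification s θ₁))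
        (ampliate R A (M.purification s θ₃)))
    (C := ‖A‖ ^ 2 * (Real.sqrt (t * ∑ k, ‖M.J θ₂ k‖ ^ 2) *
        ∑ k, |Real.sqrt (M.γ θ₂ k) - Real.sqrt (M.γ θ₃ k)|)) (fun s hs => by
      rw [uIoc_of_le ht] at hs
      rw [← inner_sub_right, ← map_sub]
      refine (M.norm_inner_ampliate_le h₁ A hs.1.le _).trans ?_
      refine mul_le_mul_of_nonneg_left ((M.norm_purification_sub_le h₂ h₃ hJ hs.1.le).trans ?_)
        (sq_nonneg _)
      have : 0 ≤ ∑ k, ‖M.J θ₂ k‖ ^ 2 := Finset.sum_nonneg fun _ _ => sq_nonneg _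
      gcongr
      exact hs.2)
  rwa [sub_zero, abs_of_nonneg ht] at this

theorem emissionCorr_conj (A : H →L[ℂ] H) (t : ℝ) (θ₁ θ₂ : Fin d → ℝ) :
    starRingEnd ℂ (M.emissionCorr A t θ₁ θ₂) = M.emissionCorr A t θ₂ θ₁ := by
  simp only [emissionCorr, intervalIntegral, map_sub, ← integral_conj, inner_conj_symm]

theorem norm_emissionCorr_sub_le' (h₁ : ∀ k, 0 ≤ M.γ θ₁ k) (h₂ : ∀ k, 0 ≤ M.γ θ₂ k)
    (h₃ : ∀ k, 0 ≤ M.γ θ₃ k) (hJ : M.J θ₂ = M.J θ₃) (A : H →L[ℂ] H) {t : ℝ} (ht : 0 ≤ t) :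
    ‖M.emissionCorr A t θ₂ θ₁ - M.emissionCorr A t θ₃ θ₁‖ ≤
      ‖A‖ ^ 2 * (Real.sqrt (t * ∑ k, ‖M.J θ₂ k‖ ^ 2) *
        ∑ k, |Real.sqrt (M.γ θ₂ k) - Real.sqrt (M.γ θ₃ k)|) * t := by
  rw [← M.emissionCorr_conj A t θ₁ θ₂, ← M.emissionCorr_conj A t θ₁ θ₃, ← map_sub,
    RCLike.norm_conj]
  exact M.norm_emissionCorr_sub_le h₁ h₂ h₃ hJ A ht

/-! ### Derivatives with respect to the eigenrates -/

/-- The eigenframe does not depend on the parameters. -/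
def ConstantFrame : Prop :=
  ∀ θ ∈ M.dom, ∀ (α : Fin d) (i k : Fin R),
    HasLineDerivAt ℝ (fun θ' => M.V θ' i k) 0 θ (dir α)

theorem eventually_mem_dom_line (hθ : θ ∈ M.dom) (α : Fin d) :
    ∀ᶠ h in 𝓝 (0 : ℝ), θ + h • dir α ∈ M.dom := by
  have hc : Continuous fun h : ℝ => θ + h • (dir α : Fin d → ℝ) := by fun_prop
  exact (hc.tendsto 0).eventually (by simpa using M.isOpen_dom.mem_nhds hθ)

/-- The domain may be disconnected, so V is frozen only on a short segment through θ. This suffices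
because all derivatives are taken along coordinate lines. -/
theorem eventually_V_line (hV : M.ConstantFrame) (hθ : θ ∈ M.dom) (α : Fin d) :
    ∀ᶠ h in 𝓝 (0 : ℝ), θ + h • dir α ∈ M.dom ∧ M.V (θ + h • dir α) = M.V θ := by
  obtain ⟨ε, hε, hball⟩ := Metric.eventually_nhds_iff_ball.1 (M.eventually_mem_dom_line hθ α)
  filter_upwards [Metric.ball_mem_nhds (0 : ℝ) hε] with h hh
  refine ⟨hball h hh, ?_⟩
  ext i k
  have hd : ∀ s ∈ Metric.ball (0 : ℝ) ε,
      HasDerivAt (fun s => M.V (θ + s • dir α) i k) 0 s := by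
    intro s hs
    -- The base point 0 is written as s - s so that translating the line derivative at θ + s e_α
    -- yields a derivative at s.
    have h1 : HasDerivAt (fun τ => M.V (θ + s • dir α + τ • dir α) i k) 0 (s - s) := by
      rw [sub_self]; exact hV _ (hball s hs) α i k
    refine (h1.comp_sub_const s s).congr_of_eventuallyEq (Eventually.of_forall fun τ => ?_)
    simp only [add_assoc, ← add_smul]
    congr 4
    ring
  have := Metric.isOpen_ball.is_const_of_deriv_eq_zero (𝕜 := ℝ)
    (convex_ball (0 : ℝ) ε).isPreconnected
    (fun s hs => (hd s hs).differentiableAt.differentiableWithinAt) (fun s hs => (hd s hs).deriv)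
    hh (Metric.mem_ball_self hε)
  simpa using this

theorem J_eq_of_V_eq (h : M.V θ₁ = M.V θ₂) : M.J θ₁ = M.J θ₂ := by
  funext k; simp only [J, h]

theorem γ_nonneg (hθ : θ ∈ M.dom) (k : Fin R) : 0 ≤ M.γ θ k := (M.γ_pos θ hθ k).le

theorem hasDerivAt_γ_line (hθ : θ ∈ M.dom) (α : Fin d) (k : Fin R) :
    HasDerivAt (fun h : ℝ => M.γ (θ + h • dir α) k) (pd α (fun θ' => M.γ θ' k) θ) 0 :=
  (M.γ_diff θ hθ k α).hasLineDerivAt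

theorem hasDerivAt_sqrt_γ_line (hθ : θ ∈ M.dom) (α : Fin d) (k : Fin R) :
    HasDerivAt (fun h : ℝ => Real.sqrt (M.γ (θ + h • dir α) k))
      (pd α (fun θ' => M.γ θ' k) θ / (2 * Real.sqrt (M.γ θ k))) 0 := by
  have h0 : M.γ (θ + (0 : ℝ) • dir α) k = M.γ θ k := by simp
  have := (M.hasDerivAt_γ_line hθ α k).sqrt (by rw [h0]; exact (M.γ_pos θ hθ k).ne')
  rwa [h0] at this

theorem pd_sqrt_γ (hθ : θ ∈ M.dom) (α : Fin d) (k : Fin R) :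
    pd α (fun θ' => Real.sqrt (M.γ θ' k)) θ =
      pd α (fun θ' => M.γ θ' k) θ / (2 * Real.sqrt (M.γ θ k)) :=
  (M.hasDerivAt_sqrt_γ_line hθ α k).deriv

/-- The inner product of two difference quotients is a mixed second difference of the overlap. The
limit is taken jointly in both increments, which is what the Cauchy argument for α = β requires. -/
theorem tendsto_inner_slope_purification (hV : M.ConstantFrame) (hθ : θ ∈ M.dom) {t : ℝ}
    (ht : 0 ≤ t) (α β : Fin d) :
    Tendsto (fun p : ℝ × ℝ =>
      inner ℂ (slope (fun h : ℝ => M.purification t (θ + h • dir α)) 0 p.1)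
        (slope (fun h : ℝ => M.purification t (θ + h • dir β)) 0 p.2))
      (𝓝[≠] 0 ×ˢ 𝓝[≠] 0)
      (𝓝 (∑ j, ((pd α (fun θ' => Real.sqrt (M.γ θ' j)) θ : ℝ) : ℂ) *
        ((pd β (fun θ' => Real.sqrt (M.γ θ' j)) θ : ℝ) : ℂ) * M.emissionCorr (M.J θ j) t θ θ)) := by
  set p : ℝ → Fin d → ℝ := fun h => θ + h • dir α
  set q : ℝ → Fin d → ℝ := fun h => θ + h • dir β
  have hp0 : p 0 = θ := by simp [p]
  have hq0 : q 0 = θ := by simp [q]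
  have hJp : ∀ {h}, M.V (p h) = M.V θ → M.J (p h) = M.J θ := fun e => M.J_eq_of_V_eq e
  have hJq : ∀ {h}, M.V (q h) = M.V θ → M.J (q h) = M.J θ := fun e => M.J_eq_of_V_eq e
  set L := Real.sqrt (t * ∑ k, ‖M.J θ k‖ ^ 2)
  set C : ℝ := (∑ j, ‖M.J θ j‖ ^ 2) * L * t
  have hC : ∀ j (S : ℝ), 0 ≤ S → ‖M.J θ j‖ ^ 2 * (L * S) * t ≤ C * S := by
    intro j S hS
    have h1 : ‖M.J θ j‖ ^ 2 ≤ ∑ j, ‖M.J θ j‖ ^ 2 :=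
      Finset.single_le_sum (f := fun j => ‖M.J θ j‖ ^ 2) (fun _ _ => sq_nonneg _)
        (Finset.mem_univ j)
    calc _ = ‖M.J θ j‖ ^ 2 * (L * S * t) := by ring
      _ ≤ (∑ j, ‖M.J θ j‖ ^ 2) * (L * S * t) :=
        mul_le_mul_of_nonneg_right h1 (by positivity)
      _ = _ := by ring
  have key := tendsto_mixed_difference
    -- Subtracting the amplitude at θ makes a and b vanish at 0 without changing a - b.
    (a := fun j h => Real.sqrt (M.γ (p h) j) - Real.sqrt (M.γ θ j))
    (b := fun j h => Real.sqrt (M.γ (q h) j) - Real.sqrt (M.γ θ j))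
    (a' := fun j => pd α (fun θ' => Real.sqrt (M.γ θ' j)) θ)
    (b' := fun j => pd β (fun θ' => Real.sqrt (M.γ θ' j)) θ)
    (N := fun j h k => M.emissionCorr (M.J θ j) t (p h) (q k))
    (G := fun h k => inner ℂ (M.purification t (p h)) (M.purification t (q k)))
    (C := C) (M.eventually_V_line hV hθ α) (M.eventually_V_line hV hθ β)
    (fun j => by simp [hp0]) (fun j => by simp [hq0])
    (fun j => by
      rw [M.pd_sqrt_γ hθ]; exact (M.hasDerivAt_sqrt_γ_line hθ α j).sub_const _)
    (fun j => by
      rw [M.pd_sqrt_γ hθ]; exact (M.hasDerivAt_sqrt_γ_line hθ β j).sub_const _)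
    (fun h hh k hk => by
      have e1 := hJp hh.2
      have e2 := hJq hk.2
      have hp : p h ∈ M.dom := hh.1
      have hq : q k ∈ M.dom := hk.1
      rw [M.inner_purification (M.γ_nonneg hp) (M.γ_nonneg hq) (e1.trans e2.symm) ht]
      simp only [sub_sub_sub_cancel_right, e1]
      rfl)
    (fun j h hh k hk => by
      have e1 := hJp hh.2
      have := M.norm_emissionCorr_sub_le' (M.γ_nonneg hk.1) (M.γ_nonneg hh.1) (M.γ_nonneg hθ)
        e1 (M.J θ j) ht
      rw [hp0]
      refine this.trans ?_
      rw [e1]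
      exact hC j _ (Finset.sum_nonneg fun _ _ => abs_nonneg _))
    (fun j h hh k hk => by
      have e2 := hJq hk.2
      have := M.norm_emissionCorr_sub_le (M.γ_nonneg hh.1) (M.γ_nonneg hk.1) (M.γ_nonneg hθ)
        e2 (M.J θ j) ht
      rw [hq0]
      refine this.trans ?_
      rw [e2]
      exact hC j _ (Finset.sum_nonneg fun _ _ => abs_nonneg _))
  simp only [hp0, hq0] at key
  refine key.congr fun x => ?_
  rw [slope_def_module, slope_def_module]
  simp only [sub_zero, joint_real_smul, inner_smul_left, inner_smul_right, inner_sub_left,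
    inner_sub_right, zero_smul, add_zero, Complex.ofReal_inv, map_inv₀, Complex.conj_ofReal, p, q]
  ring

/-- The overlap differs from 1 by a term quadratic in the amplitude differences, so its first-order
part vanishes. -/
theorem tendsto_inner_purification_slope (hV : M.ConstantFrame) (hθ : θ ∈ M.dom) {t : ℝ}
    (ht : 0 ≤ t) (β : Fin d) :
    Tendsto (fun k : ℝ => inner ℂ (M.purification t θ)
        (slope (fun h : ℝ => M.purification t (θ + h • dir β)) 0 k)) (𝓝[≠] 0) (𝓝 0) := by
  set q : ℝ → Fin d → ℝ := fun h => θ + h • dir β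
  have hq0 : q 0 = θ := by simp [q]
  have hd := fun j => M.hasDerivAt_sqrt_γ_line hθ β j
  set b : Fin R → ℝ → ℝ := fun j h => Real.sqrt (M.γ (q h) j) - Real.sqrt (M.γ θ j)
  have hlim : Tendsto (fun k => ∑ j, |b j k / k| * |b j k| * (‖M.J θ j‖ ^ 2 * t)) (𝓝[≠] 0)
      (𝓝 0) := by
    have h1 : ∀ j, Tendsto (fun k => b j k / k) (𝓝[≠] 0)
        (𝓝 (pd β (fun θ' => M.γ θ' j) θ / (2 * Real.sqrt (M.γ θ j)))) := fun j => by
      refine (hasDerivAt_iff_tendsto_slope.1 (hd j)).congr fun k => ?_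
      rw [slope_def_field]
      simp [b, q]
    have h2 : ∀ j, Tendsto (b j) (𝓝[≠] 0) (𝓝 0) := fun j => by
      have := ((hd j).sub_const (Real.sqrt (M.γ θ j))).continuousAt.tendsto
      simp only [zero_smul, add_zero, sub_self] at this
      exact this.mono_left nhdsWithin_le_nhds
    have := tendsto_finsetSum Finset.univ fun j (_ : j ∈ Finset.univ) =>
      ((h1 j).abs.mul (h2 j).abs).mul_const (‖M.J θ j‖ ^ 2 * t)
    simpa using this
  refine squeeze_zero_norm' ?_ hlim
  filter_upwards [mem_nhdsWithin_of_mem_nhds (M.eventually_V_line hV hθ β),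
    self_mem_nhdsWithin] with k hk hk0
  have e2 : M.J (q k) = M.J θ := M.J_eq_of_V_eq hk.2
  have hself : inner ℂ (M.purification t θ) (M.purification t θ) = (1 : ℂ) := by
    rw [inner_self_eq_norm_sq_to_K, M.norm_purification (M.γ_nonneg hθ) ht]; simp
  have e : inner ℂ (M.purification t θ) (slope (fun h : ℝ => M.purification t (q h)) 0 k) =
      -(1 / 2 : ℂ) * ∑ j, ((b j k / k * b j k : ℝ) : ℂ) * M.emissionCorr (M.J θ j) t θ (q k) := by
    rw [slope_def_module]
    simp only [sub_zero, joint_real_smul, inner_smul_right, inner_sub_right, hq0, hself]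
    have hq : q k ∈ M.dom := hk.1
    rw [M.inner_purification (M.γ_nonneg hθ) (M.γ_nonneg hq) e2.symm ht, Finset.mul_sum,
      sub_sub_cancel_left, Finset.mul_sum, ← Finset.sum_neg_distrib, Finset.mul_sum]
    refine Finset.sum_congr rfl fun j _ => ?_
    rw [emissionCorr]
    simp only [b]
    push_cast
    ring
  rw [e]
  refine (norm_mul_le _ _).trans ?_
  have : ‖(-(1 / 2) : ℂ)‖ ≤ 1 := by norm_num
  refine (mul_le_mul_of_nonneg_right this (norm_nonneg _)).trans ?_
  rw [one_mul]
  refine (norm_sum_le _ _).trans (Finset.sum_le_sum fun j _ => ?_)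
  rw [norm_mul, Complex.norm_real, Real.norm_eq_abs, abs_mul]
  exact mul_le_mul_of_nonneg_left
    (M.norm_emissionCorr_le (M.γ_nonneg hθ) (M.γ_nonneg hk.1) _ ht) (by positivity)

theorem hasPd_purification (hV : M.ConstantFrame) (hθ : θ ∈ M.dom) {t : ℝ} (ht : 0 ≤ t)
    (α : Fin d) : HasPd α (M.purification t) θ := by
  obtain ⟨f', hf'⟩ := exists_hasDerivAt_of_tendsto_inner_slope
    (M.tendsto_inner_slope_purification hV hθ ht α α)
  exact hf'.differentiableAt

theorem tendsto_slope_purification (hV : M.ConstantFrame) (hθ : θ ∈ M.dom) {t : ℝ} (ht : 0 ≤ t)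
    (α : Fin d) : Tendsto (slope (fun h : ℝ => M.purification t (θ + h • dir α)) 0) (𝓝[≠] 0)
      (𝓝 (pd α (M.purification t) θ)) :=
  hasDerivAt_iff_tendsto_slope.1 (M.hasPd_purification hV hθ ht α).hasLineDerivAt

theorem inner_pd_pd (hV : M.ConstantFrame) (hθ : θ ∈ M.dom) {t : ℝ} (ht : 0 ≤ t)
    (α β : Fin d) :
    inner ℂ (pd α (M.purification t) θ) (pd β (M.purification t) θ) =
      ∑ j, ((pd α (fun θ' => Real.sqrt (M.γ θ' j)) θ : ℝ) : ℂ) *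
        ((pd β (fun θ' => Real.sqrt (M.γ θ' j)) θ : ℝ) : ℂ) * M.emissionCorr (M.J θ j) t θ θ :=
  tendsto_nhds_unique
    (((M.tendsto_slope_purification hV hθ ht α).comp tendsto_fst).inner
      ((M.tendsto_slope_purification hV hθ ht β).comp tendsto_snd))
    (M.tendsto_inner_slope_purification hV hθ ht α β)

theorem inner_purification_pd (hV : M.ConstantFrame) (hθ : θ ∈ M.dom) {t : ℝ} (ht : 0 ≤ t)
    (β : Fin d) : inner ℂ (M.purification t θ) (pd β (M.purification t) θ) = 0 :=
  tendsto_nhds_unique (tendsto_const_nhds.inner (M.tendsto_slope_purification hV hθ ht β))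
    (M.tendsto_inner_purification_slope hV hθ ht β)

/-! ### The quantum Fisher information -/

/-- The expected number `Tr(J_k† J_k ρ(s))` of emissions into channel `k`, per unit of rate. -/
noncomputable def emissionRate (θ : Fin d → ℝ) (k : Fin R) (s : ℝ) : ℝ :=
  ‖ampliate R (M.J θ k) (M.purification s θ)‖ ^ 2

theorem emissionRate_eq_opTrace (hθ : θ ∈ M.dom) {ι : Type*} [Countable ι]
    (b : HilbertBasis ι ℂ H) (k : Fin R) {s : ℝ} (hs : 0 ≤ s) :
    (opTrace b (star (M.J θ k) * M.J θ k * M.ρ θ s)).re = M.emissionRate θ k s := by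
  rw [M.opTrace_mul_ρ b (M.γ_nonneg hθ) hs, ← inner_ampliate_ampliate, emissionRate,
    ← inner_self_eq_norm_sq (𝕜 := ℂ)]
  rfl

theorem continuousOn_emissionRate (hθ : θ ∈ M.dom) (k : Fin R) :
    ContinuousOn (M.emissionRate θ k) (Ici 0) := by
  have := Complex.continuous_re.comp_continuousOn
    (M.continuousOn_inner_ampliate_J (M.γ_nonneg hθ) (M.γ_nonneg hθ) (M.J θ k))
  refine this.congr fun s _ => ?_
  rw [emissionRate, ← inner_self_eq_norm_sq (𝕜 := ℂ)]
  rfl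

theorem emissionRate_le (hθ : θ ∈ M.dom) (k : Fin R) {s : ℝ} (hs : 0 ≤ s) :
    M.emissionRate θ k s ≤ ‖M.J θ k‖ ^ 2 := by
  have h1 := norm_ampliate_apply_le (M.J θ k) (M.purification s θ)
  rw [M.norm_purification (M.γ_nonneg hθ) hs, mul_one] at h1
  exact pow_le_pow_left₀ (norm_nonneg _) h1 2

theorem emissionCorr_self (k : Fin R) (t : ℝ) :
    M.emissionCorr (M.J θ k) t θ θ = ((∫ s in (0 : ℝ)..t, M.emissionRate θ k s : ℝ) : ℂ) := by
  rw [emissionCorr, ← intervalIntegral.integral_ofReal]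
  refine intervalIntegral.integral_congr fun s _ => ?_
  simp only [inner_self_eq_norm_sq_to_K, emissionRate]
  norm_cast

theorem collisionalQFI_apply (θ : Fin d → ℝ) (t : ℝ) (α β : Fin d) :
    M.collisionalQFI θ t α β =
      4 * (inner ℂ (pd α (M.purification t) θ) (pd β (M.purification t) θ) -
        inner ℂ (pd α (M.purification t) θ) (M.purification t θ) *
          inner ℂ (M.purification t θ) (pd β (M.purification t) θ)).re := rfl

/-- The projection term of the geometric tensor drops out because ⟨Ψ, ∂_βΨ⟩ = 0. -/
theorem collisionalQFI_eq (hV : M.ConstantFrame) (hθ : θ ∈ M.dom) {t : ℝ} (ht : 0 ≤ t)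
    (α β : Fin d) :
    M.collisionalQFI θ t α β = 4 * ∑ k, pd α (fun θ' => Real.sqrt (M.γ θ' k)) θ *
      pd β (fun θ' => Real.sqrt (M.γ θ' k)) θ * ∫ s in (0 : ℝ)..t, M.emissionRate θ k s := by
  rw [collisionalQFI_apply, M.inner_purification_pd hV hθ ht, mul_zero,
    sub_zero, M.inner_pd_pd hV hθ ht]
  simp only [emissionCorr_self]
  norm_cast

theorem collisionalQFI_self_eq (hV : M.ConstantFrame) (hθ : θ ∈ M.dom) {t : ℝ} (ht : 0 ≤ t)
    (α : Fin d) :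
    M.collisionalQFI θ t α α = 4 * ‖pd α (M.purification t) θ‖ ^ 2 := by
  rw [collisionalQFI_apply, M.inner_purification_pd hV hθ ht, mul_zero,
    sub_zero, ← inner_self_eq_norm_sq (𝕜 := ℂ)]
  rfl

theorem hasDerivWithinAt_collisionalQFI (hV : M.ConstantFrame) (hθ : θ ∈ M.dom) {t : ℝ}
    (ht : 0 ≤ t) (α β : Fin d) :
    HasDerivWithinAt (fun s => M.collisionalQFI θ s α β)
      (4 * ∑ k, pd α (fun θ' => Real.sqrt (M.γ θ' k)) θ *
        pd β (fun θ' => Real.sqrt (M.γ θ' k)) θ * M.emissionRate θ k t) (Ici 0) t := by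
  have hI : ∀ k, HasDerivWithinAt (fun t => ∫ s in (0 : ℝ)..t, M.emissionRate θ k s)
      (M.emissionRate θ k t) (Ici 0) t := by
    intro k
    -- The rate is known to be continuous only for s ≥ 0; its constant extension to negative times
    -- makes the fundamental theorem of calculus available at t = 0.
    have hc : Continuous fun s => M.emissionRate θ k (max s 0) :=
      (M.continuousOn_emissionRate hθ k).comp_continuous (by fun_prop) fun s => le_max_right s 0
    have h1 := (hc.integral_hasStrictDerivAt 0 t).hasDerivAt.hasDerivWithinAt (s := Ici 0)
    simp only [max_eq_left ht] at h1
    have heq : ∀ u, 0 ≤ u → ∫ s in (0 : ℝ)..u, M.emissionRate θ k s =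
        ∫ s in (0 : ℝ)..u, M.emissionRate θ k (max s 0) := fun u hu => by
      refine intervalIntegral.integral_congr fun s hs => ?_
      rw [uIcc_of_le hu] at hs
      simp only [max_eq_left hs.1]
    exact h1.congr (fun u hu => heq u hu) (heq t ht)
  have hsum := (HasDerivWithinAt.fun_sum (u := Finset.univ) fun k _ =>
    (hI k).const_mul (pd α (fun θ' => Real.sqrt (M.γ θ' k)) θ *
        pd β (fun θ' => Real.sqrt (M.γ θ' k)) θ)).const_mul 4
  exact hsum.congr (fun u hu => M.collisionalQFI_eq hV hθ hu α β)
    (M.collisionalQFI_eq hV hθ ht α β)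

theorem collisionalQFI_self_le (hV : M.ConstantFrame) (hθ : θ ∈ M.dom) {t : ℝ} (ht : 0 ≤ t)
    (α : Fin d) :
    M.collisionalQFI θ t α α ≤
      t * ∑ k, (pd α (fun θ' => M.γ θ' k) θ) ^ 2 / M.γ θ k * ‖M.J θ k‖ ^ 2 := by
  rw [M.collisionalQFI_eq hV hθ ht, Finset.mul_sum, Finset.mul_sum]
  refine Finset.sum_le_sum fun k _ => ?_
  have hint : ∫ s in (0 : ℝ)..t, M.emissionRate θ k s ≤ ∫ _ in (0 : ℝ)..t, ‖M.J θ k‖ ^ 2 := by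
    refine intervalIntegral.integral_mono_on ht
      ((M.continuousOn_emissionRate hθ k).mono ?_).intervalIntegrable intervalIntegrable_const
      fun s hs => M.emissionRate_le hθ k hs.1
    rw [uIcc_of_le ht]
    exact Icc_subset_Ici_self
  rw [intervalIntegral.integral_const, smul_eq_mul, sub_zero] at hint
  have hγ := M.γ_pos θ hθ k
  have e : 4 * (pd α (fun θ' => Real.sqrt (M.γ θ' k)) θ *
      pd α (fun θ' => Real.sqrt (M.γ θ' k)) θ) = pd α (fun θ' => M.γ θ' k) θ ^ 2 / M.γ θ k := by
    rw [M.pd_sqrt_γ hθ, div_mul_div_comm]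
    have : 2 * Real.sqrt (M.γ θ k) * (2 * Real.sqrt (M.γ θ k)) = 4 * M.γ θ k := by
      have := Real.mul_self_sqrt hγ.le
      linear_combination 4 * this
    rw [this]
    field_simp
  rw [← mul_assoc, e]
  calc _ ≤ pd α (fun θ' => M.γ θ' k) θ ^ 2 / M.γ θ k * (t * ‖M.J θ k‖ ^ 2) :=
        mul_le_mul_of_nonneg_left hint (by positivity)
    _ = _ := by ring

end Model

/-! ### The classical Cramér-Rao bound for independent repetitions -/

section CramerRao

variable {Ω : Type*} [Fintype Ω]

theorem sum_cons_eq {ν : ℕ} (F : (Fin (ν + 1) → Ω) → ℝ) :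
    ∑ x, F x = ∑ ω, ∑ y : Fin ν → Ω, F (Fin.cons ω y) := by
  rw [← Fintype.sum_prod_type', ← (Fin.consEquiv fun _ : Fin (ν + 1) => Ω).sum_comp]
  rfl

/-- The first moments of the score of `ν` independent repetitions. -/
theorem moments_score {p l : Ω → ℝ} (hp : ∑ ω, p ω = 1) (hl : ∑ ω, p ω * l ω = 0) (ν : ℕ) :
    (∑ x : Fin ν → Ω, ∏ a, p (x a) = 1) ∧
    (∑ x : Fin ν → Ω, (∏ a, p (x a)) * ∑ a, l (x a) = 0) ∧
    (∑ x : Fin ν → Ω, (∏ a, p (x a)) * (∑ a, l (x a)) ^ 2 = ν * ∑ ω, p ω * l ω ^ 2) := by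
  induction ν with
  | zero => simp
  | succ ν ih =>
    obtain ⟨h0, h1, h2⟩ := ih
    simp only [sum_cons_eq, Fin.prod_univ_succ, Fin.sum_univ_succ, Fin.cons_zero, Fin.cons_succ]
    refine ⟨?_, ?_, ?_⟩
    · simp only [← Finset.mul_sum, h0, mul_one, hp]
    · have : ∀ ω, ∑ y : Fin ν → Ω, p ω * (∏ a, p (y a)) * (l ω + ∑ a, l (y a)) = p ω * l ω := by
        intro ω
        calc _ = p ω * l ω * (∑ y : Fin ν → Ω, ∏ a, p (y a)) +
              p ω * ∑ y : Fin ν → Ω, (∏ a, p (y a)) * ∑ a, l (y a) := by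
              rw [Finset.mul_sum, Finset.mul_sum, ← Finset.sum_add_distrib]
              exact Finset.sum_congr rfl fun y _ => by ring
          _ = _ := by rw [h0, h1]; ring
      simp only [this, hl]
    · have : ∀ ω, ∑ y : Fin ν → Ω, p ω * (∏ a, p (y a)) * (l ω + ∑ a, l (y a)) ^ 2 =
          p ω * l ω ^ 2 + p ω * (ν * ∑ ω, p ω * l ω ^ 2) := by
        intro ω
        calc _ = p ω * l ω ^ 2 * (∑ y : Fin ν → Ω, ∏ a, p (y a)) +
              2 * p ω * l ω * (∑ y : Fin ν → Ω, (∏ a, p (y a)) * ∑ a, l (y a)) +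
              p ω * ∑ y : Fin ν → Ω, (∏ a, p (y a)) * (∑ a, l (y a)) ^ 2 := by
              rw [Finset.mul_sum, Finset.mul_sum, Finset.mul_sum, ← Finset.sum_add_distrib,
                ← Finset.sum_add_distrib]
              exact Finset.sum_congr rfl fun y _ => by ring
          _ = _ := by rw [h0, h1, h2]; ring
      simp only [this, Finset.sum_add_distrib, ← Finset.sum_mul, hp]
      push_cast
      ring

/-- The Cramér-Rao bound for `ν` independent repetitions of an experiment with score `l`. -/
theorem one_le_fisher_mul_variance {P : ℝ → Ω → ℝ} {p l : Ω → ℝ} {ν : ℕ}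
    {est : (Fin ν → Ω) → ℝ} {m : ℝ} (hp0 : ∀ ω, 0 ≤ p ω) (hp : ∑ ω, p ω = 1)
    (hl : ∑ ω, p ω * l ω = 0) (hP0 : P 0 = p)
    (hP : ∀ ω, HasDerivAt (fun h => P h ω) (p ω * l ω) 0)
    (hE : HasDerivAt (fun h => ∑ x : Fin ν → Ω, (∏ a, P h (x a)) * est x) 1 0) :
    1 ≤ (ν * ∑ ω, p ω * l ω ^ 2) *
      ∑ x : Fin ν → Ω, (∏ a, p (x a)) * ((est x - m) * (est x - m)) := by
  classical
  obtain ⟨-, h1, h2⟩ := moments_score hp hl ν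
  have hprod : ∀ x : Fin ν → Ω, HasDerivAt (fun h => ∏ a, P h (x a))
      ((∏ a, p (x a)) * ∑ a, l (x a)) 0 := by
    intro x
    have := HasDerivAt.fun_finsetProd (u := Finset.univ) fun a _ => hP (x a)
    refine this.congr_deriv ?_
    rw [Finset.mul_sum]
    refine Finset.sum_congr rfl fun a _ => ?_
    rw [hP0, smul_eq_mul, ← Finset.mul_prod_erase _ _ (Finset.mem_univ a)]
    ring
  have hE' := HasDerivAt.fun_sum (u := Finset.univ) fun x (_ : x ∈ Finset.univ) =>
    (hprod x).mul_const (est x)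
  have e1 := hE'.unique hE
  -- The score has mean zero, so centring the estimator at any m leaves its correlation with the
  -- score equal to the derivative of its mean.
  have e2 : ∑ x : Fin ν → Ω, (∏ a, p (x a)) * (∑ a, l (x a)) * (est x - m) = 1 := by
    simp only [mul_sub, Finset.sum_sub_distrib, e1, ← Finset.sum_mul, h1]
    ring
  have hW : ∀ x : Fin ν → Ω, 0 ≤ ∏ a, p (x a) := fun x => Finset.prod_nonneg fun a _ => hp0 _
  have cs := Finset.sum_sq_le_sum_mul_sum_of_sq_le_mul Finset.univ
    (r := fun x : Fin ν → Ω => (∏ a, p (x a)) * (∑ a, l (x a)) * (est x - m))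
    (f := fun x => (∏ a, p (x a)) * (∑ a, l (x a)) ^ 2)
    (g := fun x => (∏ a, p (x a)) * ((est x - m) * (est x - m)))
    (fun x _ => mul_nonneg (hW x) (sq_nonneg _))
    (fun x _ => mul_nonneg (hW x) (mul_self_nonneg _)) (fun x _ => le_of_eq (by ring))
  rw [e2, h2, one_pow] at cs
  exact cs

end CramerRao

/-! ### Measurements on the joint vector -/

section Measurement

variable {K : Type*} [NormedAddCommGroup K] [InnerProductSpace ℂ K]

/-- The Cauchy-Schwarz inequality for a positive semidefinite form. -/
theorem re_inner_sq_le_of_nonneg {A : K →L[ℂ] K} (hs : ∀ u v, inner ℂ (A u) v = inner ℂ u (A v))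
    (hA : ∀ u, 0 ≤ (inner ℂ u (A u)).re) (u v : K) :
    (inner ℂ u (A v)).re ^ 2 ≤ (inner ℂ u (A u)).re * (inner ℂ v (A v)).re := by
  have hsymm : (inner ℂ v (A u)).re = (inner ℂ u (A v)).re := by
    rw [← hs v u, ← inner_conj_symm, Complex.conj_re]
  -- The form is evaluated at u + xv; a real quadratic that is nonnegative everywhere has
  -- nonpositive discriminant.
  have h : ∀ x : ℝ, 0 ≤ (inner ℂ v (A v)).re * (x * x) + 2 * (inner ℂ u (A v)).re * x +
      (inner ℂ u (A u)).re := by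
    intro x
    have := hA (u + (x : ℂ) • v)
    simp only [map_add, map_smul, inner_add_left, inner_add_right, inner_smul_left,
      inner_smul_right, Complex.conj_ofReal, Complex.add_re, Complex.re_ofReal_mul, hsymm] at this
    linarith
  have := discrim_le_zero h
  rw [discrim] at this
  nlinarith

end Measurement

namespace Model

variable {H : Type*} [NormedAddCommGroup H] [InnerProductSpace ℂ H] [CompleteSpace H] {d R : ℕ}
variable (M : Model H d R) {θ : Fin d → ℝ}

omit [CompleteSpace H] in
theorem inner_ampliate_left {A : H →L[ℂ] H} (hA : A.IsPositive) (Φ₁ Φ₂ : Joint H R) :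
    inner ℂ (ampliate R A Φ₁) Φ₂ = inner ℂ Φ₁ (ampliate R A Φ₂) := by
  rw [inner_ampliate, L2.inner_def]
  refine integral_congr_ae ?_
  filter_upwards [A.coeFn_compLpL Φ₁] with σ h1
  rw [ampliate, h1]
  exact hA.isSymmetric (Φ₁ σ) (Φ₂ σ)

omit [CompleteSpace H] in
theorem re_inner_ampliate_nonneg {A : H →L[ℂ] H} (hA : A.IsPositive) (Φ : Joint H R) :
    0 ≤ (inner ℂ Φ (ampliate R A Φ)).re := by
  have hint : Integrable (fun σ => inner ℂ (Φ σ) (A (Φ σ))) (fockMeasure R) := by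
    refine (L2.integrable_inner (𝕜 := ℂ) Φ (ampliate R A Φ)).congr ?_
    filter_upwards [A.coeFn_compLpL Φ] with σ h1
    rw [ampliate, h1]
  rw [inner_ampliate, ← RCLike.re_to_complex, ← integral_re hint]
  exact integral_nonneg fun σ => hA.re_inner_nonneg_right (Φ σ)

omit [CompleteSpace H] in
theorem sum_inner_ampliate {Ω : Type*} [Fintype Ω] {A : Ω → H →L[ℂ] H} (hA : ∑ x, A x = 1)
    (Φ₁ Φ₂ : Joint H R) : ∑ x, inner ℂ Φ₁ (ampliate R (A x) Φ₂) = inner ℂ Φ₁ Φ₂ := by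
  have hint : ∀ x, Integrable (fun σ => inner ℂ (Φ₁ σ) (A x (Φ₂ σ))) (fockMeasure R) := by
    intro x
    refine (L2.integrable_inner (𝕜 := ℂ) Φ₁ (ampliate R (A x) Φ₂)).congr ?_
    filter_upwards [(A x).coeFn_compLpL Φ₂] with σ h1
    rw [ampliate, h1]
  simp only [inner_ampliate]
  rw [← integral_finsetSum _ fun x _ => hint x, L2.inner_def]
  refine integral_congr_ae (Eventually.of_forall fun σ => ?_)
  simp only [← inner_sum, ← sum_apply, hA, one_apply_eq_self]

variable {ι : Type*} [Countable ι] (b : HilbertBasis ι ℂ H) {Ω : Type*} [Fintype Ω] (P : POVM H Ω)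

theorem bornProb_eq (hθ : θ ∈ M.dom) {t : ℝ} (ht : 0 ≤ t) (x : Ω) :
    bornProb b M P t θ x =
      (inner ℂ (M.purification t θ) (ampliate R (P.effect x) (M.purification t θ))).re := by
  rw [bornProb, M.opTrace_mul_ρ b (M.γ_nonneg hθ) ht]

/-- The Born probability is the quadratic form of a symmetric operator in the joint vector, so the
derivative of Ψ suffices and ρ need not be differentiated. -/
theorem hasDerivAt_bornProb (hV : M.ConstantFrame) (hθ : θ ∈ M.dom) {t : ℝ} (ht : 0 ≤ t)
    (α : Fin d) (x : Ω) :
    HasDerivAt (fun h : ℝ => bornProb b M P t (θ + h • dir α) x)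
      (2 * (inner ℂ (pd α (M.purification t) θ)
        (ampliate R (P.effect x) (M.purification t θ))).re) 0 := by
  have hd : HasDerivAt (fun h : ℝ => M.purification t (θ + h • dir α))
      (pd α (M.purification t) θ) 0 := (M.hasPd_purification hV hθ ht α).hasLineDerivAt
  have hA : HasDerivAt (fun h : ℝ => ampliate R (P.effect x) (M.purification t (θ + h • dir α)))
      (ampliate R (P.effect x) (pd α (M.purification t) θ)) 0 :=
    ((ampliate R (P.effect x)).restrictScalars ℝ).hasFDerivAt.comp_hasDerivAt 0 hd
  have hi := hd.inner ℂ hA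
  have hre := Complex.reCLM.hasFDerivAt.comp_hasDerivAt 0 hi
  simp only [zero_smul, add_zero] at hre
  have hval : (Complex.reCLM (inner ℂ (M.purification t θ)
      (ampliate R (P.effect x) (pd α (M.purification t) θ)) +
      inner ℂ (pd α (M.purification t) θ) (ampliate R (P.effect x) (M.purification t θ)))) =
      2 * (inner ℂ (pd α (M.purification t) θ)
        (ampliate R (P.effect x) (M.purification t θ))).re := by
    rw [← inner_ampliate_left (P.effect_pos x), ← inner_conj_symm, Complex.reCLM_apply,
      Complex.add_re, Complex.conj_re]
    ring
  rw [hval] at hre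
  refine hre.congr_of_eventuallyEq ?_
  filter_upwards [M.eventually_mem_dom_line hθ α] with h hh
  exact M.bornProb_eq b P hh ht x

/-- The quantum Cramér-Rao bound for a measurement of the system alone. -/
theorem one_le_qfi_mul_covMatrix (hV : M.ConstantFrame) (hθ : θ ∈ M.dom) {t : ℝ} (ht : 0 ≤ t)
    {ν : ℕ} {est : (Fin ν → Ω) → Fin d → ℝ} (hest : LocallyUnbiased b M P t ν est θ)
    (α : Fin d) :
    1 ≤ ν * M.collisionalQFI θ t α α * covMatrix b M P t ν est θ α α ∧
      0 ≤ covMatrix b M P t ν est θ α α := by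
  set Ψ := M.purification t θ
  set Ψ' := pd α (M.purification t) θ
  set p : Ω → ℝ := bornProb b M P t θ with hpdef
  have hp : ∀ x, p x = (inner ℂ Ψ (ampliate R (P.effect x) Ψ)).re := M.bornProb_eq b P hθ ht
  have hp0 : ∀ x, 0 ≤ p x := fun x => by
    rw [hp]; exact re_inner_ampliate_nonneg (P.effect_pos x) Ψ
  set f : Ω → ℝ := fun x => (inner ℂ Ψ' (ampliate R (P.effect x) Ψ')).re
  set g : Ω → ℝ := fun x => 2 * (inner ℂ Ψ' (ampliate R (P.effect x) Ψ)).re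
  have hcs : ∀ x, g x ^ 2 ≤ 4 * f x * p x := fun x => by
    have := re_inner_sq_le_of_nonneg (inner_ampliate_left (P.effect_pos x))
      (re_inner_ampliate_nonneg (P.effect_pos x)) Ψ' Ψ
    rw [← hp] at this
    simp only [g, f]
    linarith
  have hf0 : ∀ x, 0 ≤ f x := fun x => re_inner_ampliate_nonneg (P.effect_pos x) Ψ'
  -- The score is 0 at outcomes of probability 0 by the convention for division by zero; there
  -- Cauchy-Schwarz forces g = 0 too, so p·l = g at every outcome.
  set l : Ω → ℝ := fun x => g x / p x
  have hgl : ∀ x, p x * l x = g x := fun x => by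
    rcases eq_or_ne (p x) 0 with h | h
    · have := hcs x
      rw [h, mul_zero] at this
      rw [h, zero_mul]
      exact (pow_eq_zero_iff two_ne_zero).1 (le_antisymm this (sq_nonneg _)) |>.symm
    · exact mul_div_cancel₀ _ h
  have hpl : ∀ x, p x * l x ^ 2 ≤ 4 * f x := fun x => by
    rcases eq_or_ne (p x) 0 with h | h
    · rw [h, zero_mul]; linarith [hf0 x]
    · have hpos := lt_of_le_of_ne (hp0 x) h.symm
      rw [div_pow, sq (p x), ← mul_div_assoc, mul_div_mul_left _ _ h, div_le_iff₀ hpos]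
      exact hcs x
  have hsum : ∑ x, p x = 1 := by
    simp only [hp]
    rw [← Complex.re_sum, sum_inner_ampliate P.sum_effect, inner_self_eq_norm_sq_to_K,
      M.norm_purification (M.γ_nonneg hθ) ht]
    simp
  have hsl : ∑ x, p x * l x = 0 := by
    simp only [hgl, g]
    rw [← Finset.mul_sum, ← Complex.re_sum, sum_inner_ampliate P.sum_effect, ← inner_conj_symm,
      M.inner_purification_pd hV hθ ht]
    simp
  -- The effects sum to the identity, so the pointwise bounds add up to 4‖∂_αΨ‖².
  have hfisher : ∑ x, p x * l x ^ 2 ≤ M.collisionalQFI θ t α α := by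
    refine (Finset.sum_le_sum fun x _ => hpl x).trans_eq ?_
    rw [← Finset.mul_sum, ← Complex.re_sum, sum_inner_ampliate P.sum_effect,
      M.collisionalQFI_self_eq hV hθ ht, ← inner_self_eq_norm_sq (𝕜 := ℂ)]
    rfl
  have hE : HasDerivAt (fun h : ℝ => ∑ x : Fin ν → Ω,
      (∏ a, bornProb b M P t (θ + h • dir α) (x a)) * est x α) 1 0 := by
    have := (hest α).2 α
    rw [if_pos rfl] at this
    exact this
  have key := one_le_fisher_mul_variance (P := fun h => bornProb b M P t (θ + h • dir α))
    (est := fun x => est x α) (m := θ α) hp0 hsum hsl (by simp [hpdef])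
    (fun x => by rw [hgl]; exact M.hasDerivAt_bornProb b P hV hθ ht α x) hE
  have hcov : covMatrix b M P t ν est θ α α =
      ∑ x : Fin ν → Ω, (∏ a, p (x a)) * ((est x α - θ α) * (est x α - θ α)) := rfl
  have hcov0 : 0 ≤ covMatrix b M P t ν est θ α α := by
    rw [hcov]
    exact Finset.sum_nonneg fun x _ =>
      mul_nonneg (Finset.prod_nonneg fun a _ => hp0 _) (mul_self_nonneg _)
  rw [← hcov] at key
  exact ⟨key.trans (by gcongr), hcov0⟩

/-! ### The dissipation kernel -/

theorem pdMatrix_ζ (hV : M.ConstantFrame) (hθ : θ ∈ M.dom) (α : Fin d) :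
    pdMatrix α M.ζ θ = M.V θ *
      Matrix.diagonal fun k => ((pd α (fun θ' => Real.sqrt (M.γ θ' k)) θ : ℝ) : ℂ) := by
  ext i j
  have h1 : HasDerivAt (fun h : ℝ => M.V θ i j * (Real.sqrt (M.γ (θ + h • dir α) j) : ℂ))
      (M.V θ i j * ((pd α (fun θ' => Real.sqrt (M.γ θ' j)) θ : ℝ) : ℂ)) 0 := by
    rw [M.pd_sqrt_γ hθ]
    exact ((M.hasDerivAt_sqrt_γ_line hθ α j).ofReal_comp).const_mul _
  rw [Matrix.mul_diagonal]
  refine (h1.congr_of_eventuallyEq ?_).deriv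
  filter_upwards [M.eventually_V_line hV hθ α] with h hh
  rw [ζ, Matrix.mul_diagonal, hh.2]

theorem pdMatrix_Γ (hV : M.ConstantFrame) (hθ : θ ∈ M.dom) (α : Fin d) :
    pdMatrix α M.Γ θ = M.V θ *
      Matrix.diagonal (fun k => ((pd α (fun θ' => M.γ θ' k) θ : ℝ) : ℂ)) *
      (M.V θ).conjTranspose := by
  ext i j
  have h1 : HasDerivAt (fun h : ℝ => ∑ k, M.V θ i k * (M.γ (θ + h • dir α) k : ℂ) *
      (M.V θ).conjTranspose k j)
      (∑ k, M.V θ i k * ((pd α (fun θ' => M.γ θ' k) θ : ℝ) : ℂ) *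
      (M.V θ).conjTranspose k j) 0 :=
    HasDerivAt.fun_sum fun k _ =>
      (((M.hasDerivAt_γ_line hθ α k).ofReal_comp).const_mul _).mul_const _
  rw [Matrix.mul_apply]
  simp only [Matrix.mul_diagonal]
  refine (h1.congr_of_eventuallyEq ?_).deriv
  filter_upwards [M.eventually_V_line hV hθ α] with h hh
  rw [Γ, Matrix.mul_apply, hh.2]
  simp only [Matrix.mul_diagonal]

/-- All matrices are conjugated into the common frame V, which reduces the claim to the scalar
identity 4 ∂_β√γ ∂_α√γ = ∂_βγ ∂_αγ / γ. -/
theorem kernel_eq (hV : M.ConstantFrame) (hθ : θ ∈ M.dom) (α β : Fin d) :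
    M.kernel θ α β = pdMatrix β M.Γ θ * (M.Γ θ)⁻¹ * pdMatrix α M.Γ θ := by
  have hU : (M.V θ).conjTranspose * M.V θ = 1 := Matrix.mem_unitaryGroup_iff'.1 (M.V_unitary θ hθ)
  have hU' : M.V θ * (M.V θ).conjTranspose = 1 := Matrix.mem_unitaryGroup_iff.1 (M.V_unitary θ hθ)
  have hγ : ∀ k, (M.γ θ k : ℂ) ≠ 0 := fun k =>
    Complex.ofReal_ne_zero.2 (M.γ_pos θ hθ k).ne'
  have hcancel : ∀ X Y : Matrix (Fin R) (Fin R) ℂ,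
      M.V θ * X * (M.V θ).conjTranspose * (M.V θ * Y * (M.V θ).conjTranspose) =
        M.V θ * (X * Y) * (M.V θ).conjTranspose := fun X Y => by
    calc _ = M.V θ * X * ((M.V θ).conjTranspose * M.V θ) * Y * (M.V θ).conjTranspose := by
          simp only [Matrix.mul_assoc]
      _ = _ := by rw [hU, Matrix.mul_one]; simp only [Matrix.mul_assoc]
  have hinv : (M.Γ θ)⁻¹ = M.V θ * Matrix.diagonal (fun k => (M.γ θ k : ℂ)⁻¹) *
      (M.V θ).conjTranspose := by
    refine Matrix.inv_eq_right_inv ?_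
    rw [Γ, hcancel, Matrix.diagonal_mul_diagonal]
    simp only [mul_inv_cancel₀ (hγ _), Matrix.diagonal_one, Matrix.mul_one, hU']
  rw [kernel, M.pdMatrix_ζ hV hθ, M.pdMatrix_ζ hV hθ, hinv, M.pdMatrix_Γ hV hθ,
    M.pdMatrix_Γ hV hθ, hcancel, hcancel, Matrix.conjTranspose_mul,
    Matrix.diagonal_conjTranspose, Matrix.diagonal_mul_diagonal, Matrix.diagonal_mul_diagonal,
    Matrix.mul_assoc, ← Matrix.mul_assoc (Matrix.diagonal _), Matrix.diagonal_mul_diagonal,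
    ← Matrix.mul_assoc, ← Matrix.smul_mul, ← Matrix.mul_smul, ← Matrix.diagonal_smul]
  congr 3
  funext k
  have hsq : ((Real.sqrt (M.γ θ k) : ℝ) : ℂ) * (Real.sqrt (M.γ θ k) : ℝ) = (M.γ θ k : ℂ) := by
    rw [← Complex.ofReal_mul, Real.mul_self_sqrt (M.γ_pos θ hθ k).le]
  have hs0 : ((Real.sqrt (M.γ θ k) : ℝ) : ℂ) ≠ 0 :=
    Complex.ofReal_ne_zero.2 (Real.sqrt_pos.2 (M.γ_pos θ hθ k)).ne'
  simp only [Pi.smul_apply, Pi.star_apply, smul_eq_mul, Complex.star_def, Complex.conj_ofReal,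
    M.pd_sqrt_γ hθ, ← hsq]
  push_cast
  field_simp
  ring

end Model

end CollisionalQFI

/-! ### Assembly of the proposition -/

theorem proposition1
    {H : Type*} [NormedAddCommGroup H] [InnerProductSpace ℂ H] [CompleteSpace H]
    {ι : Type*} [Countable ι] (b : HilbertBasis ι ℂ H) {d R : ℕ}
    (M : CollisionalQFI.Model H d R)
    -- the eigenframe does not depend on the parameters: `∂_α V = 0` on the parameter domain
    (hV : ∀ θ ∈ M.dom, ∀ (α : Fin d) (i k : Fin R),
      HasLineDerivAt ℝ (fun θ' => M.V θ' i k) 0 θ (CollisionalQFI.dir α))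
    (θ : Fin d → ℝ) (hθ : θ ∈ M.dom) :
    -- the kernel
    (∀ α β : Fin d, M.kernel θ α β =
      CollisionalQFI.pdMatrix β M.Γ θ * (M.Γ θ)⁻¹ * CollisionalQFI.pdMatrix α M.Γ θ) ∧
    -- `Ψ(θ;t)` is a purification of `ρ(θ;t)` and has partial derivatives in the parameters
    (∀ t : ℝ, 0 ≤ t →
      CollisionalQFI.Purifies b (M.purification t θ) (M.ρ θ t) ∧
      ∀ α : Fin d, CollisionalQFI.HasPd α (M.purification t) θ) ∧
    -- the flow of the quantum Fisher information matrix
    (∀ t : ℝ, 0 ≤ t → ∀ α β : Fin d,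
      HasDerivWithinAt (fun s => M.collisionalQFI θ s α β)
        (4 * ∑ k, CollisionalQFI.pd α (fun θ' => Real.sqrt (M.γ θ' k)) θ *
          CollisionalQFI.pd β (fun θ' => Real.sqrt (M.γ θ' k)) θ *
          (CollisionalQFI.opTrace b (star (M.J θ k) * M.J θ k * M.ρ θ t)).re)
        (Set.Ici 0) t) ∧
    -- the precision bound, for every measurement and all unbiased estimators
    (∀ (t T : ℝ) (ν : ℕ), 0 ≤ t → T = ν * t →
      ∀ {Ω : Type*} [Fintype Ω] (P : CollisionalQFI.POVM H Ω) (est : (Fin ν → Ω) → Fin d → ℝ),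
      CollisionalQFI.LocallyUnbiased b M P t ν est θ →
      ∀ α : Fin d,
        0 < CollisionalQFI.covMatrix b M P t ν est θ α α ∧
        CollisionalQFI.precision b M P t ν est θ α ≤ ν * M.collisionalQFI θ t α α ∧
        CollisionalQFI.precision b M P t ν est θ α ≤
          T * ∑ k, (CollisionalQFI.pd α (fun θ' => M.γ θ' k) θ) ^ 2 / M.γ θ k *
            ‖M.J θ k‖ ^ 2) := by
  refine ⟨M.kernel_eq hV hθ, fun t ht => ⟨M.purifies b (M.γ_nonneg hθ) ht,
    M.hasPd_purification hV hθ ht⟩, fun t ht α β => ?_, ?_⟩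
  · simp only [M.emissionRate_eq_opTrace hθ b _ ht]
    exact M.hasDerivWithinAt_collisionalQFI hV hθ ht α β
  · intro t T ν ht hT Ω _ P est hest α
    obtain ⟨h1, h0⟩ := M.one_le_qfi_mul_covMatrix b P hV hθ ht hest α
    -- Zero variance would contradict 1 ≤ ν F_Q Σ. This also disposes of ν = 0 and t = 0, where
    -- local unbiasedness cannot hold.
    have hpos : 0 < CollisionalQFI.covMatrix b M P t ν est θ α α := by
      refine lt_of_le_of_ne h0 fun h => ?_
      rw [← h, mul_zero] at h1
      exact absurd h1 (by norm_num)
    have hprec : CollisionalQFI.precision b M P t ν est θ α ≤ ν * M.collisionalQFI θ t α α :=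
      (div_le_iff₀ hpos).2 h1
    refine ⟨hpos, hprec, hprec.trans ?_⟩
    rw [hT, mul_assoc]
    exact mul_le_mul_of_nonneg_left (M.collisionalQFI_self_le hV hθ ht α) ν.cast_nonneg
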